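/- Fix $m\ge 1$. Manifolds are piecewise linear (PL), Hausdorff and second countable, may have boundary and need not be connected; homeomorphisms are PL. A codimension-$0$ submanifold $Q$ of an $m$-manifold $M$ is clean if it is closed in $M$ and its point-set frontier $\operatorname{Fr}_M Q$ is a properly embedded, locally flat $(m-1)$-submanifold of $M$; the same notion is used for codimension-$0$ submanifolds of a manifold $\partial W$. A clean neighborhood of infinity in $M$ is a clean codimension-$0$ submanifold $N\subseteq M$ with $\overline{M\setminus N}$ compact. It is a homotopy collar if $\operatorname{Fr}_M N\hookrightarrow N$ is a homotopy equivalence. A pseudo-collar in $M$ is a homotopy collar $N$ such that for every compact $K\subseteq M$ there is a homotopy collar $N'\subseteq N$ in $M$ with $N'\cap K=\emptyset$. A relative cobordism $(W,A,B)$ is a compact $m$-manifold $W$ with disjoint clean codimension-$0$ submanifolds $A,B$ of $\partial W$; put $V=\partial W\setminus(\operatorname{int}A\cup\operatorname{int}B)$. It is a relative one-sided $h$-cobordism if one of the inclusions of pairs $(A,\partial A)\hookrightarrow(W,V)$, $(B,\partial B)\hookrightarrow(W,V)$ is a homotopy equivalence of pairs. A concatenation consists of, for each $i\ge 1$, a finite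 disjoint union $(W_i,A_i,B_i)=\bigsqcup_j (W_i^j,A_i^j,B_i^j)$ of relative one-sided $h$-cobordisms such that each $A_i^j\hookrightarrow W_i^j$ is a homotopy equivalence, together with a homeomorphism $h_i\colon D_i\to A_{i+1}$ from a clean codimension-$0$ submanifold $D_i$ of $\partial W_i$ with $D_i\subseteq B_i$ onto $A_{i+1}$. (The case $D_i=B_i$ is allowed.) Let $X=W_1\cup_{h_1}W_2\cup_{h_2}W_3\cup_{h_3}\cdots$ be the adjunction space. A realization of the concatenation by a clean neighborhood of infinity $N$ in an $m$-manifold $M$ is a homeomorphism $e\colon X\to N$ that is PL on each $W_i$ and satisfies $e(A_1)=\operatorname{Fr}_M N$. Proposition. (1) Every concatenation is realized by a clean neighborhood of infinity in some $m$-manifold, and whenever a clean neighborhood of infinity $N$ in an $m$-manifold $M$ realizes a concatenation, $N$ is a pseudo-collar in $M$. (2) Conversely, every pseudo-collar $N$ in every $m$-manifold $M$ realizes some concatenation; moreover the concatenation can be chosen so that each pair inclusion $(A_i^j,\partial A_i^j)\hookrightarrow(W_i^j,V_i^j)$ is a homotopy equivalence of pairs and $D_i\cap\partial B_i=\emptyset$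 for all $i$. -/

import Mathlib

open Set Filter Topology
open scoped Manifold ContinuousMap

universe u

noncomputable section

namespace PLTop

/-! ### Piecewise-linear manifolds (with boundary) and piecewise-linear maps -/

/-- Along the filter `l`, the map `v` is, as a function of the coordinates `u`, a selection from a
finite set of affine maps. A continuous map on an open piece of a polyhedron is piecewise linear
near a point if and only if it is such a selection near that point: the loci where two of the
affine maps agree cut a neighborhood into finitely many polyhedral cells, and on the interior of
each cell a continuous selection agrees with a single affine map. -/
def AffineSelection (m : ℕ) {X : Type*} (l : Filter X) (u v : X → EuclideanSpace ℝ (Fin m)) :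
    Prop :=
  ∃ F : Set (EuclideanSpace ℝ (Fin m) →ᵃ[ℝ] EuclideanSpace ℝ (Fin m)),
    F.Finite ∧ ∀ᶠ q in l, ∃ α ∈ F, v q = α (u q)

/-- Piecewise-linear maps between open subsets of the half-space `{x : x 0 ≥ 0}`. -/
def plPregroupoid (m : ℕ) [NeZero m] : Pregroupoid (EuclideanHalfSpace m) where
  property f s := ContinuousOn f s ∧
    ∀ x ∈ s, AffineSelection m (𝓝[s] x) (fun y => y.val) (fun y => (f y).val)
  comp := by
    rintro f g s t ⟨hf, hf'⟩ ⟨hg, hg'⟩ - - -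
    refine ⟨hg.comp (hf.mono inter_subset_left) fun x hx => hx.2, ?_⟩
    rintro x ⟨hxs, hxt⟩
    obtain ⟨F, hF, hFx⟩ := hf' x hxs
    obtain ⟨G, hG, hGx⟩ := hg' (f x) hxt
    refine ⟨Set.image2 (fun β α => AffineMap.comp β α) G F, hG.image2 _ hF, ?_⟩
    have hlim : Tendsto f (𝓝[s ∩ f ⁻¹' t] x) (𝓝[t] (f x)) :=
      tendsto_nhdsWithin_of_tendsto_nhds_of_eventually_within _
        ((hf x hxs).mono_left (nhdsWithin_mono _ inter_subset_left))
        (eventually_nhdsWithin_of_forall fun y hy => hy.2)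
    filter_upwards [hlim.eventually hGx, nhdsWithin_mono x inter_subset_left hFx]
      with y hy1 hy2
    obtain ⟨β, hβ, hβy⟩ := hy1
    obtain ⟨α, hα, hαy⟩ := hy2
    refine ⟨β.comp α, ⟨β, hβ, α, hα, rfl⟩, ?_⟩
    simp only [Function.comp_apply, AffineMap.comp_apply]
    rw [hβy, hαy]
  id_mem := ⟨continuousOn_id, fun x _ => ⟨{AffineMap.id ℝ _}, Set.finite_singleton _,
    Eventually.of_forall fun q => ⟨_, rfl, rfl⟩⟩⟩
  locality := by
    intro f s hs h
    refine ⟨fun x hx => ?_, fun x hx => ?_⟩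
    · obtain ⟨v, hv, hxv, hc, -⟩ := h x hx
      have h1 := hc x ⟨hx, hxv⟩
      rwa [continuousWithinAt_inter (hv.mem_nhds hxv)] at h1
    · obtain ⟨v, hv, hxv, -, ha⟩ := h x hx
      have h1 := ha x ⟨hx, hxv⟩
      rwa [nhdsWithin_inter_of_mem' (mem_nhdsWithin_of_mem_nhds (hv.mem_nhds hxv))] at h1
  congr := by
    rintro f g s - hfg ⟨hc, ha⟩
    refine ⟨hc.congr hfg, fun x hx => ?_⟩
    obtain ⟨F, hF, hFx⟩ := ha x hx
    refine ⟨F, hF, ?_⟩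
    filter_upwards [hFx, self_mem_nhdsWithin] with y hy hys
    rw [hfg y hys]
    exact hy

/-- The structure groupoid of piecewise-linear homeomorphisms between open subsets of the
half-space. A PL `m`-manifold with (possibly empty) boundary is a Hausdorff second countable space
charted on `EuclideanHalfSpace m` whose transition maps lie in this groupoid. -/
def plGroupoid (m : ℕ) [NeZero m] : StructureGroupoid (EuclideanHalfSpace m) :=
  (plPregroupoid m).groupoid

/-- A map from a subset `S` of a PL manifold (in all uses a subpolyhedron: a codimension-zero
submanifold of the boundary, or everything) to a PL manifold is piecewise linear: it is continuous
and, in charts, locally a selection from finitely many affine maps. -/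
def IsPL (m : ℕ) [NeZero m] {X Y : Type*} [TopologicalSpace X] [TopologicalSpace Y]
    [ChartedSpace (EuclideanHalfSpace m) X] [ChartedSpace (EuclideanHalfSpace m) Y]
    {S : Set X} (f : S → Y) : Prop :=
  Continuous f ∧ ∀ p : S, AffineSelection m (𝓝 p)
    (fun q => (chartAt (EuclideanHalfSpace m) (p : X) (q : X)).val)
    (fun q => (chartAt (EuclideanHalfSpace m) (f p) (f q)).val)

/-- The manifold boundary `∂X`. -/
def bdry (m : ℕ) [NeZero m] (X : Type*) [TopologicalSpace X]
    [ChartedSpace (EuclideanHalfSpace m) X] : Set X :=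
  (modelWithCornersEuclideanHalfSpace m).boundary X

/-- A clean codimension-zero submanifold `Q` of `X`: a closed subset whose point-set frontier is a
properly embedded, locally flat submanifold of codimension one. In terms of local models: around
each frontier point there is a PL chart (into the half-space `{x : x 0 ≥ 0}`, with `x 0 = 0`
corresponding to `∂X`) in which `Q` is a half-space `{x : x i ≥ c}`. At a frontier point on `∂X`
the index `i` is automatically nonzero, so that the frontier meets `∂X` transversally. -/
def IsClean (m : ℕ) [NeZero m] {X : Type*} [TopologicalSpace X]
    [ChartedSpace (EuclideanHalfSpace m) X] (Q : Set X) : Prop :=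
  IsClosed Q ∧ ∀ p ∈ frontier Q,
    ∃ φ ∈ StructureGroupoid.maximalAtlas X (plGroupoid m), p ∈ φ.source ∧
      ∃ i : Fin m, ∀ q ∈ φ.source, q ∈ Q ↔ (φ p).val i ≤ (φ q).val i

/-- For a codimension-zero submanifold `A` of `∂X`, its boundary `∂A` (the frontier of `A` in the
boundaryless manifold `∂X`). -/
def edge (m : ℕ) [NeZero m] {X : Type*} [TopologicalSpace X]
    [ChartedSpace (EuclideanHalfSpace m) X] (A : Set X) : Set X :=
  A ∩ closure (bdry m X \ A)

/-- A clean codimension-zero submanifold `A` of the boundary `∂X`: the notion `IsClean` inside the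
boundaryless manifold `∂X`, where the charts of `∂X` are restrictions of charts of `X`. -/
def IsCleanInBdry (m : ℕ) [NeZero m] {X : Type*} [TopologicalSpace X]
    [ChartedSpace (EuclideanHalfSpace m) X] (A : Set X) : Prop :=
  A ⊆ bdry m X ∧ IsClosed A ∧ ∀ p ∈ edge m A,
    ∃ φ ∈ StructureGroupoid.maximalAtlas X (plGroupoid m), p ∈ φ.source ∧
      ∃ i : Fin m, ∀ q ∈ φ.source ∩ bdry m X, q ∈ A ↔ (φ p).val i ≤ (φ q).val i

/-! ### Homotopy equivalences -/

/-- `S ⊆ T`, and the inclusion `S ↪ T` is a homotopy equivalence. -/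
def InclIsHEquiv {X : Type*} [TopologicalSpace X] (S T : Set X) : Prop :=
  ∃ e : ContinuousMap.HomotopyEquiv S T, ∀ x : S, (e x : X) = x

/-- The inclusion of pairs `(S, S') ↪ (T, T')` is a homotopy equivalence of pairs. -/
def InclIsPairHEquiv {X : Type*} [TopologicalSpace X] (S S' T T' : Set X) : Prop :=
  S' ⊆ S ∧ T' ⊆ T ∧ S' ⊆ T' ∧
  ∃ (ι : C(S, T)) (g : C(T, S)), (∀ x : S, (ι x : X) = x) ∧
    (∀ x : T, (x : X) ∈ T' → (g x : X) ∈ S') ∧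
    (∃ H : ContinuousMap.Homotopy (ι.comp g) (ContinuousMap.id T),
      ∀ t, ∀ x : T, (x : X) ∈ T' → (H (t, x) : X) ∈ T') ∧
    (∃ K : ContinuousMap.Homotopy (g.comp ι) (ContinuousMap.id S),
      ∀ t, ∀ x : S, (x : X) ∈ S' → (K (t, x) : X) ∈ S')

/-! ### Pseudo-collars -/

section PseudoCollar

variable (m : ℕ) [NeZero m] {M : Type*} [TopologicalSpace M]
  [ChartedSpace (EuclideanHalfSpace m) M]

/-- A clean neighborhood of infinity. -/
def IsCleanNbhdInfinity (N : Set M) : Prop :=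
  IsClean m N ∧ IsCompact (closure Nᶜ)

/-- A homotopy collar: a clean neighborhood of infinity `N` for which `Fr N ↪ N` is a homotopy
equivalence. -/
def IsHomotopyCollar (N : Set M) : Prop :=
  IsCleanNbhdInfinity m N ∧ InclIsHEquiv (frontier N) N

/-- A pseudo-collar: a homotopy collar that contains arbitrarily small homotopy collar
neighborhoods of infinity. -/
def IsPseudoCollar (N : Set M) : Prop :=
  IsHomotopyCollar m N ∧
    ∀ K : Set M, IsCompact K → ∃ N' : Set M, N' ⊆ N ∧ Disjoint N' K ∧ IsHomotopyCollar m N'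

end PseudoCollar

/-! ### Relative cobordisms -/

/-- A (compact) relative cobordism `(W, A, B)` of dimension `m`: `A` and `B` are disjoint clean
codimension-zero submanifolds of `∂W`. -/
structure RelCobordism (m : ℕ) [NeZero m] : Type (u + 1) where
  W : Type u
  [top : TopologicalSpace W]
  [charted : ChartedSpace (EuclideanHalfSpace m) W]
  [pl : HasGroupoid W (plGroupoid m)]
  [t2 : T2Space W]
  [secondCountable : SecondCountableTopology W]
  [compact : CompactSpace W]
  A : Set W
  B : Set W
  cleanA : IsCleanInBdry m A
  cleanB : IsCleanInBdry m B
  disj : Disjoint A B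

attribute [instance] RelCobordism.top RelCobordism.charted RelCobordism.pl RelCobordism.t2
  RelCobordism.secondCountable RelCobordism.compact

namespace RelCobordism

variable {m : ℕ} [NeZero m] (c : RelCobordism.{u} m)

/-- `V = ∂W \ (int A ∪ int B)`. -/
def V : Set c.W := bdry m c.W \ ((c.A \ edge m c.A) ∪ (c.B \ edge m c.B))

/-- `(A, ∂A) ↪ (W, V)` is a homotopy equivalence of pairs. -/
def PairHEquivA : Prop := InclIsPairHEquiv c.A (edge m c.A) univ c.V

/-- `(B, ∂B) ↪ (W, V)` is a homotopy equivalence of pairs. -/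
def PairHEquivB : Prop := InclIsPairHEquiv c.B (edge m c.B) univ c.V

/-- Relative one-sided h-cobordism. -/
def IsOneSidedHCobordism : Prop := c.PairHEquivA ∨ c.PairHEquivB

end RelCobordism

/-! ### Disjoint unions -/

section Sigma

variable {k : ℕ} {m : ℕ} [NeZero m]

instance : Nonempty (EuclideanHalfSpace m) := ⟨⟨0, le_refl _⟩⟩

/-- The disjoint union of a finite family of cobordisms. -/
abbrev DisjUnion (c : Fin k → RelCobordism.{u} m) : Type u := Σ j, (c j).W

/-- The disjoint union of charted spaces is charted by the charts of the summands. -/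
instance DisjUnion.charted (c : Fin k → RelCobordism.{u} m) :
    ChartedSpace (EuclideanHalfSpace m) (DisjUnion c) where
  atlas := ⋃ j, (fun φ : OpenPartialHomeomorph (c j).W (EuclideanHalfSpace m) =>
    φ.lift_openEmbedding (IsOpenEmbedding.sigmaMk (σ := fun j => (c j).W) (i := j))) ''
      atlas (EuclideanHalfSpace m) (c j).W
  chartAt p := (chartAt (EuclideanHalfSpace m) p.2).lift_openEmbedding
    (IsOpenEmbedding.sigmaMk (σ := fun j => (c j).W) (i := p.1))
  mem_chart_source p := ⟨p.2, mem_chart_source _ p.2, rfl⟩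
  chart_mem_atlas p := mem_iUnion.2 ⟨p.1, _, chart_mem_atlas _ p.2, rfl⟩

instance DisjUnion.hasGroupoid (c : Fin k → RelCobordism.{u} m) :
    HasGroupoid (DisjUnion c) (plGroupoid m) where
  compatible := by
    intro e e' he he'
    obtain ⟨j, φ, hφ, rfl⟩ := mem_iUnion.1 he
    obtain ⟨j', ψ, hψ, rfl⟩ := mem_iUnion.1 he'
    by_cases hj : j = j'
    · subst hj
      rw [OpenPartialHomeomorph.lift_openEmbedding_trans]
      exact HasGroupoid.compatible hφ hψ
    · have key : ∀ x ∈ (((φ.lift_openEmbedding (IsOpenEmbedding.sigmaMk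
          (σ := fun j => (c j).W) (i := j))).symm.trans (ψ.lift_openEmbedding
          (IsOpenEmbedding.sigmaMk (σ := fun j => (c j).W) (i := j')))).source), False := by
        intro x hx
        rw [OpenPartialHomeomorph.trans_source] at hx
        obtain ⟨y, -, hy⟩ := hx.2
        exact hj (congrArg Sigma.fst hy).symm
      refine (plGroupoid m).locality' _ fun x hx => (key x hx).elim

/-- The disjoint union of the `A j`. -/
def unionA (c : Fin k → RelCobordism.{u} m) : Set (DisjUnion c) := {p | p.2 ∈ (c p.1).A}

/-- The disjoint union of the `B j`. -/
def unionB (c : Fin k → RelCobordism.{u} m) : Set (DisjUnion c) := {p | p.2 ∈ (c p.1).B}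

end Sigma

/-! ### Concatenations -/

/-- The data for a countable concatenation: for every `i`, a finite family `(W i j, A i j, B i j)`
of relative one-sided h-cobordisms with `A i j ↪ W i j` a homotopy equivalence, with disjoint
union `(W i, A i, B i)`, and a PL homeomorphism `h i` from a clean codimension-zero submanifold
`D i` of `B i` onto `A (i + 1)`. -/
structure Concatenation (m : ℕ) [NeZero m] : Type (u + 1) where
  k : ℕ → ℕ
  cob : ∀ i, Fin (k i) → RelCobordism.{u} m
  oneSided : ∀ i j, (cob i j).IsOneSidedHCobordism
  hequiv : ∀ i j, InclIsHEquiv (cob i j).A univ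
  D : ∀ i, Set (DisjUnion (cob i))
  D_sub : ∀ i, D i ⊆ unionB (cob i)
  D_clean : ∀ i, IsCleanInBdry m (D i)
  h : ∀ i, D i ≃ₜ unionA (cob (i + 1))
  h_pl : ∀ i, IsPL m (fun p : D i => (h i p : DisjUnion (cob (i + 1))))
  h_symm_pl : ∀ i, IsPL m
    (fun p : unionA (cob (i + 1)) => ((h i).symm p : DisjUnion (cob i)))

namespace Concatenation

variable {m : ℕ} [NeZero m] (C : Concatenation.{u} m)

/-- The identifications `b ∼ h i b`. -/
inductive Glue : (Σ i, DisjUnion (C.cob i)) → (Σ i, DisjUnion (C.cob i)) → Prop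
  | glue (i : ℕ) (b : C.D i) : Glue ⟨i, b.1⟩ ⟨i + 1, (C.h i b).1⟩

/-- The adjunction space `W 0 ∪ W 1 ∪ W 2 ∪ ⋯`, with the quotient topology. -/
def Space : Type u := Quot C.Glue

instance : TopologicalSpace C.Space :=
  inferInstanceAs (TopologicalSpace (Quot C.Glue))

/-- The canonical map of `W i` to the adjunction space. -/
def piece (i : ℕ) (p : DisjUnion (C.cob i)) : C.Space := Quot.mk C.Glue ⟨i, p⟩

/-- `e` identifies the adjunction space with the clean neighborhood of infinity `N` of the PL
manifold `M`, respecting the PL structures, in such a way that the initial end `A 0` is the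
frontier of `N`. -/
def Realizes {M : Type*} [TopologicalSpace M] [ChartedSpace (EuclideanHalfSpace m) M]
    (N : Set M) (e : C.Space → M) : Prop :=
  IsCleanNbhdInfinity m N ∧ IsEmbedding e ∧ range e = N ∧
    (∀ i, IsPL m (fun p : (univ : Set (DisjUnion (C.cob i))) => e (C.piece i p))) ∧
    (fun p => e (C.piece 0 p)) '' unionA (C.cob 0) = frontier N

end Concatenation

end PLTop

end

/-! Why concatenations give pseudo-collars. A compact clean submanifold of the boundary is a
neighborhood deformation retract, because it has half-space models (`IsCleanInBdry.isNDR`). Hence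
the homotopy equivalence from `A i` to `W i` improves to a strong deformation retraction
(`IsNDR.isSDR`). In the adjunction space the `k`-th piece is retracted during the time interval from
`2^-(k+1)` to `2^-k`. The pieces are locally finite, so the infinite concatenation of these
retractions is continuous (`isSDR_iUnion`), and it retracts each tail onto the initial end of its
first piece. That end is the frontier of the tail, and the tails leave every compact set, so they
are the required small homotopy collars (`IsChain.isPseudoCollar`).

Why concatenations are realized. A second copy of the first piece is glued to the adjunction space
along `A 0`, which puts `A 0` in the position of a frontier. The result is a manifold: near a corner
of `A i` the half-space is PL homeomorphic to a quadrant with `A i` as one wall, and two quadrants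
whose coordinates match along a wall form a half-space (`exists_matching_chart`,
`exists_glued_chart`).

Why pseudo-collars are concatenations. Choose homotopy collars `S 0 = N`, `S 1`, ..., each in the
interior of the preceding one and leaving every compact set. The layer `S i \ interior (S (i + 1))`
is a compact PL manifold between two frontiers. As `S (i + 1)` retracts onto its frontier, `S i`
retracts onto the layer, so the initial frontier is homotopy equivalent to the layer. To obtain an
equivalence of pairs, the initial end `A` is enlarged in the boundary to `A'`, which contains `A` in
its interior, misses the terminal end `D` and deforms onto `A` without entering the interior of `A`
from outside. With `B` the closure of the complement of `A'`, the set `V` is `A'` minus the interior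
of `A`, and retracting the layer to `A'` and then to `A` preserves `V` (`exists_complement`). The
edge of `B` lies in `A'`, hence off `D`. The enlargement is a finite composition of PL pushes in
charts (`IsCleanInBdry.exists_isEnlargement`), so no collar theorem is needed.

Two facts about PL maps support all of this: the inverse of an injective PL map is PL
(`AffineSelection.symm`), so compatibility has to be checked in one direction only, and PL
coordinate changes preserve the boundary (`mem_bdry_iff`). -/

set_option linter.unusedSectionVars false

namespace PLTop

/-! ### Calculus of selections from finitely many affine maps -/

section Selection

variable {m : ℕ} {X Y : Type*} {l l' : Filter X} {u v w u' v' : X → EuclideanSpace ℝ (Fin m)}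

theorem AffineSelection.of_affine (α : EuclideanSpace ℝ (Fin m) →ᵃ[ℝ] EuclideanSpace ℝ (Fin m))
    (h : ∀ᶠ q in l, v q = α (u q)) : AffineSelection m l u v :=
  ⟨{α}, Set.finite_singleton _, h.mono fun _ hq => ⟨α, rfl, hq⟩⟩

theorem AffineSelection.refl : AffineSelection m l u u :=
  .of_affine (AffineMap.id ℝ _) (Eventually.of_forall fun _ => rfl)

theorem AffineSelection.iSup {ι : Type*} [Finite ι] {f : ι → Filter X}
    (h : ∀ i, AffineSelection m (f i) u v) : AffineSelection m (⨆ i, f i) u v := by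
  choose F hF h using h
  refine ⟨⋃ i, F i, Set.finite_iUnion hF, eventually_iSup.2 fun i => ?_⟩
  exact (h i).mono fun q ⟨α, hα, e⟩ => ⟨α, mem_iUnion.2 ⟨i, hα⟩, e⟩

theorem AffineSelection.trans (h : AffineSelection m l u v) (h' : AffineSelection m l v w) :
    AffineSelection m l u w := by
  obtain ⟨F, hF, h⟩ := h
  obtain ⟨G, hG, h'⟩ := h'
  refine ⟨Set.image2 (fun β α => AffineMap.comp β α) G F, hG.image2 _ hF, ?_⟩
  filter_upwards [h, h'] with q ⟨α, hα, e⟩ ⟨β, hβ, e'⟩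
  exact ⟨_, ⟨β, hβ, α, hα, rfl⟩, by simp [e', e]⟩

theorem AffineSelection.congr (h : AffineSelection m l u v) (hu : u =ᶠ[l] u')
    (hv : v =ᶠ[l] v') : AffineSelection m l u' v' := by
  obtain ⟨F, hF, h⟩ := h
  refine ⟨F, hF, ?_⟩
  filter_upwards [h, hu, hv] with q ⟨α, hα, e⟩ h1 h2
  exact ⟨α, hα, by rw [← h2, ← h1, e]⟩

theorem AffineSelection.comp_tendsto {k : Filter Y} {f : Y → X} (h : AffineSelection m l u v)
    (hf : Tendsto f k l) : AffineSelection m k (fun y => u (f y)) (fun y => v (f y)) := by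
  obtain ⟨F, hF, h⟩ := h
  exact ⟨F, hF, hf.eventually h⟩

theorem affineSelection_map_iff {k : Filter Y} {f : Y → X} :
    AffineSelection m (map f k) u v ↔ AffineSelection m k (fun y => u (f y)) (fun y => v (f y)) :=
  Iff.rfl

end Selection

/-- If finitely many sets cover a nonempty open set then one of them is dense in a nonempty open
subset. -/
theorem exists_isOpen_subset_closure {X ι : Type*} [TopologicalSpace X] {F : Set ι}
    (hF : F.Finite) (S : ι → Set X) : ∀ B : Set X, IsOpen B → B.Nonempty →
    B ⊆ ⋃ a ∈ F, S a → ∃ a ∈ F, ∃ B' ⊆ B, IsOpen B' ∧ B'.Nonempty ∧ B' ⊆ closure (S a) := by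
  induction F, hF using Set.Finite.induction_on with
  | empty =>
    intro B _ hne hB
    obtain ⟨x, hx⟩ := hne
    simpa using hB hx
  | @insert a F _ _ ih =>
    intro B hBo hne hB
    by_cases hc : (B \ closure (S a)).Nonempty
    · obtain ⟨b, hb, B', h1, h2⟩ := ih (B \ closure (S a)) (hBo.sdiff isClosed_closure) hc (by
        rintro x ⟨hx, hx'⟩
        have := hB hx
        rw [biUnion_insert] at this
        exact this.resolve_left fun h => hx' (subset_closure h))
      exact ⟨b, .inr hb, B', h1.trans sdiff_subset, h2⟩
    · refine ⟨a, .inl rfl, B, subset_rfl, hBo, hne, fun x hx => ?_⟩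
      by_contra h
      exact hc ⟨x, hx, h⟩

/-! ### The half-space, and inverses of piecewise linear maps -/

section HalfSpace

variable {m : ℕ} [NeZero m]

/-- The retraction of Euclidean space onto the half-space. -/
noncomputable def toHalf (m : ℕ) [NeZero m] : EuclideanSpace ℝ (Fin m) → EuclideanHalfSpace m :=
  (modelWithCornersEuclideanHalfSpace m).symm

theorem continuous_toHalf : Continuous (toHalf m) :=
  (modelWithCornersEuclideanHalfSpace m).continuous_symm

theorem continuous_val : Continuous (Subtype.val : EuclideanHalfSpace m → _) :=
  continuous_subtype_val

theorem toHalf_val {x : EuclideanSpace ℝ (Fin m)} (hx : 0 ≤ x 0) : (toHalf m x).val = x :=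
  (modelWithCornersEuclideanHalfSpace m).right_inv (x := x)
    (by change x ∈ range (Subtype.val : EuclideanHalfSpace m → _)
        rw [range_euclideanHalfSpace]; exact hx)

theorem val_toHalf (x : EuclideanHalfSpace m) : toHalf m x.val = x :=
  (modelWithCornersEuclideanHalfSpace m).left_inv x

theorem toHalf_mk {x : EuclideanSpace ℝ (Fin m)} (hx : 0 ≤ x 0) : toHalf m x = ⟨x, hx⟩ :=
  Subtype.ext (toHalf_val hx)

theorem continuous_coord (i : Fin m) : Continuous fun x : EuclideanSpace ℝ (Fin m) => x i := by
  fun_prop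

theorem continuous_valCoord (i : Fin m) : Continuous fun x : EuclideanHalfSpace m => x.val i :=
  (continuous_coord i).comp continuous_val

/-- A boundary point of `V` is first moved inwards along coordinate `0`; around the moved point a
full Euclidean ball stays in the half-space. -/
theorem exists_ball_subset_of_isOpen {V : Set (EuclideanHalfSpace m)} (hV : IsOpen V)
    (hne : V.Nonempty) : ∃ y : EuclideanSpace ℝ (Fin m), ∃ ε > 0, ∀ z ∈ Metric.ball y ε,
      ∃ hz : 0 ≤ z 0, (⟨z, hz⟩ : EuclideanHalfSpace m) ∈ V := by
  obtain ⟨x, hx⟩ := hne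
  let f : ℝ → EuclideanSpace ℝ (Fin m) := fun t => x.val + t • EuclideanSpace.single 0 1
  have hf : Continuous f := by fun_prop
  have hf0 : f 0 = x.val := by simp [f]
  have hft : ∀ t, f t 0 = x.val 0 + t := fun t => by simp [f]
  have hO : IsOpen (toHalf m ⁻¹' V) := hV.preimage continuous_toHalf
  have h0 : (0 : ℝ) ∈ f ⁻¹' (toHalf m ⁻¹' V) := by
    rw [mem_preimage, hf0, mem_preimage, val_toHalf]; exact hx
  obtain ⟨δ, hδ, hb⟩ := Metric.isOpen_iff.1 (hO.preimage hf) 0 h0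
  have ht : f (δ / 2) ∈ toHalf m ⁻¹' V ∩ {z | 0 < z 0} := by
    refine ⟨hb (by simp [abs_of_pos hδ, hδ]), ?_⟩
    have := x.2
    simp only [mem_ofPred_eq, hft]; linarith
  obtain ⟨ε, hε, hb'⟩ := Metric.isOpen_iff.1
    (hO.inter (isOpen_lt continuous_const (continuous_coord 0))) _ ht
  refine ⟨f (δ / 2), ε, hε, fun z hz => ?_⟩
  obtain ⟨h1, h2⟩ := hb' hz
  refine ⟨le_of_lt h2, ?_⟩
  rw [← toHalf_mk]; exact h1

theorem affineMap_injective_of_injOn_ball {E F : Type*} [NormedAddCommGroup E] [NormedSpace ℝ E]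
    [AddCommGroup F] [Module ℝ F] (α : E →ᵃ[ℝ] F) {y : E} {ε : ℝ} (hε : 0 < ε)
    (h : InjOn α (Metric.ball y ε)) : Function.Injective α := by
  rw [← AffineMap.linear_injective_iff, injective_iff_map_eq_zero]
  intro k hk
  by_contra hne
  have hk0 : 0 < ‖k‖ := norm_pos_iff.2 hne
  have h1 : α ((ε / 2 / ‖k‖) • k +ᵥ y) = α y := by
    rw [AffineMap.map_vadd, map_smul, hk, smul_zero, zero_vadd]
  have h2 := h (by
    simp only [vadd_eq_add, Metric.mem_ball, dist_add_self_left, norm_smul, norm_div, norm_norm]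
    rw [div_mul_cancel₀ _ hk0.ne', Real.norm_eq_abs, Real.norm_eq_abs, abs_of_pos hε, abs_two]
    linarith) (Metric.mem_ball_self hε) h1
  have h3 : (ε / 2 / ‖k‖) • k = 0 := by simpa using h2
  rcases smul_eq_zero.1 h3 with h | h
  · have : 0 < ε / 2 / ‖k‖ := by positivity
    linarith
  · exact hne h

theorem exists_affine_leftInverse
    (α : EuclideanSpace ℝ (Fin m) →ᵃ[ℝ] EuclideanSpace ℝ (Fin m)) (h : Function.Injective α) :
    ∃ β : EuclideanSpace ℝ (Fin m) →ᵃ[ℝ] EuclideanSpace ℝ (Fin m), ∀ x, β (α x) = x := by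
  have hb : Function.Bijective α := by
    refine ⟨h, (AffineMap.linear_surjective_iff α).1 ?_⟩
    exact LinearMap.injective_iff_surjective.1 ((AffineMap.linear_injective_iff α).2 h)
  exact ⟨(AffineEquiv.ofBijective hb).symm.toAffineMap, fun x =>
    (AffineEquiv.ofBijective hb).symm_apply_apply x⟩

theorem eqOn_of_subset_closure {X Z : Type*} [TopologicalSpace X] [TopologicalSpace Z] [T2Space Z]
    {f g : X → Z} {B S : Set X} (hB : IsOpen B) (hf : ContinuousOn f B) (hg : ContinuousOn g B)
    (hBS : B ⊆ closure S) (h : EqOn f g (S ∩ B)) : EqOn f g B := by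
  intro x hx
  have hx' : x ∈ closure (S ∩ B) := by
    rw [inter_comm]; exact hB.inter_closure ⟨hx, hBS hx⟩
  have := mem_closure_iff_nhdsWithin_neBot.1 hx'
  have h1 : Tendsto f (𝓝[S ∩ B] x) (𝓝 (f x)) := (hf x hx).mono inter_subset_right
  have h2 : Tendsto g (𝓝[S ∩ B] x) (𝓝 (g x)) := (hg x hx).mono inter_subset_right
  exact tendsto_nhds_unique (h1.congr' (eventually_nhdsWithin_of_forall fun y hy => h hy)) h2

/-- The inverse of an injective piecewise linear map is piecewise linear. -/
theorem AffineSelection.symm {X : Type*} [TopologicalSpace X]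
    {φ : OpenPartialHomeomorph X (EuclideanHalfSpace m)} {v : X → EuclideanSpace ℝ (Fin m)}
    {p : X} {U : Set X} (hU : U ∈ 𝓝 p) (hp : p ∈ φ.source) (hc : ContinuousOn v U)
    (hi : InjOn v U) (h : AffineSelection m (𝓝 p) (fun q => (φ q).val) v) :
    AffineSelection m (𝓝 p) v (fun q => (φ q).val) := by
  obtain ⟨F, hF, hFp⟩ := h
  obtain ⟨O, hOsub, hO, hpO⟩ := mem_nhds_iff.1
    (inter_mem (inter_mem hU (φ.open_source.mem_nhds hp)) hFp)
  have hOU : O ⊆ U := fun q hq => (hOsub hq).1.1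
  have hOs : O ⊆ φ.source := fun q hq => (hOsub hq).1.2
  have hφc : ContinuousOn (fun q => (φ q).val) O :=
    continuous_val.comp_continuousOn (φ.continuousOn.mono hOs)
  -- If no injective member of `F` represents `v` at `q`, then none does near `q`, so the
  -- non-injective members cover a neighborhood. One of them represents `v` on a dense part of some
  -- open set `B`, hence on all of `B` by continuity; as `v` is injective there, this member is
  -- injective after all.
  have key : ∀ q ∈ O, ∃ α ∈ F, Function.Injective α ∧ v q = α (φ q).val := by
    intro q hq
    by_contra hcon
    push Not at hcon
    set O' : Set X := ⋂ α ∈ {α ∈ F | Function.Injective α}, O ∩ {q | v q ≠ α (φ q).val} with hO'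
    have hO'o : IsOpen (O ∩ O') := by
      refine hO.inter (Set.Finite.isOpen_biInter (hF.subset fun α hα => hα.1) fun α _ => ?_)
      exact ((hc.mono hOU).prodMk (α.continuous_of_finiteDimensional.comp_continuousOn
        hφc)).isOpen_inter_preimage hO isClosed_diagonal.isOpen_compl
    obtain ⟨α, hα, B, hBO, hBo, hBne, hBcl⟩ := exists_isOpen_subset_closure
      (hF.subset (fun α hα => hα.1 : {α ∈ F | ¬ Function.Injective α} ⊆ F))
      (fun α => {q | v q = α (φ q).val}) (O ∩ O') hO'o ⟨q, hq, by
        simp only [hO', mem_iInter]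
        exact fun α hα => ⟨hq, hcon α hα.1 hα.2⟩⟩ (by
        rintro x ⟨hx, hx'⟩
        obtain ⟨α, hα, e⟩ := (hOsub hx).2
        refine mem_biUnion (x := α) ⟨hα, fun hinj => ?_⟩ e
        simp only [hO', mem_iInter] at hx'
        exact (hx' α ⟨hα, hinj⟩).2 e)
    have hBO' : B ⊆ O := fun x hx => (hBO hx).1
    have heq : EqOn v (fun q => α (φ q).val) B :=
      eqOn_of_subset_closure hBo (hc.mono (hBO'.trans hOU))
        (α.continuous_of_finiteDimensional.comp_continuousOn (hφc.mono hBO')) hBcl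
        fun x hx => hx.1
    obtain ⟨y, ε, hε, hb⟩ := exists_ball_subset_of_isOpen
      (φ.isOpen_image_of_subset_source hBo (hBO'.trans hOs)) (hBne.image φ)
    refine hα.2 (affineMap_injective_of_injOn_ball α (y := y) hε ?_)
    intro z hz z' hz' hzz
    obtain ⟨h1, x, hx, hxe⟩ := hb z hz
    obtain ⟨h2, x', hx', hxe'⟩ := hb z' hz'
    have e1 : (φ x).val = z := by rw [hxe]
    have e2 : (φ x').val = z' := by rw [hxe']
    have : v x = v x' := by rw [heq hx, heq hx']; simp only [e1, e2, hzz]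
    rw [← e1, ← e2, hi (hOU (hBO' hx)) (hOU (hBO' hx')) this]
  -- For non-injective `α` the value `inv α` is arbitrary; by `key` it is never used.
  choose! inv hinv using fun α : EuclideanSpace ℝ (Fin m) →ᵃ[ℝ] EuclideanSpace ℝ (Fin m) =>
    exists_affine_leftInverse α
  refine ⟨inv '' F, hF.image _, ?_⟩
  filter_upwards [hO.mem_nhds hpO] with q hq
  obtain ⟨α, hα, hinj, e⟩ := key q hq
  exact ⟨inv α, ⟨α, hα, rfl⟩, by rw [e, hinv α hinj]⟩

end HalfSpace

/-! ### The maximal PL atlas in terms of selections -/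

section Atlas

variable {m : ℕ} [NeZero m] {X : Type*} [TopologicalSpace X]

/-- Compatibility of two charts, in terms of selections. -/
theorem symm_trans_mem_plGroupoid_iff {φ ψ : OpenPartialHomeomorph X (EuclideanHalfSpace m)} :
    φ.symm.trans ψ ∈ plGroupoid m ↔ ∀ p ∈ φ.source ∩ ψ.source,
      AffineSelection m (𝓝 p) (fun q => (φ q).val) (fun q => (ψ q).val) ∧
      AffineSelection m (𝓝 p) (fun q => (ψ q).val) (fun q => (φ q).val) := by
  have key : ∀ φ ψ : OpenPartialHomeomorph X (EuclideanHalfSpace m), ∀ p ∈ φ.source ∩ ψ.source,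
      (AffineSelection m (𝓝[(φ.symm.trans ψ).source] (φ p)) (fun y => y.val)
        (fun y => ((φ.symm.trans ψ) y).val) ↔
      AffineSelection m (𝓝 p) (fun q => (φ q).val) (fun q => (ψ q).val)) := by
    intro φ ψ p hp
    have hmem : φ p ∈ (φ.symm.trans ψ).source := by
      simp [φ.map_source hp.1, φ.left_inv hp.1, hp.2]
    rw [(φ.symm.trans ψ).open_source.nhdsWithin_eq hmem, ← φ.map_nhds_eq hp.1,
      affineSelection_map_iff]
    have : ∀ᶠ q in 𝓝 p, φ.symm (φ q) = q := φ.eventually_left_inverse hp.1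
    constructor
    · intro h
      refine h.congr .rfl ?_
      filter_upwards [this] with q hq
      simp [hq]
    · intro h
      refine h.congr .rfl ?_
      filter_upwards [this] with q hq
      simp [hq]
  have hcont : ∀ φ ψ : OpenPartialHomeomorph X (EuclideanHalfSpace m),
      (∀ x ∈ (φ.symm.trans ψ).source,
        AffineSelection m (𝓝[(φ.symm.trans ψ).source] x) (fun y => y.val)
        (fun y => ((φ.symm.trans ψ) y).val)) ↔ ∀ p ∈ φ.source ∩ ψ.source,
      AffineSelection m (𝓝 p) (fun q => (φ q).val) (fun q => (ψ q).val) := by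
    intro φ ψ
    constructor
    · intro h p hp
      refine (key φ ψ p hp).1 (h _ ?_)
      simp [φ.map_source hp.1, φ.left_inv hp.1, hp.2]
    · intro h x hx
      rw [OpenPartialHomeomorph.trans_source] at hx
      have hx1 : x ∈ φ.target := hx.1
      have := (key φ ψ (φ.symm x) ⟨φ.map_target hx1, hx.2⟩).2 (h _ ⟨φ.map_target hx1, hx.2⟩)
      rwa [φ.right_inv hx1] at this
  have hs : (φ.symm.trans ψ).symm = ψ.symm.trans φ := by
    rw [OpenPartialHomeomorph.trans_symm_eq_symm_trans_symm, OpenPartialHomeomorph.symm_symm]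
  rw [plGroupoid, mem_groupoid_of_pregroupoid]
  change (_ ∧ _) ∧ (_ ∧ _) ↔ _
  have e2 : (φ.symm.trans ψ).target = (ψ.symm.trans φ).source := by
    rw [← OpenPartialHomeomorph.symm_source, hs]
  have e3 := hcont ψ φ
  rw [← hs] at e3
  rw [OpenPartialHomeomorph.symm_source] at e3
  constructor
  · rintro ⟨⟨-, h1⟩, -, h2⟩ p hp
    exact ⟨(hcont φ ψ).1 h1 p hp, e3.1 h2 p hp.symm⟩
  · intro h
    exact ⟨⟨(φ.symm.trans ψ).continuousOn, (hcont φ ψ).2 fun p hp => (h p hp).1⟩,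
      (φ.symm.trans ψ).symm.continuousOn, e3.2 fun p hp => (h p hp.symm).2⟩

variable [ChartedSpace (EuclideanHalfSpace m) X]

/-- The charts of the maximal piecewise linear atlas. -/
abbrev plCharts (m : ℕ) [NeZero m] (X : Type*) [TopologicalSpace X]
    [ChartedSpace (EuclideanHalfSpace m) X] :
    Set (OpenPartialHomeomorph X (EuclideanHalfSpace m)) :=
  StructureGroupoid.maximalAtlas X (plGroupoid m)

theorem affineSelection_of_mem [HasGroupoid X (plGroupoid m)]
    {φ ψ : OpenPartialHomeomorph X (EuclideanHalfSpace m)}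
    (hφ : φ ∈ plCharts m X) (hψ : ψ ∈ plCharts m X) {p : X} (hp : p ∈ φ.source)
    (hp' : p ∈ ψ.source) :
    AffineSelection m (𝓝 p) (fun q => (φ q).val) (fun q => (ψ q).val) :=
  (symm_trans_mem_plGroupoid_iff.1
    (StructureGroupoid.compatible_of_mem_maximalAtlas hφ hψ) p ⟨hp, hp'⟩).1

theorem chartAt_mem_plCharts [HasGroupoid X (plGroupoid m)] (p : X) :
    chartAt (EuclideanHalfSpace m) p ∈ plCharts m X :=
  StructureGroupoid.chart_mem_maximalAtlas _ p

theorem chart_val_continuousOn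
    (φ : OpenPartialHomeomorph X (EuclideanHalfSpace m)) :
    ContinuousOn (fun q => (φ q).val) φ.source :=
  continuous_val.comp_continuousOn φ.continuousOn

theorem chart_val_injOn
    (φ : OpenPartialHomeomorph X (EuclideanHalfSpace m)) :
    InjOn (fun q => (φ q).val) φ.source :=
  fun _ hx _ hy h => φ.injOn hx hy (Subtype.ext h)

/-- One direction suffices for membership in the maximal atlas. -/
theorem mem_plCharts [HasGroupoid X (plGroupoid m)]
    {φ : OpenPartialHomeomorph X (EuclideanHalfSpace m)}
    (h : ∀ p ∈ φ.source, ∃ ψ ∈ plCharts m X, p ∈ ψ.source ∧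
      AffineSelection m (𝓝 p) (fun q => (ψ q).val) (fun q => (φ q).val)) :
    φ ∈ plCharts m X := by
  have key : ∀ ψ ∈ plCharts m X, ∀ p ∈ φ.source, p ∈ ψ.source →
      AffineSelection m (𝓝 p) (fun q => (ψ q).val) (fun q => (φ q).val) ∧
      AffineSelection m (𝓝 p) (fun q => (φ q).val) (fun q => (ψ q).val) := by
    intro ψ hψ p hp hp'
    obtain ⟨χ, hχ, hpχ, hs⟩ := h p hp
    have h1 := (affineSelection_of_mem hψ hχ hp' hpχ).trans hs
    -- A chart is injective, so the reverse selection comes for free.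
    exact ⟨h1, AffineSelection.symm (φ.open_source.mem_nhds hp) hp'
      (chart_val_continuousOn φ) (chart_val_injOn φ) h1⟩
  rw [plCharts, mem_maximalAtlas_iff]
  intro e he
  have he' : e ∈ plCharts m X := StructureGroupoid.subset_maximalAtlas _ he
  exact ⟨symm_trans_mem_plGroupoid_iff.2 fun p hp => (key e he' p hp.1 hp.2).symm,
    symm_trans_mem_plGroupoid_iff.2 fun p hp => (key e he' p hp.2 hp.1)⟩

end Atlas

theorem eq_of_mem_closure {X Z : Type*} [TopologicalSpace X] [TopologicalSpace Z] [T2Space Z]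
    {f g : X → Z} {B S : Set X} {x : X} (hx : x ∈ B) (hSB : S ⊆ B) (hxS : x ∈ closure S)
    (hf : ContinuousOn f B) (hg : ContinuousOn g B) (h : EqOn f g S) : f x = g x := by
  have := mem_closure_iff_nhdsWithin_neBot.1 hxS
  exact tendsto_nhds_unique (((hf x hx).mono hSB).congr'
    (eventually_nhdsWithin_of_forall fun y hy => h hy)) ((hg x hx).mono hSB)

/-! ### PL invariance of the boundary -/

section Boundary

variable {m : ℕ} [NeZero m]

theorem isOpen_image_val {V : Set (EuclideanHalfSpace m)} (hV : IsOpen V)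
    (hpos : ∀ x ∈ V, 0 < x.val 0) : IsOpen (Subtype.val '' V) := by
  have : Subtype.val '' V = toHalf m ⁻¹' V ∩ {x | 0 < x 0} := by
    ext x
    constructor
    · rintro ⟨y, hy, rfl⟩
      exact ⟨by rw [mem_preimage, val_toHalf]; exact hy, hpos y hy⟩
    · rintro ⟨h1, h2⟩
      exact ⟨_, h1, toHalf_val (le_of_lt h2)⟩
  rw [this]
  exact (hV.preimage continuous_toHalf).inter (isOpen_lt continuous_const (continuous_coord 0))

/-- Boundary points of the half-space near which a piecewise linear map is affine are dense in the
boundary. -/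
theorem exists_affine_near_boundary {V : Set (EuclideanHalfSpace m)} (hV : IsOpen V)
    {y : EuclideanHalfSpace m} (hy : y ∈ V) (hy0 : y.val 0 = 0)
    {g : EuclideanHalfSpace m → EuclideanSpace ℝ (Fin m)} (hg : ContinuousOn g V)
    (h : AffineSelection m (𝓝 y) (fun x => x.val) g) :
    ∃ z : EuclideanSpace ℝ (Fin m), z 0 = 0 ∧ ∃ ε > 0,
      ∃ β : EuclideanSpace ℝ (Fin m) →ᵃ[ℝ] EuclideanSpace ℝ (Fin m),
      ∀ x ∈ Metric.ball z ε, ∀ hx : 0 ≤ x 0,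
        (⟨x, hx⟩ : EuclideanHalfSpace m) ∈ V ∧ g ⟨x, hx⟩ = β x := by
  obtain ⟨F, hF, hFy⟩ := h
  obtain ⟨O, hOsub, hO, hyO⟩ := mem_nhds_iff.1 (inter_mem (hV.mem_nhds hy) hFy)
  have hOE : IsOpen (toHalf m ⁻¹' O) := hO.preimage continuous_toHalf
  let T : (EuclideanSpace ℝ (Fin m) →ᵃ[ℝ] EuclideanSpace ℝ (Fin m)) ×
    (EuclideanSpace ℝ (Fin m) →ᵃ[ℝ] EuclideanSpace ℝ (Fin m)) → Set (EuclideanSpace ℝ (Fin m)) :=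
    fun p => {x | p.1 x = p.2 x}
  have hTc : ∀ p, IsClosed (T p) := fun p => isClosed_eq p.1.continuous_of_finiteDimensional
    p.2.continuous_of_finiteDimensional
  let P : Set (EuclideanSpace ℝ (Fin m)) := {x | x 0 = 0}
  let G := {p ∈ F ×ˢ F | ¬ P ⊆ T p}
  have hG : G.Finite := (hF.prod hF).subset fun p hp => hp.1
  -- `G` holds the pairs that disagree somewhere on the hyperplane `P`. Affine maps that agree on an
  -- open part of `P` agree on `P`, so the agreement set of such a pair is nowhere dense in `P`, and
  -- finitely many of them leave out some `z`.
  obtain ⟨z, hzO, hzP, hzT⟩ : ∃ z, z ∈ toHalf m ⁻¹' O ∧ z ∈ P ∧ ∀ p ∈ G, z ∉ T p := by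
    by_contra hcon
    push Not at hcon
    obtain ⟨p, hp, B, -, hBo, ⟨b, hb⟩, hBcl⟩ := exists_isOpen_subset_closure hG
      (fun p => (Subtype.val ⁻¹' T p : Set P)) (Subtype.val ⁻¹' (toHalf m ⁻¹' O))
      (hOE.preimage continuous_subtype_val) ⟨⟨y.val, hy0⟩, by
        simp only [mem_preimage, val_toHalf]; exact hyO⟩ (by
        rintro x hx
        obtain ⟨p, hp, hpx⟩ := hcon x.1 hx x.2
        exact mem_biUnion hp hpx)
    rw [((hTc p).preimage continuous_subtype_val).closure_eq] at hBcl
    refine hp.2 fun x hx => ?_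
    let c : ℝ → EuclideanSpace ℝ (Fin m) := fun t => b.1 + t • (x - b.1)
    have hcP : ∀ t, c t ∈ P := fun t => by
      have h1 : b.1 0 = 0 := b.2
      have h2 : x 0 = 0 := hx
      simp [c, P, h1, h2]
    have hcc : Continuous fun t => (⟨c t, hcP t⟩ : P) :=
      Continuous.subtype_mk (by fun_prop) _
    obtain ⟨δ, hδ, hsub⟩ := Metric.isOpen_iff.1 (hBo.preimage hcc) 0 (by
      have : (⟨c 0, hcP 0⟩ : P) = b := Subtype.ext (by simp [c])
      rw [mem_preimage, this]; exact hb)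
    have h1 : p.1 (c (δ / 2)) = p.2 (c (δ / 2)) :=
      hBcl (hsub (by simp [abs_of_pos hδ, hδ]))
    have h0 : p.1 b.1 = p.2 b.1 := hBcl hb
    have hlin : ∀ α : EuclideanSpace ℝ (Fin m) →ᵃ[ℝ] EuclideanSpace ℝ (Fin m), ∀ t,
        α (c t) = t • (α x - α b.1) + α b.1 := by
      intro α t
      have : c t = AffineMap.lineMap b.1 x t := by
        simp only [c, AffineMap.lineMap_apply, vsub_eq_sub, vadd_eq_add]; rw [add_comm]
      rw [this, AffineMap.apply_lineMap, AffineMap.lineMap_apply]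
      simp
    rw [hlin, hlin, h0] at h1
    have h2 : (δ / 2) • (p.1 x - p.2 b.1) = (δ / 2) • (p.2 x - p.2 b.1) := add_right_cancel h1
    have h3 := smul_right_injective _ (by positivity : (δ / 2) ≠ 0) h2
    exact sub_left_injective h3
  have hopen : IsOpen (toHalf m ⁻¹' O ∩ ⋂ p ∈ G, (T p)ᶜ) :=
    hOE.inter (Set.Finite.isOpen_biInter hG fun p _ => (hTc p).isOpen_compl)
  obtain ⟨ε, hε, hball⟩ := Metric.isOpen_iff.1 hopen z ⟨hzO, mem_iInter₂.2 hzT⟩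
  let S : Set (EuclideanSpace ℝ (Fin m)) := Metric.ball z ε ∩ {x | 0 < x 0}
  have hSo : IsOpen S := Metric.isOpen_ball.inter (isOpen_lt continuous_const (continuous_coord 0))
  have hSconv : Convex ℝ S := by
    refine (convex_ball z ε).inter ?_
    intro a ha b hb s t hs ht hst
    simp only [mem_ofPred_eq, PiLp.add_apply, PiLp.smul_apply, smul_eq_mul] at ha hb ⊢
    rcases hs.eq_or_lt with rfl | hs
    · simp at hst; subst hst; simpa using hb
    · have := mul_pos hs ha; have := mul_nonneg ht hb.le; linarith
  have hSO : ∀ x ∈ Metric.ball z ε, toHalf m x ∈ O := fun x hx => (hball hx).1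
  have hgS : ContinuousOn (fun x => g (toHalf m x)) (Metric.ball z ε) :=
    hg.comp continuous_toHalf.continuousOn fun x hx => (hOsub (hSO x hx)).1
  have hsel : ∀ x ∈ Metric.ball z ε, 0 ≤ x 0 → ∃ α ∈ F, g (toHalf m x) = α x := by
    intro x hx hx0
    obtain ⟨α, hα, e⟩ := (hOsub (hSO x hx)).2
    exact ⟨α, hα, by rw [e]; exact congrArg α (toHalf_val hx0)⟩
  -- The ball avoids the agreement sets of `G`, so two maps that agree at a point of `S` agree on
  -- `P` too; `P` and a point off it span the whole space.
  have hdisj : ∀ α ∈ F, ∀ β ∈ F, ∀ x ∈ S, α x = β x → α = β := by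
    intro α hα β hβ x hx hxe
    have hPT : P ⊆ T (α, β) := by
      by_contra hn
      exact mem_iInter₂.1 (hball hx.1).2 (α, β) ⟨⟨hα, hβ⟩, hn⟩ hxe
    ext1 w
    have hx0 : 0 < x 0 := hx.2
    let w' := w - (w 0 / x 0) • x
    have hw' : w' ∈ P := by simp [w', P, hx0.ne']
    have h0 : (0 : EuclideanSpace ℝ (Fin m)) ∈ P := by simp [P]
    have e : ∀ α : EuclideanSpace ℝ (Fin m) →ᵃ[ℝ] EuclideanSpace ℝ (Fin m),
        α w = α w' + (w 0 / x 0) • (α x - α 0) := by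
      intro α
      have h1 : w = (w 0 / x 0) • x +ᵥ w' := by simp [w']
      have h2 : α.linear x = α x - α 0 := by
        have := α.linearMap_vsub x 0
        simpa using this
      conv_lhs => rw [h1]
      rw [AffineMap.map_vadd, map_smul, h2, vadd_eq_add, add_comm]
    rw [e α, e β, hPT hw', hPT h0, hxe]
  have hSne : S.Nonempty := by
    refine ⟨z + (ε / 2) • EuclideanSpace.single 0 1, ?_, ?_⟩
    · simp [norm_smul, abs_of_pos hε, hε]
    · have : z 0 = 0 := hzP
      simp [this, hε]
  obtain ⟨s, hs⟩ := hSne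
  obtain ⟨β, hβ, hβs⟩ := hsel s hs.1 hs.2.le
  have hrel : ∀ α : EuclideanSpace ℝ (Fin m) →ᵃ[ℝ] EuclideanSpace ℝ (Fin m),
      IsOpen (S ∩ {x | g (toHalf m x) ≠ α x}) := fun α =>
    ((hgS.mono inter_subset_left).prodMk
      α.continuous_of_finiteDimensional.continuousOn).isOpen_inter_preimage hSo
      isClosed_diagonal.isOpen_compl
  -- By `hdisj` the agreement sets of different maps are disjoint in `S`, and there are finitely
  -- many, so each is relatively open and closed; `S` is connected.
  have hSβ : ∀ x ∈ S, g (toHalf m x) = β x := by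
    let u := S ∩ ⋂ α ∈ F \ {β}, S ∩ {x | g (toHalf m x) ≠ α x}
    have hu : IsOpen u := hSo.inter
      (Set.Finite.isOpen_biInter (hF.subset sdiff_subset) fun α _ => hrel α)
    have hβu : ∀ x ∈ S, x ∈ u ↔ g (toHalf m x) = β x := by
      intro x hx
      constructor
      · rintro ⟨-, h⟩
        obtain ⟨α, hα, e⟩ := hsel x hx.1 hx.2.le
        by_contra hne
        have hαβ : α ≠ β := fun h => hne (h ▸ e)
        exact (mem_iInter₂.1 h α ⟨hα, hαβ⟩).2 e
      · intro h
        refine ⟨hx, mem_iInter₂.2 fun α hα => ⟨hx, fun e => hα.2 ?_⟩⟩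
        exact hdisj α hα.1 β hβ x hx (e.symm.trans h)
    have := hSconv.isPreconnected.subset_left_of_subset_union hu (hrel β) (by
        rw [Set.disjoint_left]
        intro x hx hx'
        exact hx'.2 ((hβu x hx.1).1 hx)) (by
        intro x hx
        by_cases h : g (toHalf m x) = β x
        · exact .inl ((hβu x hx).2 h)
        · exact .inr ⟨hx, h⟩) ⟨s, hs, (hβu s hs).2 hβs⟩
    exact fun x hx => (hβu x hx).1 (this hx)
  refine ⟨z, hzP, ε, hε, β, fun x hx hx0 => ?_⟩
  rw [← toHalf_mk hx0]
  refine ⟨(hOsub (hSO x hx)).1, ?_⟩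
  have hcl : x ∈ closure S := by
    refine Metric.isOpen_ball.inter_closure ⟨hx, ?_⟩
    rw [closure_open_halfSpace]; exact hx0
  exact eq_of_mem_closure hx inter_subset_left hcl hgS
    β.continuous_of_finiteDimensional.continuousOn hSβ

/-- Piecewise linear invariance of the boundary of the half-space. -/
theorem not_isOpen_image_of_boundary {V : Set (EuclideanHalfSpace m)} (hV : IsOpen V)
    {y : EuclideanHalfSpace m} (hy : y ∈ V) (hy0 : y.val 0 = 0)
    {g : EuclideanHalfSpace m → EuclideanSpace ℝ (Fin m)} (hg : ContinuousOn g V)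
    (hinj : InjOn g V) (h : AffineSelection m (𝓝 y) (fun x => x.val) g) :
    ∃ V' ⊆ V, IsOpen V' ∧ ¬ IsOpen (g '' V') := by
  obtain ⟨z, hz, ε, hε, β, hβ⟩ := exists_affine_near_boundary hV hy hy0 hg h
  have hβinj : Function.Injective β := by
    refine affineMap_injective_of_injOn_ball β
      (y := z + (ε / 2) • EuclideanSpace.single 0 1) (half_pos hε) ?_
    have hb : ∀ a ∈ Metric.ball (z + (ε / 2) • EuclideanSpace.single 0 1) (ε / 2),
        a ∈ Metric.ball z ε ∧ 0 ≤ a 0 := by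
      intro a ha
      rw [Metric.mem_ball, dist_eq_norm] at ha ⊢
      constructor
      · calc ‖a - z‖ = ‖(a - (z + (ε / 2) • EuclideanSpace.single 0 1)) +
              (ε / 2) • EuclideanSpace.single 0 1‖ := by congr 1; abel
          _ ≤ _ := norm_add_le _ _
          _ < ε / 2 + ε / 2 := by
            refine add_lt_add_of_lt_of_le ha ?_
            simp [norm_smul, abs_of_pos hε]
          _ = ε := by ring
      · have h1 := PiLp.norm_apply_le (a - (z + (ε / 2) • EuclideanSpace.single 0 1)) 0
        simp only [PiLp.sub_apply, PiLp.add_apply, PiLp.smul_apply, hz,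
          PiLp.single_apply, if_true, smul_eq_mul, mul_one, Real.norm_eq_abs] at h1
        have h2 := (abs_lt.1 (h1.trans_lt ha)).1
        linarith
    intro a ha b hb' hab
    obtain ⟨h1, h1'⟩ := hb a ha
    obtain ⟨h2, h2'⟩ := hb b hb'
    have := hinj (hβ a h1 h1').1 (hβ b h2 h2').1
      (by rw [(hβ a h1 h1').2, (hβ b h2 h2').2, hab])
    exact congrArg Subtype.val this
  refine ⟨Subtype.val ⁻¹' Metric.ball z ε, fun x hx => (hβ x.1 hx x.2).1,
    Metric.isOpen_ball.preimage continuous_val, fun hopen => ?_⟩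
  -- An open image would contain `β` of points on the line through `z` just outside the half-space.
  -- Injectivity of `β` would then put these points inside.
  have hc : Continuous fun t : ℝ => β (z + t • EuclideanSpace.single 0 (-1)) :=
    β.continuous_of_finiteDimensional.comp (by fun_prop)
  obtain ⟨δ, hδ, hsub⟩ := Metric.isOpen_iff.1 (hopen.preimage hc) 0 (by
    refine ⟨⟨z, hz.ge⟩, Metric.mem_ball_self hε, ?_⟩
    rw [(hβ z (Metric.mem_ball_self hε) hz.ge).2]; simp)
  obtain ⟨x, hx, hxe⟩ := hsub (show δ / 2 ∈ Metric.ball (0 : ℝ) δ by simp [abs_of_pos hδ, hδ])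
  have h1 := hβinj ((hβ x.1 hx x.2).2.symm.trans hxe)
  have h2 : x.1 0 = _ := congrArg (fun w : EuclideanSpace ℝ (Fin m) => w 0) h1
  have h3 := x.2
  simp [hz] at h2
  linarith

variable {X : Type*} [TopologicalSpace X] [ChartedSpace (EuclideanHalfSpace m) X]

/-- If the coordinate change sent a boundary point to a point with positive coordinate `0`, it would
be an open map into Euclidean space near that point, against `not_isOpen_image_of_boundary`. -/
theorem coord_zero_of_coord_zero [HasGroupoid X (plGroupoid m)]
    {φ ψ : OpenPartialHomeomorph X (EuclideanHalfSpace m)}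
    (hφ : φ ∈ plCharts m X) (hψ : ψ ∈ plCharts m X) {p : X} (hp : p ∈ φ.source)
    (hp' : p ∈ ψ.source) (h : (φ p).val 0 = 0) : (ψ p).val 0 = 0 := by
  by_contra hne
  have hpos : 0 < (ψ p).val 0 := lt_of_le_of_ne (ψ p).2 (Ne.symm hne)
  set U : Set X := φ.source ∩ (ψ.source ∩ ψ ⁻¹' {y | 0 < y.val 0}) with hU
  have hUo : IsOpen U := φ.open_source.inter
    (ψ.isOpen_inter_preimage (isOpen_lt continuous_const (continuous_valCoord 0)))
  have hUφ : U ⊆ φ.source := inter_subset_left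
  have hUψ : U ⊆ ψ.source := fun q hq => hq.2.1
  have hVo := φ.isOpen_image_of_subset_source hUo hUφ
  have hmaps : MapsTo φ.symm (φ '' U) U := by
    rintro _ ⟨q, hq, rfl⟩
    rwa [φ.left_inv (hUφ hq)]
  obtain ⟨V', hV', hV'o, hno⟩ := not_isOpen_image_of_boundary hVo (mem_image_of_mem φ ⟨hp, hp', hpos⟩) h
    (g := fun y => (ψ (φ.symm y)).val)
    ((chart_val_continuousOn ψ).comp
      (φ.continuousOn_symm.mono (by rintro _ ⟨q, hq, rfl⟩; exact φ.map_source (hUφ hq)))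
      fun y hy => hUψ (hmaps hy))
    (by
      rintro _ ⟨q, hq, rfl⟩ _ ⟨q', hq', rfl⟩ e
      simp only [φ.left_inv (hUφ hq), φ.left_inv (hUφ hq')] at e
      rw [chart_val_injOn ψ (hUψ hq) (hUψ hq') e])
    (by
      rw [← φ.map_nhds_eq hp, affineSelection_map_iff]
      refine (affineSelection_of_mem hφ hψ hp hp').congr .rfl ?_
      filter_upwards [φ.open_source.mem_nhds hp] with q hq
      rw [φ.left_inv hq])
  refine hno ?_
  have hV'm : ∀ y ∈ V', φ.symm y ∈ U := fun y hy => hmaps (hV' hy)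
  have e : (fun y => (ψ (φ.symm y)).val) '' V' = Subtype.val '' (ψ '' (φ.symm '' V')) := by
    rw [image_image, image_image]
  rw [e]
  refine isOpen_image_val (ψ.isOpen_image_of_subset_source ?_ ?_) ?_
  · refine φ.symm.isOpen_image_of_subset_source hV'o fun y hy => ?_
    obtain ⟨q, hq, rfl⟩ := hV' hy
    exact φ.map_source (hUφ hq)
  · rintro _ ⟨y, hy, rfl⟩
    exact hUψ (hV'm y hy)
  · rintro _ ⟨_, ⟨y, hy, rfl⟩, rfl⟩
    exact (hV'm y hy).2.2

theorem mem_bdry_iff_chartAt {p : X} :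
    p ∈ bdry m X ↔ (chartAt (EuclideanHalfSpace m) p p).val 0 = 0 := by
  change extChartAt (modelWithCornersEuclideanHalfSpace m) p p ∈
    frontier (range (modelWithCornersEuclideanHalfSpace m)) ↔ _
  rw [frontier_range_modelWithCornersEuclideanHalfSpace]
  exact eq_comm

/-- The boundary is defined by the preferred chart at each point; invariance allows every chart of
the maximal atlas, such as the ones that occur in cleanness. -/
theorem mem_bdry_iff [HasGroupoid X (plGroupoid m)]
    {φ : OpenPartialHomeomorph X (EuclideanHalfSpace m)}
    (hφ : φ ∈ plCharts m X) {p : X} (hp : p ∈ φ.source) :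
    p ∈ bdry m X ↔ (φ p).val 0 = 0 := by
  rw [mem_bdry_iff_chartAt]
  exact ⟨coord_zero_of_coord_zero (chartAt_mem_plCharts p) hφ (mem_chart_source _ p) hp,
    coord_zero_of_coord_zero hφ (chartAt_mem_plCharts p) hp (mem_chart_source _ p)⟩

theorem isClosed_bdry [HasGroupoid X (plGroupoid m)] : IsClosed (bdry m X) := by
  rw [← isOpen_compl_iff, isOpen_iff_mem_nhds]
  intro p hp
  have hφ := chartAt_mem_plCharts (m := m) p
  set φ := chartAt (EuclideanHalfSpace m) p
  have hps : p ∈ φ.source := mem_chart_source _ p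
  have ho : IsOpen (φ.source ∩ φ ⁻¹' {y | y.val 0 ≠ 0}) := φ.isOpen_inter_preimage
    (isOpen_ne_fun (continuous_valCoord 0) continuous_const)
  filter_upwards [ho.mem_nhds ⟨hps, fun h => hp ((mem_bdry_iff hφ hps).2 h)⟩] with q hq h
  exact hq.2 ((mem_bdry_iff hφ hq.1).1 h)

theorem chart_restrOpen_mem [HasGroupoid X (plGroupoid m)]
    {φ : OpenPartialHomeomorph X (EuclideanHalfSpace m)}
    (hφ : φ ∈ plCharts m X) {U : Set X} (hU : IsOpen U) : φ.restrOpen U hU ∈ plCharts m X :=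
  mem_plCharts fun _ hp => ⟨φ, hφ, hp.1, AffineSelection.refl⟩

theorem chart_trans_mem [HasGroupoid X (plGroupoid m)]
    {φ : OpenPartialHomeomorph X (EuclideanHalfSpace m)} (hφ : φ ∈ plCharts m X)
    (e : OpenPartialHomeomorph (EuclideanHalfSpace m) (EuclideanHalfSpace m))
    (he : ∀ y ∈ e.source, AffineSelection m (𝓝 y) (fun y => y.val) (fun y => (e y).val)) :
    φ.trans e ∈ plCharts m X := by
  refine mem_plCharts fun p hp => ⟨φ, hφ, ?_, ?_⟩
  · rw [OpenPartialHomeomorph.trans_source] at hp; exact hp.1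
  · rw [OpenPartialHomeomorph.trans_source] at hp
    exact (he _ hp.2).comp_tendsto (φ.continuousAt hp.1)

/-- Near every point of a clean submanifold of the boundary there is a chart in which the
submanifold is a half-space of the boundary; the index is `0` away from the edge. -/
theorem IsCleanInBdry.exists_chart [HasGroupoid X (plGroupoid m)] {A : Set X}
    (hA : IsCleanInBdry m A) {p : X} (hp : p ∈ A) {U : Set X} (hU : U ∈ 𝓝 p) :
    ∃ φ ∈ plCharts m X, p ∈ φ.source ∧ φ.source ⊆ U ∧
      ∃ i : Fin m, (i = 0 ↔ p ∉ edge m A) ∧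
        ∀ q ∈ φ.source ∩ bdry m X, q ∈ A ↔ (φ p).val i ≤ (φ q).val i := by
  obtain ⟨O, hOU, hO, hpO⟩ := mem_nhds_iff.1 hU
  by_cases he : p ∈ edge m A
  · obtain ⟨φ, hφ, hps, i, hi⟩ := hA.2.2 p he
    refine ⟨φ.restrOpen O hO, chart_restrOpen_mem hφ hO, ⟨hps, hpO⟩, fun q hq => hOU hq.2, i, ?_,
      fun q hq => hi q ⟨hq.1.1, hq.2⟩⟩
    -- Coordinate `0` vanishes on the whole boundary, so a model with `i = 0` would make `A` fill
    -- the boundary near `p`, leaving no edge there.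
    simp only [he, not_true, iff_false]
    rintro rfl
    obtain ⟨q, hq, hqb, hqA⟩ := mem_closure_iff.1 he.2 φ.source φ.open_source hps
    refine hqA ((hi q ⟨hq, hqb⟩).2 ?_)
    rw [(mem_bdry_iff hφ hps).1 (hA.1 hp), (mem_bdry_iff hφ hq).1 hqb]
  -- Off the edge the chart is shrunk until `A` is all of the boundary in it; then the inequality
  -- for index `0` reads `0 ≤ 0`.
  · have hO' : IsOpen (O ∩ (closure (bdry m X \ A))ᶜ) := hO.inter isClosed_closure.isOpen_compl
    have hφ := chartAt_mem_plCharts (m := m) p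
    refine ⟨(chartAt (EuclideanHalfSpace m) p).restrOpen _ hO', chart_restrOpen_mem hφ hO',
      ⟨mem_chart_source _ p, hpO, fun h => he ⟨hp, h⟩⟩, fun q hq => hOU hq.2.1, 0, by simp [he],
      fun q hq => ?_⟩
    have h1 := (mem_bdry_iff hφ (mem_chart_source _ p)).1 (hA.1 hp)
    have h2 := (mem_bdry_iff hφ hq.1.1).1 hq.2
    refine iff_of_true (by_contra fun h => hq.1.2.2 (subset_closure ⟨hq.2, h⟩)) ?_
    exact (h1.trans h2.symm).le

end Boundary

/-! ### Strong deformation retractions and homotopy equivalences -/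

section Deform

variable {X Y : Type*} [TopologicalSpace X] [TopologicalSpace Y]

/-- `H` is a strong deformation retraction of `T` onto `S` (with time parameter in `ℝ`, constant
outside the unit interval). -/
structure Deforms (S T : Set X) (H : X × ℝ → X) : Prop where
  sub : S ⊆ T
  cont : ContinuousOn H (T ×ˢ univ)
  maps : ∀ x ∈ T, ∀ t, H (x, t) ∈ T
  zero : ∀ x ∈ T, ∀ t ≤ 0, H (x, t) = x
  one : ∀ x ∈ T, ∀ t ≥ 1, H (x, t) = H (x, 1)
  mem : ∀ x ∈ T, H (x, 1) ∈ S
  fixed : ∀ x ∈ S, ∀ t, H (x, t) = x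

/-- `S` is a strong deformation retract of `T`. -/
def IsSDR (S T : Set X) : Prop := ∃ H, Deforms S T H

/-- Concatenation of homotopies. -/
noncomputable def concatH (H K : X × ℝ → X) : X × ℝ → X := fun p =>
  if p.2 ≤ 1 / 2 then H (p.1, 2 * p.2) else K (H (p.1, 1), 2 * p.2 - 1)

variable {S T U Q : Set X} {H K : X × ℝ → X}

theorem Deforms.refl (S : Set X) : Deforms S S Prod.fst where
  sub := subset_rfl
  cont := continuous_fst.continuousOn
  maps _ hx _ := hx
  zero _ _ _ _ := rfl
  one _ _ _ _ := rfl
  mem _ hx := hx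
  fixed _ _ _ := rfl

theorem Deforms.mono_time (h : Deforms S T H) {x : X} (hx : x ∈ T) {t : ℝ} (ht : 1 ≤ t) :
    H (x, t) ∈ S := by
  rw [h.one x hx t ht]; exact h.mem x hx

theorem Deforms.trans (h : Deforms T U H) (k : Deforms S T K) : Deforms S U (concatH H K) where
  sub := k.sub.trans h.sub
  cont := by
    have hU : (U ×ˢ (univ : Set ℝ)) = (U ×ˢ Iic (1 / 2)) ∪ (U ×ˢ Ici (1 / 2)) := by
      rw [← prod_union, Iic_union_Ici]
    have h1 : ContinuousOn (fun p : X × ℝ => H (p.1, 2 * p.2)) (U ×ˢ univ) :=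
      h.cont.comp (by fun_prop) fun p hp => ⟨hp.1, mem_univ _⟩
    have h2 : ContinuousOn (fun p : X × ℝ => K (H (p.1, 1), 2 * p.2 - 1)) (U ×ˢ univ) :=
      k.cont.comp ((h.cont.comp (by fun_prop) fun p hp => ⟨hp.1, mem_univ _⟩).prodMk
        (by fun_prop)) fun p hp => ⟨h.mem _ hp.1, mem_univ _⟩
    refine ContinuousOn.if ?_ (h1.mono ?_) (h2.mono ?_)
    · rintro ⟨x, t⟩ ⟨hx, ht⟩
      have ht' : t = 1 / 2 := frontier_le_subset_eq continuous_snd continuous_const ht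
      subst ht'
      norm_num
      rw [k.zero _ (h.mem _ hx.1) _ le_rfl]
    · exact inter_subset_left
    · exact inter_subset_left
  maps x hx t := by
    simp only [concatH]
    split_ifs
    · exact h.maps x hx _
    · exact h.sub (k.maps _ (h.mem x hx) _)
  zero x hx t ht := by
    have : t ≤ 1 / 2 := by linarith
    simp only [concatH, this, if_true]
    exact h.zero x hx _ (by linarith)
  one x hx t ht := by
    have h1 : ¬ t ≤ 1 / 2 := by linarith
    have h2 : ¬ (1 : ℝ) ≤ 1 / 2 := by norm_num
    simp only [concatH, h1, h2, if_false]
    rw [k.one _ (h.mem x hx) _ (by linarith)]; norm_num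
  mem x hx := by
    have h2 : ¬ (1 : ℝ) ≤ 1 / 2 := by norm_num
    simp only [concatH, h2, if_false]
    exact k.mono_time (h.mem x hx) (by norm_num)
  fixed x hx t := by
    simp only [concatH]
    rw [h.fixed x (k.sub hx), h.fixed x (k.sub hx), k.fixed x hx]
    simp

/-- Tracks a subset `Q` through both stages; with `Q = V` this is how deformations of pairs are
composed. -/
theorem concatH_mem (h : Deforms T U H) (hQ : ∀ x ∈ Q ∩ U, ∀ t, H (x, t) ∈ Q)
    (kQ : ∀ x ∈ Q ∩ T, ∀ t, K (x, t) ∈ Q) : ∀ x ∈ Q ∩ U, ∀ t, concatH H K (x, t) ∈ Q := by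
  intro x hx t
  simp only [concatH]
  split_ifs
  · exact hQ x hx _
  · exact kQ _ ⟨hQ x hx _, h.mem x hx.2⟩ _

open Classical in
/-- Extension of a deformation by the identity. -/
theorem Deforms.union (h : Deforms S T H) {C : Set X} (hT : IsClosed T) (hC : IsClosed C)
    (hCT : C ∩ T ⊆ S) :
    Deforms (S ∪ C) (T ∪ C) (fun p => if p.1 ∈ T then H p else p.1) := by
  have hfix : ∀ x ∈ C, ∀ t, (if x ∈ T then H (x, t) else x) = x := by
    intro x hx t
    split_ifs with hxT
    · exact h.fixed x (hCT ⟨hx, hxT⟩) t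
    · rfl
  refine ⟨union_subset_union_left _ h.sub, ?_, ?_, ?_, ?_, ?_, ?_⟩
  · rw [union_prod]
    refine ContinuousOn.union_of_isClosed ?_ ?_ (hT.prod isClosed_univ) (hC.prod isClosed_univ)
    · exact h.cont.congr fun p hp => by simp [hp.1]
    · exact continuous_fst.continuousOn.congr fun p hp => hfix p.1 hp.1 p.2
  · rintro x (hx | hx) t
    · simp only [hx, if_true]; exact .inl (h.maps x hx t)
    · simp only [hfix x hx]; exact .inr hx
  · rintro x (hx | hx) t ht
    · simp only [hx, if_true]; exact h.zero x hx t ht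
    · exact hfix x hx t
  · rintro x (hx | hx) t ht
    · simp only [hx, if_true]; exact h.one x hx t ht
    · simp only [hfix x hx]
  · rintro x (hx | hx)
    · simp only [hx, if_true]; exact .inl (h.mem x hx)
    · simp only [hfix x hx]; exact .inr hx
  · rintro x (hx | hx) t
    · simp only [h.sub hx, if_true]; exact h.fixed x hx t
    · exact hfix x hx t

/-- A left inverse of an embedding is continuous on its range. -/
theorem exists_leftInverse_continuousOn {κ : Y → X} (hκ : IsEmbedding κ) [Nonempty Y] :
    ∃ g : X → Y, (∀ y, g (κ y) = y) ∧ ContinuousOn g (range κ) := by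
  refine ⟨Function.invFun κ, Function.leftInverse_invFun hκ.injective, ?_⟩
  rw [hκ.isInducing.continuousOn_iff]
  refine continuousOn_id.congr ?_
  rintro _ ⟨y, rfl⟩
  simp [Function.leftInverse_invFun hκ.injective y]

theorem IsSDR.image {κ : Y → X} (hκ : IsEmbedding κ) {S T : Set Y} (h : IsSDR S T) :
    IsSDR (κ '' S) (κ '' T) := by
  obtain ⟨H, h⟩ := h
  rcases isEmpty_or_nonempty Y with hY | hY
  · rw [Set.eq_empty_of_isEmpty S, Set.eq_empty_of_isEmpty T, image_empty]
    exact ⟨_, Deforms.refl _⟩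
  obtain ⟨g, hg, hgc⟩ := exists_leftInverse_continuousOn hκ
  refine ⟨fun p => κ (H (g p.1, p.2)), image_mono h.sub, ?_, ?_, ?_, ?_, ?_, ?_⟩
  · refine hκ.continuous.comp_continuousOn (h.cont.comp ((hgc.comp continuousOn_fst ?_).prodMk
      continuousOn_snd) ?_)
    · rintro ⟨_, t⟩ ⟨⟨y, hy, rfl⟩, -⟩
      exact mem_range_self y
    · rintro ⟨_, t⟩ ⟨⟨y, hy, rfl⟩, -⟩
      exact ⟨by simpa [hg] using hy, mem_univ _⟩
  · rintro _ ⟨y, hy, rfl⟩ t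
    exact ⟨_, h.maps y hy t, by simp [hg]⟩
  · rintro _ ⟨y, hy, rfl⟩ t ht
    simp [hg, h.zero y hy t ht]
  · rintro _ ⟨y, hy, rfl⟩ t ht
    simp [hg, h.one y hy t ht]
  · rintro _ ⟨y, hy, rfl⟩
    exact ⟨_, h.mem y hy, by simp [hg]⟩
  · rintro _ ⟨y, hy, rfl⟩ t
    simp [hg, h.fixed y hy t]

/-- The end map of a deformation. -/
def Deforms.retr (h : Deforms S T H) : C(T, S) :=
  ⟨fun x => ⟨H (x, 1), h.mem x x.2⟩, Continuous.subtype_mk (h.cont.comp_continuous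
    (by fun_prop) fun x => ⟨x.2, mem_univ _⟩) _⟩

theorem Deforms.retr_comp (h : Deforms S T H) :
    h.retr.comp ⟨inclusion h.sub, continuous_inclusion h.sub⟩ = ContinuousMap.id S := by
  ext x
  exact h.fixed x x.2 1

theorem Deforms.comp_retr (h : Deforms S T H) :
    ContinuousMap.Homotopic ((⟨inclusion h.sub, continuous_inclusion h.sub⟩ : C(S, T)).comp h.retr)
      (ContinuousMap.id T) := by
  refine ContinuousMap.Homotopic.symm ⟨⟨⟨fun p => ⟨H (p.2, p.1), h.maps _ p.2.2 _⟩,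
    Continuous.subtype_mk (h.cont.comp_continuous (by fun_prop) fun p => ⟨p.2.2, mem_univ _⟩) _⟩,
    fun x => ?_, fun x => ?_⟩⟩
  · exact Subtype.ext (h.zero x x.2 _ le_rfl)
  · exact Subtype.ext rfl

theorem IsSDR.inclIsHEquiv (h : IsSDR S T) : InclIsHEquiv S T := by
  obtain ⟨H, h⟩ := h
  exact ⟨⟨⟨inclusion h.sub, continuous_inclusion h.sub⟩, h.retr,
    h.retr_comp ▸ ContinuousMap.Homotopic.refl _, h.comp_retr⟩, fun x => rfl⟩

theorem InclIsHEquiv.subset (h : InclIsHEquiv S T) : S ⊆ T := by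
  obtain ⟨e, he⟩ := h
  intro x hx
  have h : (e ⟨x, hx⟩ : X) = x := he ⟨x, hx⟩
  exact h ▸ (e ⟨x, hx⟩).2

theorem InclIsHEquiv.exists_inverse (h : InclIsHEquiv S T) :
    ∃ g : C(T, S), ContinuousMap.Homotopic
      (g.comp ⟨inclusion h.subset, continuous_inclusion h.subset⟩) (ContinuousMap.id S) ∧
      ContinuousMap.Homotopic ((⟨inclusion h.subset, continuous_inclusion h.subset⟩ :
        C(S, T)).comp g) (ContinuousMap.id T) := by
  obtain ⟨e, he⟩ := id h
  have : e.toFun = ⟨inclusion h.subset, continuous_inclusion h.subset⟩ := by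
    ext x; exact he x
  exact ⟨e.invFun, this ▸ e.left_inv, this ▸ e.right_inv⟩

theorem inclIsHEquiv_of_inverse (hST : S ⊆ T) (g : C(T, S))
    (h1 : ContinuousMap.Homotopic (g.comp ⟨inclusion hST, continuous_inclusion hST⟩)
      (ContinuousMap.id S))
    (h2 : ContinuousMap.Homotopic ((⟨inclusion hST, continuous_inclusion hST⟩ :
        C(S, T)).comp g) (ContinuousMap.id T)) : InclIsHEquiv S T :=
  ⟨⟨⟨inclusion hST, continuous_inclusion hST⟩, g, h1, h2⟩, fun _ => rfl⟩

/-- If `U` retracts onto `T` and `S ↪ U` is a homotopy equivalence, then so is `S ↪ T`. -/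
theorem InclIsHEquiv.of_isSDR_right (h : InclIsHEquiv S U) (k : IsSDR T U) (hST : S ⊆ T) :
    InclIsHEquiv S T := by
  obtain ⟨K, k⟩ := k
  obtain ⟨g, h1, h2⟩ := h.exists_inverse
  refine inclIsHEquiv_of_inverse hST (g.comp ⟨inclusion k.sub, continuous_inclusion k.sub⟩) h1 ?_
  have := ((ContinuousMap.Homotopic.refl k.retr).comp h2).comp
    (ContinuousMap.Homotopic.refl ⟨inclusion k.sub, continuous_inclusion k.sub⟩)
  have e2 : (k.retr.comp (ContinuousMap.id U)).comp
      ⟨inclusion k.sub, continuous_inclusion k.sub⟩ = ContinuousMap.id T := k.retr_comp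
  have e1 : (k.retr.comp ((⟨inclusion h.subset, continuous_inclusion h.subset⟩ :
        C(S, U)).comp g)).comp ⟨inclusion k.sub, continuous_inclusion k.sub⟩ =
      (⟨inclusion hST, continuous_inclusion hST⟩ : C(S, T)).comp
        (g.comp ⟨inclusion k.sub, continuous_inclusion k.sub⟩) := by
    ext x
    exact k.fixed _ (hST (g _).2) 1
  rwa [e1, e2] at this

/-- If `T` retracts onto `S` and `S ↪ U` is a homotopy equivalence, then so is `T ↪ U`. -/
theorem InclIsHEquiv.of_isSDR_left (h : InclIsHEquiv S U) (k : IsSDR S T) (hTU : T ⊆ U) :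
    InclIsHEquiv T U := by
  obtain ⟨K, k⟩ := k
  obtain ⟨g, h1, h2⟩ := h.exists_inverse
  let i : C(S, T) := ⟨inclusion k.sub, continuous_inclusion k.sub⟩
  let j : C(T, U) := ⟨inclusion hTU, continuous_inclusion hTU⟩
  refine inclIsHEquiv_of_inverse hTU (i.comp g) ?_ h2
  have a1 : ContinuousMap.Homotopic ((i.comp g).comp j) (((i.comp g).comp j).comp
      (i.comp k.retr)) :=
    ((ContinuousMap.Homotopic.refl ((i.comp g).comp j)).comp k.comp_retr).symm
  have a2 : ContinuousMap.Homotopic (i.comp ((g.comp (j.comp i)).comp k.retr))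
      (i.comp ((ContinuousMap.id S).comp k.retr)) :=
    (ContinuousMap.Homotopic.refl i).comp (h1.comp (ContinuousMap.Homotopic.refl k.retr))
  exact (a1.trans a2).trans k.comp_retr

theorem InclIsHEquiv.of_image {κ : Y → X} (hκ : IsEmbedding κ) {S T : Set Y}
    (h : InclIsHEquiv (κ '' S) (κ '' T)) : InclIsHEquiv S T := by
  obtain ⟨e, he⟩ := h
  refine ⟨((hκ.homeomorphImage S).toHomotopyEquiv.trans e).trans
    (hκ.homeomorphImage T).symm.toHomotopyEquiv, fun x => ?_⟩
  apply hκ.injective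
  have h1 : ∀ y : κ '' T, κ ((hκ.homeomorphImage T).symm y) = y := fun y =>
    congrArg Subtype.val ((hκ.homeomorphImage T).apply_symm_apply y)
  exact (h1 _).trans (he _)

end Deform

/-! ### Neighborhood deformation retracts and the homotopy extension property -/

section NDR

variable {X Y : Type*} [TopologicalSpace X] [TopologicalSpace Y]

/-- Some neighborhood of the closed set `A` can be deformed into `A` within `X`, by a homotopy of
`X` that fixes `A`. -/
def IsNDR (A : Set X) : Prop :=
  IsClosed A ∧ ∃ (F : X × ℝ → X) (l : X → ℝ), Continuous F ∧ Continuous l ∧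
    (∀ x, ∀ t ≤ 0, F (x, t) = x) ∧ (∀ a ∈ A, ∀ t, F (a, t) = a) ∧ (∀ a ∈ A, l a = 1) ∧
    ∀ x, 0 < l x → F (x, 1) ∈ A

theorem IsNDR.prod_univ {A : Set X} (hA : IsNDR A) : IsNDR (A ×ˢ (univ : Set ℝ)) := by
  obtain ⟨hc, F, l, hF, hl, h0, hfix, hl1, hmem⟩ := hA
  refine ⟨hc.prod isClosed_univ, fun p => (F (p.1.1, p.2), p.1.2), fun p => l p.1,
    by fun_prop, by fun_prop, ?_, ?_, ?_, ?_⟩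
  · rintro ⟨x, s⟩ t ht
    simp [h0 x t ht]
  · rintro ⟨x, s⟩ hx t
    simp [hfix x hx.1 t]
  · rintro ⟨x, s⟩ hx
    exact hl1 x hx.1
  · rintro ⟨x, s⟩ hx
    exact ⟨hmem x hx, mem_univ _⟩

/-- The homotopy extension property, up to a delay. -/
theorem IsNDR.extend {A : Set X} (hA : IsNDR A) {f : X → Y} (hf : Continuous f) {G : X × ℝ → Y}
    (hG : ContinuousOn G (A ×ˢ univ)) (hG0 : ∀ a ∈ A, ∀ t ≤ 0, G (a, t) = f a) :
    ∃ G' : X × ℝ → Y, Continuous G' ∧ (∀ x, ∀ t ≤ 0, G' (x, t) = f x) ∧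
      ∀ a ∈ A, ∀ t, G' (a, t) = G (a, 2 * t - 1) := by
  classical
  obtain ⟨-, F, l, hF, hl, h0, hfix, hl1, hmem⟩ := hA
  -- `μ` is `1` on `A` and `0` where `l ≤ 1/2`. Running `G` at speed `μ` keeps it at its initial map
  -- `f` wherever `l` is small, so the two branches of `K` agree around the set where `l` ceases to
  -- be positive.
  let μ : X → ℝ := fun x => max 0 (2 * l x - 1)
  have hμ : Continuous μ := by fun_prop
  let K : X × ℝ → Y := fun p => if 0 < l p.1 then G (F (p.1, 1), (2 * p.2 - 1) * μ p.1)
    else f (F (p.1, 1))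
  have hK : Continuous K := by
    rw [continuous_iff_continuousAt]
    rintro ⟨x, t⟩
    rcases lt_or_ge 0 (l x) with hx | hx
    · have ho : IsOpen {p : X × ℝ | 0 < l p.1} := isOpen_lt continuous_const (by fun_prop)
      have hc : ContinuousOn (fun p : X × ℝ => G (F (p.1, 1), (2 * p.2 - 1) * μ p.1))
          {p : X × ℝ | 0 < l p.1} :=
        hG.comp (by fun_prop) fun p hp => ⟨hmem _ hp, mem_univ _⟩
      refine (hc.continuousAt (ho.mem_nhds hx)).congr ?_
      filter_upwards [ho.mem_nhds hx] with p hp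
      have : 0 < l p.1 := hp
      simp [K, this]
    · have ho : IsOpen {p : X × ℝ | l p.1 < 1 / 2} := isOpen_lt (by fun_prop) continuous_const
      have hx' : (x, t) ∈ {p : X × ℝ | l p.1 < 1 / 2} := by
        simp only [mem_ofPred_eq]; linarith
      have hc : Continuous fun p : X × ℝ => f (F (p.1, 1)) := by fun_prop
      refine hc.continuousAt.congr ?_
      filter_upwards [ho.mem_nhds hx'] with p hp
      simp only [K]
      split_ifs with h
      · have : μ p.1 = 0 := max_eq_left (by have : l p.1 < 1 / 2 := hp; linarith)
        rw [this, mul_zero, hG0 _ (hmem _ h) _ le_rfl]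
      · rfl
  -- The first half of the time is spent drawing the neighborhood into `A` by `F`; only then does
  -- `G` run, whence the delay `2 * t - 1`.
  refine ⟨fun p => if p.2 ≤ 1 / 2 then f (F (p.1, 2 * p.2)) else K p, ?_, ?_, ?_⟩
  · refine Continuous.if_le (by fun_prop) hK continuous_snd continuous_const ?_
    rintro ⟨x, t⟩ ht
    have ht' : t = 1 / 2 := ht
    subst ht'
    simp only [K]
    norm_num
    intro h
    rw [hG0 _ (hmem _ h) _ le_rfl]
  · intro x t ht
    have : t ≤ 1 / 2 := by linarith
    simp only [this, if_true, h0 x (2 * t) (by linarith)]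
  · intro a ha t
    have h1 : l a = 1 := hl1 a ha
    have h2 : μ a = 1 := by simp only [μ, h1]; norm_num
    simp only [K, h1, h2, hfix a ha, zero_lt_one, if_true, mul_one]
    split_ifs with h
    · rw [hG0 a ha _ (by linarith)]
    · rfl

/-- A neighborhood deformation retract whose inclusion is a homotopy equivalence is a
deformation retract. -/
theorem IsNDR.exists_retraction {A : Set X} (hA : IsNDR A) (h : InclIsHEquiv A univ) :
    ∃ (N : X × ℝ → X) (r : X → X), Continuous N ∧ Continuous r ∧ (∀ x, r x ∈ A) ∧
      (∀ a ∈ A, r a = a) ∧ (∀ x, ∀ t ≤ 0, N (x, t) = x) ∧ ∀ x, ∀ t ≥ 1, N (x, t) = r x := by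
  classical
  obtain ⟨g, ⟨J⟩, ⟨K⟩⟩ := h.exists_inverse
  let c : ℝ → unitInterval := projIcc 0 1 zero_le_one
  have hc : Continuous c := continuous_projIcc
  have c0 : ∀ t ≤ 0, c t = 0 := fun t ht => projIcc_of_le_left _ ht
  have c1 : ∀ t ≥ 1, c t = 1 := fun t ht => projIcc_of_right_le _ ht
  let g' : X → A := fun x => g ⟨x, mem_univ x⟩
  have hg' : Continuous g' := by fun_prop
  -- The homotopy `J` from the restriction of `g` to the identity of `A` extends to a homotopy of
  -- `g` on all of `X`; its end `r` is the identity on `A`.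
  obtain ⟨R, hR, hR0, hRA⟩ := hA.extend hg'
    (G := fun p => if hp : p.1 ∈ A then J (c p.2, ⟨p.1, hp⟩) else g' p.1) (by
      rw [continuousOn_iff_continuous_domRestrict]
      have : Continuous fun p : (A ×ˢ (univ : Set ℝ) : Set (X × ℝ)) =>
          J (c p.1.2, ⟨p.1.1, p.2.1⟩) := by fun_prop
      refine this.congr fun p => ?_
      simp [p.2.1]) (by
      intro a ha t ht
      simp only [ha, dite_true, c0 t ht, ContinuousMap.Homotopy.apply_zero]
      rfl)
  let r : X → X := fun x => R (x, 1)
  have hrA : ∀ x, r x ∈ A := fun x => (R (x, 1)).2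
  have hr : ∀ a ∈ A, r a = a := by
    intro a ha
    simp only [r]
    rw [hRA a ha]
    simp only [ha, dite_true]
    rw [c1 _ (by norm_num), ContinuousMap.Homotopy.apply_one]
    rfl
  have hrc : Continuous r := by fun_prop
  -- From the identity to `g` along the reverse of `K`, then from `g` to `r` along `R`.
  let N : X × ℝ → X := fun p => if p.2 ≤ 1 / 2 then (K (c (1 - 2 * p.2), ⟨p.1, mem_univ _⟩)).1
    else R (p.1, c (2 * p.2 - 1))
  have hN : Continuous N := by
    refine Continuous.if_le (by fun_prop) (by fun_prop) continuous_snd continuous_const ?_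
    rintro ⟨x, t⟩ ht
    have ht' : t = 1 / 2 := ht
    subst ht'
    have e1 : c (1 - 2 * (1 / 2)) = 0 := c0 _ (by norm_num)
    have e2 : c (2 * (1 / 2) - 1) = 0 := c0 _ (by norm_num)
    simp only [e1, e2, ContinuousMap.Homotopy.apply_zero]
    rw [hR0 x _ (by simp)]
    rfl
  have hN0 : ∀ x, ∀ t ≤ 0, N (x, t) = x := by
    intro x t ht
    have : t ≤ 1 / 2 := by linarith
    simp only [N, this, if_true]
    rw [c1 _ (by linarith), ContinuousMap.Homotopy.apply_one]
    rfl
  have hN1 : ∀ x, ∀ t ≥ 1, N (x, t) = r x := by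
    intro x t ht
    have : ¬ t ≤ 1 / 2 := by linarith
    simp only [N, this, if_false]
    rw [c1 _ (by linarith)]
    rfl
  exact ⟨N, r, hN, hrc, hrA, hr, hN0, hN1⟩

/-- A neighborhood deformation retract whose inclusion is a homotopy equivalence is a strong
deformation retract. -/
theorem IsNDR.isSDR {A : Set X} (hA : IsNDR A) (h : InclIsHEquiv A univ) : IsSDR A univ := by
  obtain ⟨N, r, hN, hrc, hrA, hr, hN0, hN1⟩ := hA.exists_retraction h
  -- `N` need not fix `A`. Running `N` forwards, and then backwards from `r x`, is a homotopy over
  -- `[0, 2]` from the identity to `r` whose trace at a point of `A` is a path followed by its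
  -- reverse.
  let L : X × ℝ → X := fun p => if p.2 ≤ 1 then N p else N (r p.1, 2 - p.2)
  have hL : Continuous L := by
    refine Continuous.if_le hN (by fun_prop) continuous_snd continuous_const ?_
    rintro ⟨x, t⟩ ht
    have ht' : t = 1 := ht
    subst ht'
    rw [hN1 x _ le_rfl]
    norm_num
    rw [hN1 _ _ le_rfl, hr _ (hrA x)]
  -- Out-and-back paths are contracted by capping the time of `N` at `1 - t`; the contraction
  -- extends from `A × ℝ` to `X × ℝ`.
  obtain ⟨P, hP, hP0, hPA⟩ := hA.prod_univ.extend hL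
    (G := fun q => N (q.1.1, min (min q.1.2 (2 - q.1.2)) (1 - q.2))) (by fun_prop) (by
      rintro ⟨a, s⟩ ⟨ha, -⟩ t ht
      simp only [L]
      split_ifs with hs
      · congr 2
        rw [min_eq_left (by linarith : s ≤ 2 - s), min_eq_left (by linarith)]
      · push Not at hs
        rw [hr a ha]
        congr 2
        rw [min_eq_right (by linarith : 2 - s ≤ s), min_eq_left (by linarith)])
  have hL0 : ∀ x, L (x, 0) = x := fun x => by simp [L, hN0]
  have hL2 : ∀ x, L (x, 2) = r x := fun x => by
    have : ¬ (2 : ℝ) ≤ 1 := by norm_num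
    simp only [L, this, if_false]
    exact hN0 _ _ (by norm_num)
  obtain ⟨d, hd, d0, d1⟩ : ∃ d : ℝ → ℝ, Continuous d ∧ (∀ t ≤ 0, d t = 0) ∧
      ∀ t ≥ 1, d t = 1 := by
    refine ⟨fun t => max 0 (min t 1), by fun_prop, fun t ht => ?_, fun t ht => ?_⟩
    · exact max_eq_left ((min_le_left _ _).trans ht)
    · simp only [min_eq_right (show (1 : ℝ) ≤ t from ht)]; norm_num
  -- The pair `(σ, θ)` runs along three sides of `[0, 2] × [0, 1]`: up at `σ = 0`, across at `θ =
  -- 1`, down at `σ = 2`. On each of them the capped time is at most `0` over `A`, so `A` stays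
  -- fixed.
  let σ : ℝ → ℝ := fun τ => 2 * d (3 * τ - 1)
  let θ : ℝ → ℝ := fun τ => min (d (3 * τ)) (d (3 - 3 * τ))
  have hσ : Continuous σ := by fun_prop
  have hθ : Continuous θ := by fun_prop
  have hcont : Continuous fun p : X × ℝ => P ((p.1, σ p.2), θ p.2) :=
    hP.comp ((continuous_fst.prodMk (hσ.comp continuous_snd)).prodMk (hθ.comp continuous_snd))
  have hfin : ∀ x, ∀ τ ≥ 1, P ((x, σ τ), θ τ) = r x := by
    intro x τ hτ
    have e1 : σ τ = 2 := by simp only [σ]; rw [d1 _ (by linarith)]; norm_num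
    have e2 : θ τ = 0 := by
      simp only [θ]; rw [d1 _ (by linarith), d0 _ (by linarith)]; norm_num
    rw [e1, e2, hP0 _ _ le_rfl, hL2]
  refine ⟨fun p => P ((p.1, σ p.2), θ p.2), subset_univ _, hcont.continuousOn, fun _ _ _ => mem_univ _,
    ?_, ?_, ?_, ?_⟩
  · intro x _ τ hτ
    have e1 : σ τ = 0 := by simp only [σ]; rw [d0 _ (by linarith)]; norm_num
    have e2 : θ τ = 0 := by
      simp only [θ]; rw [d0 _ (by linarith), d1 _ (by linarith)]; norm_num
    simp only [e1, e2, hP0 _ _ le_rfl, hL0]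
  · intro x _ τ hτ
    simp only [hfin x τ hτ, hfin x 1 le_rfl]
  · intro x _
    simp only [hfin x 1 le_rfl]
    exact hrA x
  · intro a ha τ
    change P ((a, σ τ), θ τ) = a
    rw [hPA (a, σ τ) ⟨ha, mem_univ _⟩]
    refine hN0 _ _ ?_
    rcases le_total τ (1 / 3) with h | h
    · have e1 : σ τ = 0 := by simp only [σ]; rw [d0 _ (by linarith)]; norm_num
      simp [e1]
    rcases le_total τ (2 / 3) with h' | h'
    · have e2 : θ τ = 1 := by
        simp only [θ]; rw [d1 _ (by linarith), d1 _ (by linarith)]; norm_num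
      rw [e2]; exact (min_le_right _ _).trans (by norm_num)
    · have e1 : σ τ = 2 := by simp only [σ]; rw [d1 _ (by linarith)]; norm_num
      rw [e1]; exact (min_le_left _ _).trans ((min_le_right _ _).trans (by norm_num))

/-- Criterion for neighborhood deformation retracts: local deformations onto a compact set can be
composed. -/
theorem isNDR_of_local [NormalSpace X] {A : Set X} (hA : IsCompact A) (hAc : IsClosed A)
    (h : ∀ p ∈ A, ∃ F : X × ℝ → X, Continuous F ∧ (∀ x, ∀ t ≤ 0, F (x, t) = x) ∧
      (∀ a ∈ A, ∀ t, F (a, t) = a) ∧ ∀ᶠ x in 𝓝 p, F (x, 1) ∈ A) : IsNDR A := by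
  have key : ∃ F : X × ℝ → X, Continuous F ∧ (∀ x, ∀ t ≤ 0, F (x, t) = x) ∧
      (∀ a ∈ A, ∀ t, F (a, t) = a) ∧ ∀ p ∈ A, p ∈ A → ∀ᶠ x in 𝓝 p, F (x, 1) ∈ A := by
    refine hA.induction_on (p := fun s => ∃ F : X × ℝ → X, Continuous F ∧
      (∀ x, ∀ t ≤ 0, F (x, t) = x) ∧ (∀ a ∈ A, ∀ t, F (a, t) = a) ∧
      ∀ p ∈ s, p ∈ A → ∀ᶠ x in 𝓝 p, F (x, 1) ∈ A) ?_ ?_ ?_ ?_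
    · exact ⟨Prod.fst, continuous_fst, fun _ _ _ => rfl, fun _ _ _ => rfl, fun _ h => h.elim⟩
    · rintro s t hst ⟨F, h1, h2, h3, h4⟩
      exact ⟨F, h1, h2, h3, fun p hp => h4 p (hst hp)⟩
    -- `G` is run after `F`. It fixes `A`, so what `F` has brought into `A` stays there; and `F`
    -- fixes the points of `A`, so it keeps nearby points near them, where `G` takes over.
    · rintro s t ⟨F, h1, h2, h3, h4⟩ ⟨G, k1, k2, k3, k4⟩
      refine ⟨fun p => G (F p, p.2), by fun_prop, fun x t ht => ?_, fun a ha t => ?_, ?_⟩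
      · simp only [h2 x t ht, k2 x t ht]
      · simp only [h3 a ha t, k3 a ha t]
      · rintro p (hp | hp) hpA
        · filter_upwards [h4 p hp hpA] with x hx
          simp only [k3 _ hx]; exact hx
        · have hc : Tendsto (fun x => F (x, 1)) (𝓝 p) (𝓝 p) := by
            have : Continuous fun x => F (x, 1) := by fun_prop
            simpa [h3 p hpA] using this.tendsto p
          exact hc.eventually (k4 p hp hpA)
    · intro p hp
      obtain ⟨F, h1, h2, h3, h4⟩ := h p hp
      obtain ⟨O, hO1, hO2, hO3⟩ := eventually_nhds_iff.1 h4
      refine ⟨O, mem_nhdsWithin_of_mem_nhds (hO2.mem_nhds hO3), F, h1, h2, h3, fun q hq _ => ?_⟩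
      exact eventually_nhds_iff.2 ⟨O, hO1, hO2, hq⟩
  obtain ⟨F, h1, h2, h3, h4⟩ := key
  -- A Urysohn function serves as `l`: it is `1` on `A`, and it vanishes off the open set of points
  -- known to be carried into `A`.
  obtain ⟨f, hf0, hf1, -⟩ := exists_continuous_zero_one_of_isClosed
    (s := (interior {x | F (x, 1) ∈ A})ᶜ) (t := A) isOpen_interior.isClosed_compl hAc (by
      rw [Set.disjoint_left]
      intro x hx hxA
      exact hx (mem_interior_iff_mem_nhds.2 (h4 x hxA hxA)))
  refine ⟨hAc, F, f, h1, f.continuous, h2, h3, fun a ha => hf1 ha, fun x hx => ?_⟩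
  by_contra hcon
  have : f x = 0 := hf0 fun h => hcon (interior_subset (s := {x | F (x, 1) ∈ A}) h)
  linarith

end NDR

/-! ### Infinite concatenation of deformations -/

section Telescope

variable {X : Type*} [TopologicalSpace X]

/-- The deformation of the `k`-th piece of a telescope. -/
noncomputable def teleH (R : ℕ → X × ℝ → X) : ℕ → X × ℝ → X
  | 0 => fun p => R 0 (p.1, 2 * p.2 - 1)
  | k + 1 => fun p => if p.2 ≤ (1 / 2) ^ (k + 1) then R (k + 1) (p.1, 2 ^ (k + 2) * p.2 - 1)
      else teleH R k (R (k + 1) (p.1, 1), p.2)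

variable {Z A : ℕ → Set X} {R : ℕ → X × ℝ → X}

/-- Piece `k` moves to its initial end between the times `2^-(k+1)` and `2^-k` and then follows the
pieces of lower index. Hence no later piece is still moving by itself when an earlier one starts. -/
theorem teleH_static (hR : ∀ k, Deforms (A k) (Z k) (R k)) (k : ℕ) :
    ∀ x ∈ Z k, ∀ t ≤ (1 / 2) ^ (k + 1), teleH R k (x, t) = x := by
  intro x hx t ht
  cases k with
  | zero =>
    simp only [teleH]
    exact (hR 0).zero x hx _ (by norm_num at ht; linarith)
  | succ k =>
    have h1 : (0 : ℝ) < (1 / 2) ^ (k + 1) := by positivity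
    have h2 : t ≤ (1 / 2) ^ (k + 1) := by rw [pow_succ] at ht; linarith
    simp only [teleH, h2, if_true]
    refine (hR (k + 1)).zero x hx _ ?_
    have h3 : (2 : ℝ) ^ (k + 2) * t ≤ 2 ^ (k + 2) * (1 / 2) ^ (k + 2) :=
      mul_le_mul_of_nonneg_left ht (by positivity)
    rw [← mul_pow] at h3
    norm_num at h3
    linarith

/-- On `A (k + 1)` the own motion of piece `k + 1` is constant, and piece `k` is still at rest
during that time, so the two formulas agree. -/
theorem teleH_succ_eq (hR : ∀ k, Deforms (A k) (Z k) (R k)) (hA : ∀ k, A (k + 1) ⊆ Z k) (k : ℕ) :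
    ∀ x ∈ A (k + 1), ∀ t, teleH R (k + 1) (x, t) = teleH R k (x, t) := by
  intro x hx t
  simp only [teleH]
  split_ifs with h
  · rw [(hR (k + 1)).fixed x hx, teleH_static hR k x (hA k hx) t h]
  · rw [(hR (k + 1)).fixed x hx]

theorem teleH_continuousOn (hR : ∀ k, Deforms (A k) (Z k) (R k)) (hA : ∀ k, A (k + 1) ⊆ Z k)
    (k : ℕ) : ContinuousOn (teleH R k) (Z k ×ˢ univ) := by
  induction k with
  | zero =>
    exact (hR 0).cont.comp (by fun_prop) fun p hp => ⟨hp.1, mem_univ _⟩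
  | succ k ih =>
    have h1 : ContinuousOn (fun p : X × ℝ => R (k + 1) (p.1, 2 ^ (k + 2) * p.2 - 1))
        (Z (k + 1) ×ˢ univ) :=
      (hR (k + 1)).cont.comp (by fun_prop) fun p hp => ⟨hp.1, mem_univ _⟩
    have h2 : ContinuousOn (fun p : X × ℝ => teleH R k (R (k + 1) (p.1, 1), p.2))
        (Z (k + 1) ×ˢ univ) :=
      ih.comp (((hR (k + 1)).cont.comp (by fun_prop) fun p hp => ⟨hp.1, mem_univ _⟩).prodMk
        (by fun_prop)) fun p hp => ⟨hA k ((hR (k + 1)).mem _ hp.1), mem_univ _⟩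
    refine ContinuousOn.if ?_ (h1.mono inter_subset_left) (h2.mono inter_subset_left)
    rintro ⟨x, t⟩ ⟨hx, ht⟩
    have ht' : t = (1 / 2) ^ (k + 1) :=
      frontier_le_subset_eq continuous_snd continuous_const ht
    subst ht'
    simp only
    rw [teleH_static hR k _ (hA k ((hR (k + 1)).mem _ hx.1)) _ le_rfl]
    congr 2
    rw [pow_succ' 2 (k + 1), mul_assoc, ← mul_pow]
    norm_num

theorem teleH_maps (hR : ∀ k, Deforms (A k) (Z k) (R k)) (hA : ∀ k, A (k + 1) ⊆ Z k)
    (k : ℕ) : ∀ x ∈ Z k, ∀ t, ∃ j, teleH R k (x, t) ∈ Z j := by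
  induction k with
  | zero => exact fun x hx t => ⟨0, (hR 0).maps x hx _⟩
  | succ k ih =>
    intro x hx t
    simp only [teleH]
    split_ifs
    · exact ⟨_, (hR (k + 1)).maps x hx _⟩
    · exact ih _ (hA k ((hR (k + 1)).mem _ hx)) t

theorem teleH_end (hR : ∀ k, Deforms (A k) (Z k) (R k)) (hA : ∀ k, A (k + 1) ⊆ Z k)
    (k : ℕ) : ∀ x ∈ Z k, teleH R k (x, 1) ∈ A 0 ∧
      ∀ t ≥ 1, teleH R k (x, t) = teleH R k (x, 1) := by
  induction k with
  | zero =>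
    intro x hx
    simp only [teleH]
    norm_num
    exact ⟨(hR 0).mem x hx, fun t ht => (hR 0).one x hx _ (by linarith)⟩
  | succ k ih =>
    intro x hx
    have hlt : ∀ t : ℝ, t ≥ 1 → ¬ t ≤ (1 / 2) ^ (k + 1) := by
      intro t ht h
      have : ((1 : ℝ) / 2) ^ (k + 1) < 1 := pow_lt_one₀ (by norm_num) (by norm_num) (by omega)
      linarith
    obtain ⟨h1, h2⟩ := ih _ (hA k ((hR (k + 1)).mem _ hx))
    simp only [teleH, hlt 1 le_rfl, if_false]
    exact ⟨h1, fun t ht => by simp only [hlt t ht, if_false]; exact h2 t ht⟩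

/-- An infinite concatenation of strong deformation retractions. -/
theorem isSDR_iUnion (hZ : ∀ k, IsClosed (Z k)) (hlf : LocallyFinite Z)
    (hR : ∀ k, IsSDR (A k) (Z k)) (hA : ∀ k, A (k + 1) ⊆ Z k)
    (hZA : ∀ j k, j < k → Z j ∩ Z k ⊆ A k) : IsSDR (A 0) (⋃ k, Z k) := by
  classical
  choose R hR using hR
  -- A point of `Z j` and `Z k` with `j < k` lies in `A k`, hence in `Z (k - 1)`, and the formula
  -- descends one index at a time.
  have hagree : ∀ n j k, j + n = k → ∀ x ∈ Z j ∩ Z k, ∀ t,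
      teleH R k (x, t) = teleH R j (x, t) := by
    intro n
    induction n with
    | zero => rintro j k rfl x hx t; rfl
    | succ n ih =>
      rintro j k rfl x hx t
      have hxA : x ∈ A (j + n + 1) := hZA j _ (by omega) hx
      rw [← add_assoc, teleH_succ_eq hR hA _ x hxA]
      exact ih j _ rfl x ⟨hx.1, hA _ hxA⟩ t
  have hagree' : ∀ j k, ∀ x ∈ Z j ∩ Z k, ∀ t, teleH R k (x, t) = teleH R j (x, t) := by
    intro j k x hx t
    rcases le_total j k with h | h
    · exact hagree (k - j) j k (by omega) x hx t
    · exact (hagree (j - k) k j (by omega) x hx.symm t).symm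
  let H : X × ℝ → X := fun p => if h : ∃ k, p.1 ∈ Z k then teleH R h.choose p else p.1
  have hH : ∀ k, ∀ x ∈ Z k, ∀ t, H (x, t) = teleH R k (x, t) := by
    intro k x hx t
    have h : ∃ k, x ∈ Z k := ⟨k, hx⟩
    simp only [H, h, dite_true]
    exact hagree' k _ x ⟨hx, h.choose_spec⟩ t
  refine ⟨H, (hR 0).sub.trans (subset_iUnion Z 0), ?_, ?_, ?_, ?_, ?_, ?_⟩
  · rw [iUnion_prod_const]
    refine LocallyFinite.continuousOn_iUnion ?_ (fun k => (hZ k).prod isClosed_univ) fun k =>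
      (teleH_continuousOn hR hA k).congr fun p hp => hH k p.1 hp.1 p.2
    have := hlf.preimage_continuous (continuous_fst (X := X) (Y := ℝ))
    simpa only [prod_univ] using this
  · intro x hx t
    obtain ⟨k, hk⟩ := mem_iUnion.1 hx
    rw [hH k x hk]
    exact mem_iUnion.2 (teleH_maps hR hA k x hk t)
  · intro x hx t ht
    obtain ⟨k, hk⟩ := mem_iUnion.1 hx
    rw [hH k x hk]
    exact teleH_static hR k x hk t (ht.trans (by positivity))
  · intro x hx t ht
    obtain ⟨k, hk⟩ := mem_iUnion.1 hx
    rw [hH k x hk, hH k x hk]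
    exact (teleH_end hR hA k x hk).2 t ht
  · intro x hx
    obtain ⟨k, hk⟩ := mem_iUnion.1 hx
    rw [hH k x hk]
    exact (teleH_end hR hA k x hk).1
  · intro x hx t
    rw [hH 0 x ((hR 0).sub hx)]
    exact (hR 0).fixed x hx _

end Telescope

/-- A deformation of the space onto `S` that preserves `T'` and deforms it onto `S'` makes the
inclusion a homotopy equivalence of pairs. -/
theorem Deforms.inclIsPairHEquiv {X : Type*} [TopologicalSpace X] {S S' T' : Set X}
    {H : X × ℝ → X} (h : Deforms S univ H) (hS' : S' ⊆ S) (hST : S' ⊆ T')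
    (hT : ∀ x ∈ T', ∀ t, H (x, t) ∈ T') (hmem : T' ∩ S ⊆ S') :
    InclIsPairHEquiv S S' univ T' := by
  refine ⟨hS', subset_univ _, hST, ⟨inclusion h.sub, continuous_inclusion h.sub⟩, h.retr,
    fun x => rfl, fun x hx => hmem ⟨hT _ hx _, (h.retr x).2⟩, ?_, ?_⟩
  · let K : ContinuousMap.Homotopy (ContinuousMap.id _)
        ((⟨inclusion h.sub, continuous_inclusion h.sub⟩ : C(S, univ)).comp h.retr) :=
      ⟨⟨fun p => ⟨H (p.2, p.1), mem_univ _⟩, Continuous.subtype_mk (h.cont.comp_continuous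
        (by fun_prop) fun p => ⟨mem_univ _, mem_univ _⟩) _⟩,
        fun x => Subtype.ext (h.zero x x.2 _ le_rfl), fun x => rfl⟩
    exact ⟨K.symm, fun t x hx => hT _ hx _⟩
  · rw [h.retr_comp]
    exact ⟨ContinuousMap.Homotopy.refl _, fun t x hx => hx⟩

/-! ### Cubes for the supremum distance -/

section Cubes

variable {m : ℕ}

/-- The supremum distance. -/
noncomputable def supDist (x y : EuclideanSpace ℝ (Fin m)) : ℝ := ‖x.ofLp - y.ofLp‖

theorem continuous_supDist (y : EuclideanSpace ℝ (Fin m)) : Continuous fun x => supDist x y := by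
  unfold supDist
  fun_prop

theorem supDist_le_iff {x y : EuclideanSpace ℝ (Fin m)} {ε : ℝ} (hε : 0 ≤ ε) :
    supDist x y ≤ ε ↔ ∀ k, |x k - y k| ≤ ε := by
  rw [supDist, pi_norm_le_iff_of_nonneg hε]
  rfl

theorem abs_sub_le_supDist (x y : EuclideanSpace ℝ (Fin m)) (k : Fin m) :
    |x k - y k| ≤ supDist x y :=
  norm_le_pi_norm (x.ofLp - y.ofLp) k

theorem supDist_self (x : EuclideanSpace ℝ (Fin m)) : supDist x x = 0 := by
  simp [supDist]

variable [NeZero m]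

theorem isCompact_cube (y : EuclideanSpace ℝ (Fin m)) (ε : ℝ) :
    IsCompact {x : EuclideanHalfSpace m | supDist x.val y ≤ ε} := by
  have h1 : IsCompact {x : EuclideanSpace ℝ (Fin m) | supDist x y ≤ ε} := by
    have := (EuclideanSpace.equiv (Fin m) ℝ).toHomeomorph.isCompact_preimage.2
      (isCompact_closedBall y.ofLp ε)
    refine this.of_isClosed_subset (isClosed_le (continuous_supDist y) continuous_const) ?_
    intro x hx
    rw [mem_preimage, Metric.mem_closedBall, dist_eq_norm]
    exact hx
  have h2 : IsClosed {x : EuclideanSpace ℝ (Fin m) | 0 ≤ x 0} :=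
    isClosed_le continuous_const (continuous_coord 0)
  exact h2.isClosedEmbedding_subtypeVal.isCompact_preimage h1

theorem exists_cube_subset {y : EuclideanHalfSpace m} {V : Set (EuclideanHalfSpace m)}
    (hV : V ∈ 𝓝 y) : ∃ ε > 0, {x : EuclideanHalfSpace m | supDist x.val y.val ≤ ε} ⊆ V := by
  have hc : Continuous fun w : Fin m → ℝ => toHalf m (WithLp.toLp 2 w) :=
    continuous_toHalf.comp (by fun_prop)
  have : (fun w : Fin m → ℝ => toHalf m (WithLp.toLp 2 w)) ⁻¹' V ∈ 𝓝 y.val.ofLp :=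
    hc.continuousAt.preimage_mem_nhds (by simpa [val_toHalf] using hV)
  obtain ⟨ε, hε, h⟩ := Metric.nhds_basis_closedBall.mem_iff.1 this
  refine ⟨ε, hε, fun x hx => ?_⟩
  have h1 := h (show x.val.ofLp ∈ _ by rw [Metric.mem_closedBall, dist_eq_norm]; exact hx)
  simpa [val_toHalf] using h1

end Cubes

/-! ### Extending compactly supported self-maps of a chart by the identity -/

section Extend

variable {m : ℕ} [NeZero m] {X : Type*} [TopologicalSpace X]

open Classical in
/-- The self-map of `X` given by a self-map of the half-space in the chart `φ`, and by the identity
elsewhere. -/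
noncomputable def chartExtend (φ : OpenPartialHomeomorph X (EuclideanHalfSpace m))
    (g : EuclideanHalfSpace m → EuclideanHalfSpace m) (x : X) : X :=
  if x ∈ φ.source then φ.symm (g (φ x)) else x

theorem chartExtend_of_mem {φ : OpenPartialHomeomorph X (EuclideanHalfSpace m)}
    {g : EuclideanHalfSpace m → EuclideanHalfSpace m} {x : X} (hx : x ∈ φ.source) :
    chartExtend φ g x = φ.symm (g (φ x)) := by
  simp [chartExtend, hx]

theorem chartExtend_of_eq {φ : OpenPartialHomeomorph X (EuclideanHalfSpace m)}
    {g : EuclideanHalfSpace m → EuclideanHalfSpace m} {x : X}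
    (hx : x ∈ φ.source → g (φ x) = φ x) : chartExtend φ g x = x := by
  unfold chartExtend
  split_ifs with h
  · rw [hx h, φ.left_inv h]
  · rfl

/-- The image of the compact support `C` is closed because the space is Hausdorff. Off it the map is
the identity, and on the chart domain it is given by the formula; these two open sets cover. -/
theorem continuous_chartExtend [T2Space X] {Y : Type*} [TopologicalSpace Y]
    (φ : OpenPartialHomeomorph X (EuclideanHalfSpace m)) {C : Set (EuclideanHalfSpace m)}
    (hC : IsCompact C) (hCt : C ⊆ φ.target) {g : Y → EuclideanHalfSpace m → EuclideanHalfSpace m}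
    (hg : Continuous fun p : Y × EuclideanHalfSpace m => g p.1 p.2)
    (hfix : ∀ t, ∀ y ∉ C, g t y = y) (hmaps : ∀ t, ∀ y ∈ C, g t y ∈ C) :
    Continuous fun p : X × Y => chartExtend φ (g p.2) p.1 := by
  have hK : IsClosed (φ.symm '' C) := (hC.image_of_continuousOn
    (φ.continuousOn_symm.mono hCt)).isClosed
  have htarget : ∀ t, ∀ y ∈ φ.target, g t y ∈ φ.target := by
    intro t y hy
    by_cases h : y ∈ C
    · exact hCt (hmaps t y h)
    · rw [hfix t y h]; exact hy
  rw [continuous_iff_continuousAt]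
  rintro ⟨x, t⟩
  by_cases hx : x ∈ φ.source
  · have ho : IsOpen {p : X × Y | p.1 ∈ φ.source} := φ.open_source.preimage continuous_fst
    have hc : ContinuousOn (fun p : X × Y => φ.symm (g p.2 (φ p.1))) {p : X × Y | p.1 ∈ φ.source} :=
      φ.continuousOn_symm.comp (hg.comp_continuousOn (continuousOn_snd.prodMk
        (φ.continuousOn.comp continuousOn_fst fun p hp => hp)))
        fun p hp => htarget _ _ (φ.map_source hp)
    refine (hc.continuousAt (ho.mem_nhds hx)).congr ?_
    filter_upwards [ho.mem_nhds hx] with p hp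
    rw [chartExtend_of_mem hp]
  · have ho : IsOpen {p : X × Y | p.1 ∈ (φ.symm '' C)ᶜ} := hK.isOpen_compl.preimage continuous_fst
    have hx' : (x, t) ∈ {p : X × Y | p.1 ∈ (φ.symm '' C)ᶜ} := by
      rintro ⟨y, hy, rfl⟩
      exact hx (φ.map_target (hCt hy))
    refine continuous_fst.continuousAt.congr ?_
    filter_upwards [ho.mem_nhds hx'] with p hp
    refine (chartExtend_of_eq fun h => hfix _ _ fun hC => hp ?_).symm
    exact ⟨_, hC, φ.left_inv h⟩

end Extend

/-! ### Clean submanifolds of the boundary are neighborhood deformation retracts -/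

section CleanNDR

variable {m : ℕ} [NeZero m]

theorem continuous_toLp_comp {Y : Type*} [TopologicalSpace Y] {f : Y → Fin m → ℝ}
    (hf : ∀ k, Continuous fun y => f y k) :
    Continuous fun y => (WithLp.toLp 2 (f y) : EuclideanSpace ℝ (Fin m)) :=
  (PiLp.continuous_toLp 2 _).comp (continuous_pi hf)

/-- The local deformation of the half-space towards `{y | y 0 = 0, c i ≤ y i}`. -/
noncomputable def pushToFace (c : EuclideanSpace ℝ (Fin m)) (i : Fin m) (ε t : ℝ)
    (y : EuclideanHalfSpace m) : EuclideanHalfSpace m :=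
  toHalf m (WithLp.toLp 2 fun k => y.val k + max 0 (min 1 t) *
    max 0 (min 1 (2 - 2 * supDist y.val c / ε)) *
    ((if k = 0 then 0 else if k = i then max (y.val k) (c k) else y.val k) - y.val k))

/-- The product of the two weights lies in `[0, 1]`, so coordinate `0` is only scaled towards `0`.
The point never leaves the half-space and `toHalf` acts trivially. -/
theorem pushToFace_apply (c : EuclideanSpace ℝ (Fin m)) (i : Fin m) (ε t : ℝ)
    (y : EuclideanHalfSpace m) (k : Fin m) : (pushToFace c i ε t y).val k =
      y.val k + max 0 (min 1 t) * max 0 (min 1 (2 - 2 * supDist y.val c / ε)) *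
      ((if k = 0 then 0 else if k = i then max (y.val k) (c k) else y.val k) - y.val k) := by
  have h0 := y.2
  have h1 : max 0 (min 1 t) * max 0 (min 1 (2 - 2 * supDist y.val c / ε)) ≤ 1 :=
    mul_le_one₀ (max_le zero_le_one (min_le_left _ _)) (le_max_left _ _)
      (max_le zero_le_one (min_le_left _ _))
  rw [pushToFace, toHalf_val]
  simp only [if_true]
  nlinarith

theorem continuous_pushToFace (c : EuclideanSpace ℝ (Fin m)) (i : Fin m) (ε : ℝ) :
    Continuous fun p : ℝ × EuclideanHalfSpace m => pushToFace c i ε p.1 p.2 := by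
  unfold pushToFace
  refine continuous_toHalf.comp (continuous_toLp_comp fun k => ?_)
  have h1 : Continuous fun p : ℝ × EuclideanHalfSpace m => p.2.val k :=
    (continuous_valCoord k).comp continuous_snd
  have h2 : Continuous fun p : ℝ × EuclideanHalfSpace m => supDist p.2.val c :=
    (continuous_supDist c).comp (continuous_val.comp continuous_snd)
  split_ifs <;> fun_prop

variable {X : Type*} [TopologicalSpace X] [ChartedSpace (EuclideanHalfSpace m) X]
  [HasGroupoid X (plGroupoid m)]

/-- Compact clean submanifolds of the boundary are neighborhood deformation retracts. -/
theorem IsCleanInBdry.isNDR [T2Space X] [NormalSpace X] {A : Set X}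
    (hA : IsCleanInBdry m A) (hAc : IsCompact A) : IsNDR A := by
  refine isNDR_of_local hAc hA.2.1 fun p hp => ?_
  obtain ⟨φ, hφ, hps, -, i, -, hi⟩ := hA.exists_chart hp univ_mem
  obtain ⟨ε, hε, hC⟩ := exists_cube_subset (φ.open_target.mem_nhds (φ.map_source hps))
  set c := (φ p).val with hc
  have hc0 : c 0 = 0 := (mem_bdry_iff hφ hps).1 (hA.1 hp)
  have hβ : ∀ y : EuclideanHalfSpace m, ε < supDist y.val c →
      max 0 (min 1 (2 - 2 * supDist y.val c / ε)) = 0 := by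
    intro y hy
    refine max_eq_left ((min_le_right _ _).trans ?_)
    have : 1 < supDist y.val c / ε := (one_lt_div hε).2 hy
    rw [mul_div_assoc]; linarith
  have hfix : ∀ t : ℝ, ∀ y ∉ {x : EuclideanHalfSpace m | supDist x.val c ≤ ε},
      pushToFace c i ε t y = y := by
    intro t y hy
    refine Subtype.ext (PiLp.ext fun k => ?_)
    rw [pushToFace_apply, hβ y (not_le.1 hy)]; simp
  have hmaps : ∀ t : ℝ, ∀ y ∈ {x : EuclideanHalfSpace m | supDist x.val c ≤ ε},
      pushToFace c i ε t y ∈ {x : EuclideanHalfSpace m | supDist x.val c ≤ ε} := by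
    intro t y hy
    rw [mem_ofPred_eq, supDist_le_iff hε.le] at hy ⊢
    intro k
    rw [pushToFace_apply]
    set s := max 0 (min 1 t) * max 0 (min 1 (2 - 2 * supDist y.val c / ε)) with hs
    have hs1 : s ≤ 1 := mul_le_one₀ (max_le zero_le_one (min_le_left _ _)) (le_max_left _ _)
      (max_le zero_le_one (min_le_left _ _))
    have hs0 : 0 ≤ s := mul_nonneg (le_max_left _ _) (le_max_left _ _)
    have hk := abs_le.1 (hy k)
    rw [abs_le]
    split_ifs with h0 h1
    · subst h0
      rw [hc0] at hk ⊢
      constructor <;> nlinarith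
    · rcases max_cases (y.val k) (c k) with ⟨h, h'⟩ | ⟨h, h'⟩ <;> rw [h]
      · simpa using hk
      · constructor <;> nlinarith
    · simpa using hk
  refine ⟨fun q => chartExtend φ (pushToFace c i ε q.2) q.1,
    continuous_chartExtend φ (isCompact_cube c ε) hC (continuous_pushToFace c i ε) hfix hmaps,
    ?_, ?_, ?_⟩
  · intro x t ht
    refine chartExtend_of_eq fun _ => Subtype.ext (PiLp.ext fun k => ?_)
    rw [pushToFace_apply, max_eq_left ((min_le_right _ _).trans ht)]; simp
  · intro a ha t
    refine chartExtend_of_eq fun hs => Subtype.ext (PiLp.ext fun k => ?_)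
    rw [pushToFace_apply]
    have h0 := (mem_bdry_iff hφ hs).1 (hA.1 ha)
    have h1 := (hi a ⟨hs, hA.1 ha⟩).1 ha
    split_ifs with hk hk'
    · subst hk; simp [h0]
    · subst hk'; rw [max_eq_left h1]; simp
    · simp
  -- On the cube of half the size the cutoff equals `1`. At time `1` coordinate `0` is then `0` and
  -- coordinate `i` is at least `c i`, which describes `A` in the chart.
  · have ho : ∀ᶠ x in 𝓝 p, supDist (φ x).val c < ε / 2 := by
      have h1 : ContinuousAt (fun x => supDist (φ x).val c) p :=
        ((continuous_supDist c).comp continuous_val).continuousAt.comp (φ.continuousAt hps)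
      refine h1.eventually_lt continuousAt_const ?_
      change supDist c c < _
      rw [supDist_self]; positivity
    filter_upwards [ho, φ.open_source.mem_nhds hps] with x hx hxs
    rw [chartExtend_of_mem hxs]
    have hβ1 : max 0 (min 1 (2 - 2 * supDist (φ x).val c / ε)) = 1 := by
      have : supDist (φ x).val c / ε < 1 / 2 := by rw [div_lt_iff₀ hε]; linarith
      rw [min_eq_left, max_eq_right zero_le_one]
      rw [mul_div_assoc]; linarith
    set z := pushToFace c i ε 1 (φ x) with hz
    have hzk : ∀ k, z.val k = if k = 0 then 0 else if k = i then max ((φ x).val k) (c k)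
        else (φ x).val k := by
      intro k
      rw [hz, pushToFace_apply, hβ1]; simp
    have hzt : z ∈ φ.target := hC (hmaps 1 (φ x) (by
      simp only [mem_ofPred_eq]; linarith))
    have hzb : φ.symm z ∈ bdry m X := by
      rw [mem_bdry_iff hφ (φ.map_target hzt), φ.right_inv hzt, hzk]; simp
    rw [hi _ ⟨φ.map_target hzt, hzb⟩, φ.right_inv hzt, hzk]
    split_ifs with h h'
    · subst h; exact hc0.le
    · exact le_max_right _ _
    · exact absurd rfl h'

end CleanNDR

/-! ### Real-valued piecewise affine functions -/

section RealSelection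

variable {m : ℕ} {X : Type*} {l : Filter X} {u v : X → EuclideanSpace ℝ (Fin m)} {f g : X → ℝ}

/-- Along `l`, the real function `f` is a selection from finitely many affine functions of `u`. -/
def RealSelection (m : ℕ) {X : Type*} (l : Filter X) (u : X → EuclideanSpace ℝ (Fin m))
    (f : X → ℝ) : Prop :=
  ∃ F : Set (EuclideanSpace ℝ (Fin m) →ᵃ[ℝ] ℝ), F.Finite ∧ ∀ᶠ q in l, ∃ α ∈ F, f q = α (u q)

theorem RealSelection.coord (i : Fin m) : RealSelection m l u (fun q => u q i) :=
  ⟨{((EuclideanSpace.proj i : EuclideanSpace ℝ (Fin m) →L[ℝ] ℝ) :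
    EuclideanSpace ℝ (Fin m) →ₗ[ℝ] ℝ).toAffineMap}, Set.finite_singleton _,
    Eventually.of_forall fun _ => ⟨_, rfl, rfl⟩⟩

theorem RealSelection.const (c : ℝ) : RealSelection m l u (fun _ => c) :=
  ⟨{AffineMap.const ℝ _ c}, Set.finite_singleton _, Eventually.of_forall fun _ => ⟨_, rfl, rfl⟩⟩

theorem RealSelection.congr (h : RealSelection m l u f) (hfg : f =ᶠ[l] g) :
    RealSelection m l u g := by
  obtain ⟨F, hF, h⟩ := h
  refine ⟨F, hF, ?_⟩
  filter_upwards [h, hfg] with q ⟨α, hα, e⟩ e'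
  exact ⟨α, hα, by rw [← e', e]⟩

theorem RealSelection.map₂ (h : RealSelection m l u f) (k : RealSelection m l u g)
    (op : (EuclideanSpace ℝ (Fin m) →ᵃ[ℝ] ℝ) → (EuclideanSpace ℝ (Fin m) →ᵃ[ℝ] ℝ) →
      (EuclideanSpace ℝ (Fin m) →ᵃ[ℝ] ℝ)) {op' : ℝ → ℝ → ℝ}
    (hop : ∀ α β x, op α β x = op' (α x) (β x)) :
    RealSelection m l u (fun q => op' (f q) (g q)) := by
  obtain ⟨F, hF, h⟩ := h
  obtain ⟨G, hG, k⟩ := k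
  refine ⟨Set.image2 op F G, hF.image2 _ hG, ?_⟩
  filter_upwards [h, k] with q ⟨α, hα, e⟩ ⟨β, hβ, e'⟩
  exact ⟨_, ⟨α, hα, β, hβ, rfl⟩, by rw [hop, e, e']⟩

theorem RealSelection.add (h : RealSelection m l u f) (k : RealSelection m l u g) :
    RealSelection m l u (fun q => f q + g q) :=
  h.map₂ k (· + ·) fun _ _ _ => rfl

theorem RealSelection.sub (h : RealSelection m l u f) (k : RealSelection m l u g) :
    RealSelection m l u (fun q => f q - g q) :=
  h.map₂ k (· - ·) fun _ _ _ => rfl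

theorem RealSelection.const_mul (c : ℝ) (h : RealSelection m l u f) :
    RealSelection m l u (fun q => c * f q) :=
  h.map₂ h (fun α _ => c • α) (op' := fun a _ => c * a) fun _ _ _ => rfl

/-- Selections carry no continuity condition, so maximum, minimum and absolute value all reduce to a
pointwise choice between two values. -/
theorem RealSelection.or (h : RealSelection m l u f) (k : RealSelection m l u g) {e : X → ℝ}
    (he : ∀ q, e q = f q ∨ e q = g q) : RealSelection m l u e := by
  obtain ⟨F, hF, h⟩ := h
  obtain ⟨G, hG, k⟩ := k
  refine ⟨F ∪ G, hF.union hG, ?_⟩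
  filter_upwards [h, k] with q ⟨α, hα, e1⟩ ⟨β, hβ, e2⟩
  rcases he q with h | h
  · exact ⟨α, .inl hα, h.trans e1⟩
  · exact ⟨β, .inr hβ, h.trans e2⟩

theorem RealSelection.max (h : RealSelection m l u f) (k : RealSelection m l u g) :
    RealSelection m l u (fun q => max (f q) (g q)) :=
  h.or k fun _ => max_choice _ _

theorem RealSelection.min (h : RealSelection m l u f) (k : RealSelection m l u g) :
    RealSelection m l u (fun q => min (f q) (g q)) :=
  h.or k fun _ => min_choice _ _

theorem RealSelection.abs (h : RealSelection m l u f) : RealSelection m l u (fun q => |f q|) :=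
  h.or (h.const_mul (-1)) fun q => by simpa using abs_choice (f q)

theorem RealSelection.sup (h : ∀ k : Fin m, RealSelection m l u (fun q => v q k))
    {e : X → ℝ} (he : ∀ q, ∃ k, e q = v q k) : RealSelection m l u e := by
  choose F hF h using h
  refine ⟨⋃ k, F k, Set.finite_iUnion hF, ?_⟩
  filter_upwards [eventually_all.2 h] with q hq
  obtain ⟨k, hk⟩ := he q
  obtain ⟨α, hα, e⟩ := hq k
  exact ⟨α, mem_iUnion.2 ⟨k, hα⟩, hk.trans e⟩

theorem AffineSelection.of_coords (h : ∀ k : Fin m, RealSelection m l u (fun q => v q k)) :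
    AffineSelection m l u v := by
  choose F hF h using h
  refine ⟨(fun a : Fin m → (EuclideanSpace ℝ (Fin m) →ᵃ[ℝ] ℝ) =>
    ((WithLp.linearEquiv 2 ℝ (Fin m → ℝ)).symm.toLinearMap.toAffineMap).comp
      (AffineMap.pi a)) '' Set.pi univ F, (Set.Finite.pi hF).image _, ?_⟩
  filter_upwards [eventually_all.2 h] with q hq
  choose α hα e using hq
  exact ⟨_, ⟨α, fun k _ => hα k, rfl⟩, PiLp.ext e⟩

theorem AffineSelection.coord (h : AffineSelection m l u v) (k : Fin m) :
    RealSelection m l u (fun q => v q k) := by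
  obtain ⟨F, hF, h⟩ := h
  refine ⟨(fun α => ((EuclideanSpace.proj k : EuclideanSpace ℝ (Fin m) →L[ℝ] ℝ) :
    EuclideanSpace ℝ (Fin m) →ₗ[ℝ] ℝ).toAffineMap.comp α) '' F, hF.image _, ?_⟩
  filter_upwards [h] with q ⟨α, hα, e⟩
  exact ⟨_, ⟨α, hα, rfl⟩, by simp [e]⟩

end RealSelection

/-- Two partially defined continuous maps, inverse to each other where defined, form an open
partial homeomorphism. -/
def localHomeo {X Y : Type*} [TopologicalSpace X] [TopologicalSpace Y] (f : X → Y) (σ : Y → X)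
    {O : Set X} {V : Set Y} (hO : IsOpen O) (hV : IsOpen V) (hf : ContinuousOn f O)
    (hσ : ContinuousOn σ V) (h1 : ∀ x ∈ O, f x ∈ V → σ (f x) = x)
    (h2 : ∀ y ∈ V, σ y ∈ O → f (σ y) = y) : OpenPartialHomeomorph X Y where
  toFun := f
  invFun := σ
  source := O ∩ f ⁻¹' V
  target := V ∩ σ ⁻¹' O
  map_source' x hx := ⟨hx.2, by rw [mem_preimage, h1 x hx.1 hx.2]; exact hx.1⟩
  map_target' y hy := ⟨hy.2, by rw [mem_preimage, h2 y hy.1 hy.2]; exact hy.1⟩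
  left_inv' x hx := h1 x hx.1 hx.2
  right_inv' y hy := h2 y hy.1 hy.2
  open_source := hf.isOpen_inter_preimage hO hV
  open_target := hσ.isOpen_inter_preimage hV hO
  continuousOn_toFun := hf.mono inter_subset_left
  continuousOn_invFun := hσ.mono inter_subset_left

/-! ### Wedges: the half-space with a corner -/

section Wedge

variable {m : ℕ} [NeZero m]

/-- The level of the face of the wedge with index `i`. -/
def level (i : Fin m) : ℝ := if i = 0 then 1 else 0

/-- The wedge `{x | 0 ≤ x 0, level i ≤ x i}`: a half-space if `i = 0`, a quadrant otherwise. -/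
def Wedge (i : Fin m) : Set (EuclideanSpace ℝ (Fin m)) := {x | 0 ≤ x 0 ∧ level i ≤ x i}

theorem level_nonneg (i : Fin m) : 0 ≤ level i := by
  unfold level; split_ifs <;> norm_num

/-- The retraction of Euclidean space onto a wedge. -/
noncomputable def toWedge (i : Fin m) (x : EuclideanSpace ℝ (Fin m)) : Wedge i :=
  ⟨WithLp.toLp 2 fun k => if k = i then max (x k) (level i) else if k = 0 then max (x k) 0
    else x k, by
    constructor
    · simp only [if_true]
      split_ifs
      · exact (level_nonneg i).trans (le_max_right _ _)
      · exact le_max_right _ _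
    · simp⟩

theorem continuous_toWedge (i : Fin m) : Continuous (toWedge i) := by
  refine Continuous.subtype_mk (continuous_toLp_comp fun k => ?_) _
  split_ifs <;> fun_prop

theorem toWedge_val {i : Fin m} {x : EuclideanSpace ℝ (Fin m)} (hx : x ∈ Wedge i) :
    (toWedge i x).val = x := by
  refine PiLp.ext fun k => ?_
  simp only [toWedge]
  split_ifs with h h'
  · subst h; exact max_eq_left hx.2
  · subst h'; exact max_eq_left hx.1
  · rfl

theorem toWedge_coe {i : Fin m} (x : Wedge i) : toWedge i x.1 = x :=
  Subtype.ext (toWedge_val x.2)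

/-- Replacing a coordinate. -/
noncomputable def setCoord (i : Fin m) (x : EuclideanSpace ℝ (Fin m)) (c : ℝ) :
    EuclideanSpace ℝ (Fin m) := WithLp.toLp 2 (Function.update x.ofLp i c)

theorem setCoord_self (i : Fin m) (x : EuclideanSpace ℝ (Fin m)) (c : ℝ) :
    setCoord i x c i = c := by simp [setCoord]

theorem setCoord_ne {i k : Fin m} (h : k ≠ i) (x : EuclideanSpace ℝ (Fin m)) (c : ℝ) :
    setCoord i x c k = x k := by simp [setCoord, h]

theorem setCoord_eq (i : Fin m) (x : EuclideanSpace ℝ (Fin m)) : setCoord i x (x i) = x := by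
  refine PiLp.ext fun k => ?_
  by_cases h : k = i
  · subst h; rw [setCoord_self]
  · rw [setCoord_ne h]

theorem setCoord_setCoord (i : Fin m) (x : EuclideanSpace ℝ (Fin m)) (c d : ℝ) :
    setCoord i (setCoord i x c) d = setCoord i x d := by
  simp [setCoord]

theorem continuous_setCoord {Y : Type*} [TopologicalSpace Y] {i : Fin m}
    {f : Y → EuclideanSpace ℝ (Fin m)} {c : Y → ℝ} (hf : Continuous f) (hc : Continuous c) :
    Continuous fun y => setCoord i (f y) (c y) := by
  unfold setCoord
  fun_prop

theorem continuousOn_setCoord {Y : Type*} [TopologicalSpace Y] {i : Fin m} {S : Set Y}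
    {f : Y → EuclideanSpace ℝ (Fin m)} {c : Y → ℝ} (hf : ContinuousOn f S)
    (hc : ContinuousOn c S) : ContinuousOn (fun y => setCoord i (f y) (c y)) S := by
  have : Continuous fun p : EuclideanSpace ℝ (Fin m) × ℝ => setCoord i p.1 p.2 :=
    continuous_setCoord continuous_fst continuous_snd
  exact this.comp_continuousOn (hf.prodMk hc)

theorem AffineSelection.setCoord {X : Type*} {l : Filter X}
    {u v : X → EuclideanSpace ℝ (Fin m)} {f : X → ℝ} (h : AffineSelection m l u v)
    (hf : RealSelection m l u f) (i : Fin m) :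
    AffineSelection m l u (fun q => PLTop.setCoord i (v q) (f q)) := by
  refine .of_coords fun k => ?_
  by_cases hk : k = i
  · subst hk
    exact hf.congr (.of_forall fun q => (setCoord_self k _ _).symm)
  · exact (h.coord k).congr (.of_forall fun q => (setCoord_ne hk _ _).symm)

theorem setCoord_mem_wedge {i : Fin m} {x : EuclideanSpace ℝ (Fin m)} {c : ℝ}
    (hx : 0 ≤ x 0) (hc : level i ≤ c) : setCoord i x c ∈ Wedge i := by
  refine ⟨?_, by rwa [setCoord_self]⟩
  by_cases h : (0 : Fin m) = i
  · subst h; rw [setCoord_self]; exact (level_nonneg _).trans hc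
  · rwa [setCoord_ne h]

/-- The half-space is piecewise linearly homeomorphic to every wedge. The face of the wedge
corresponds to `{y | y 0 = 0, d ≤ y i}`. -/
noncomputable def wedgeHomeo (i : Fin m) (d : ℝ) : EuclideanHalfSpace m ≃ₜ Wedge i where
  -- For `i ≠ 0` the wall `y 0 = 0` is folded at `y i = d`: the part with `y i ≥ d` becomes the wall
  -- `x i = 0`, the rest becomes the wall `x 0 = 0`. The inverse reads off `y 0` as the minimum of
  -- `x 0` and `x i`, and `y i - d` as `x 0 - x i`.
  toFun y := toWedge i (if i = 0 then setCoord 0 y.val (y.val 0 + 1) else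
    setCoord i (setCoord 0 y.val (y.val 0 + max (y.val i - d) 0)) (y.val 0 + max (d - y.val i) 0))
  invFun x := toHalf m (if i = 0 then setCoord 0 x.val (x.val 0 - 1) else
    setCoord i (setCoord 0 x.val (min (x.val 0) (x.val i))) (d + x.val 0 - x.val i))
  left_inv y := by
    have hy := y.2
    by_cases hi : i = 0
    · subst hi
      simp only [if_true]
      have : setCoord 0 y.val (y.val 0 + 1) ∈ Wedge (0 : Fin m) :=
        setCoord_mem_wedge hy (by simp [level, hy])
      rw [toWedge_val this, setCoord_self, setCoord_setCoord]
      simp [setCoord_eq, val_toHalf]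
    · simp only [hi, if_false]
      have hi' : (0 : Fin m) ≠ i := Ne.symm hi
      rw [toWedge_val (setCoord_mem_wedge (by
        rw [setCoord_self]; exact add_nonneg hy (le_max_right _ _)) (by
        simp only [level, hi, if_false]; exact add_nonneg hy (le_max_right _ _)))]
      rw [← val_toHalf y]
      congr 1
      refine PiLp.ext fun k => ?_
      by_cases hk : k = i
      · subst hk
        rw [setCoord_self, setCoord_self, setCoord_ne hi', setCoord_self, val_toHalf]
        rcases le_total d (y.val k) with h | h
        · rw [max_eq_left (by linarith), max_eq_right (by linarith)]; ring
        · rw [max_eq_right (by linarith), max_eq_left (by linarith)]; ring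
      · by_cases hk0 : k = 0
        · subst hk0
          rw [setCoord_ne hi', setCoord_self, setCoord_ne hi', setCoord_self, setCoord_self,
            val_toHalf]
          rcases le_total d (y.val i) with h | h
          · rw [max_eq_left (by linarith), max_eq_right (by linarith), add_zero,
              min_eq_right (by linarith)]
          · rw [max_eq_right (by linarith), max_eq_left (by linarith), add_zero,
              min_eq_left (by linarith)]
        · rw [setCoord_ne hk, setCoord_ne hk0, setCoord_ne hk, setCoord_ne hk0, val_toHalf]
  right_inv x := by
    obtain ⟨x, hx0, hxi⟩ := x
    by_cases hi : i = 0
    · subst hi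
      have h1 : (1 : ℝ) ≤ x 0 := by simpa [level] using hxi
      simp only [if_true]
      rw [toHalf_val (by rw [setCoord_self]; linarith), setCoord_self, setCoord_setCoord]
      simp only [sub_add_cancel, setCoord_eq]
      exact toWedge_coe ⟨x, hx0, hxi⟩
    · simp only [hi, if_false]
      have hi' : (0 : Fin m) ≠ i := Ne.symm hi
      have h1 : (0 : ℝ) ≤ x i := by simpa [level, hi] using hxi
      rw [toHalf_val (by rw [setCoord_ne hi', setCoord_self]; exact le_min hx0 h1)]
      conv_rhs => rw [← toWedge_coe ⟨x, hx0, hxi⟩]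
      congr 1
      refine PiLp.ext fun k => ?_
      by_cases hk : k = i
      · subst hk
        rw [setCoord_self, setCoord_self, setCoord_ne hi', setCoord_self]
        rcases le_total (x 0) (x k) with h | h
        · rw [min_eq_left h, max_eq_left (by linarith)]; ring
        · rw [min_eq_right h, max_eq_right (by linarith)]; ring
      · by_cases hk0 : k = 0
        · subst hk0
          rw [setCoord_ne hi', setCoord_self, setCoord_ne hi', setCoord_self, setCoord_self]
          rcases le_total (x 0) (x i) with h | h
          · rw [min_eq_left h, max_eq_right (by linarith)]; ring
          · rw [min_eq_right h, max_eq_left (by linarith)]; ring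
        · rw [setCoord_ne hk, setCoord_ne hk0, setCoord_ne hk, setCoord_ne hk0]
  continuous_toFun := by
    refine (continuous_toWedge i).comp ?_
    have h0 := continuous_valCoord (m := m) 0
    have h1 := continuous_valCoord (m := m) i
    split_ifs
    · exact continuous_setCoord continuous_val (by fun_prop)
    · exact continuous_setCoord (continuous_setCoord continuous_val (by fun_prop)) (by fun_prop)
  continuous_invFun := by
    refine continuous_toHalf.comp ?_
    have h0 : Continuous fun x : Wedge i => x.val 0 :=
      (continuous_coord 0).comp continuous_subtype_val
    have h1 : Continuous fun x : Wedge i => x.val i :=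
      (continuous_coord i).comp continuous_subtype_val
    split_ifs
    · exact continuous_setCoord continuous_subtype_val (by fun_prop)
    · exact continuous_setCoord (continuous_setCoord continuous_subtype_val (by fun_prop))
        (by fun_prop)

theorem wedgeHomeo_val (i : Fin m) (d : ℝ) (y : EuclideanHalfSpace m) :
    (wedgeHomeo i d y).val = if i = 0 then setCoord 0 y.val (y.val 0 + 1) else
    setCoord i (setCoord 0 y.val (y.val 0 + max (y.val i - d) 0))
      (y.val 0 + max (d - y.val i) 0) := by
  have hy := y.2
  refine toWedge_val ?_
  split_ifs with hi
  · subst hi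
    exact setCoord_mem_wedge hy (by simp [level, hy])
  · refine setCoord_mem_wedge ?_ ?_
    · rw [setCoord_self]; exact add_nonneg hy (le_max_right _ _)
    · simp only [level, hi, if_false]; exact add_nonneg hy (le_max_right _ _)

theorem wedgeHomeo_symm_val (i : Fin m) (d : ℝ) (x : Wedge i) :
    ((wedgeHomeo i d).symm x).val = if i = 0 then setCoord 0 x.val (x.val 0 - 1) else
    setCoord i (setCoord 0 x.val (min (x.val 0) (x.val i))) (d + x.val 0 - x.val i) := by
  have hx := x.2
  refine toHalf_val ?_
  split_ifs with hi
  · subst hi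
    have h1 := hx.2
    simp only [level, if_true] at h1
    rw [setCoord_self]; linarith
  · have h1 := hx.2
    simp only [level, hi, if_false] at h1
    rw [setCoord_ne (Ne.symm hi), setCoord_self]; exact le_min hx.1 h1

theorem affineSelection_wedgeHomeo {X : Type*} {l : Filter X} (i : Fin m) (d : ℝ)
    (y : X → EuclideanHalfSpace m) :
    AffineSelection m l (fun q => (y q).val) (fun q => (wedgeHomeo i d (y q)).val) := by
  simp only [wedgeHomeo_val]
  have h0 : RealSelection m l (fun q => (y q).val) fun q => (y q).val 0 := .coord 0
  have h1 : RealSelection m l (fun q => (y q).val) fun q => (y q).val i := .coord i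
  have hc : ∀ c, RealSelection m l (fun q => (y q).val) fun _ => c := .const
  split_ifs
  · exact AffineSelection.refl.setCoord (h0.add (hc 1)) 0
  · exact (AffineSelection.refl.setCoord (h0.add ((h1.sub (hc d)).max (hc 0))) 0).setCoord
      (h0.add (((hc d).sub h1).max (hc 0))) i

theorem affineSelection_wedgeHomeo_symm {X : Type*} {l : Filter X} (i : Fin m) (d : ℝ)
    (x : X → Wedge i) :
    AffineSelection m l (fun q => (x q).val) (fun q => ((wedgeHomeo i d).symm (x q)).val) := by
  simp only [wedgeHomeo_symm_val]
  have h0 : RealSelection m l (fun q => (x q).val) fun q => (x q).val 0 := .coord 0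
  have h1 : RealSelection m l (fun q => (x q).val) fun q => (x q).val i := .coord i
  have hc : ∀ c, RealSelection m l (fun q => (x q).val) fun _ => c := .const
  split_ifs
  · exact AffineSelection.refl.setCoord (h0.sub (hc 1)) 0
  · exact (AffineSelection.refl.setCoord (h0.min h1) 0).setCoord (((hc d).add h0).sub h1) i

theorem wedgeHomeo_face (i : Fin m) (d : ℝ) (y : EuclideanHalfSpace m) :
    (wedgeHomeo i d y).val i = level i ↔ y.val 0 = 0 ∧ (i ≠ 0 → d ≤ y.val i) := by
  rw [wedgeHomeo_val]
  have hy := y.2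
  by_cases hi : i = 0
  · subst hi
    simp [level, setCoord_self]
  · simp only [hi, if_false, level, setCoord_self, ne_eq, not_false_eq_true, true_imp_iff]
    constructor
    · intro h
      have h1 := le_max_right (d - y.val i) 0
      have h2 := le_max_left (d - y.val i) 0
      constructor <;> linarith
    · rintro ⟨h, h'⟩
      rw [h, max_eq_right (by linarith), add_zero]

end Wedge

/-! ### Charts with values in a wedge -/

section WedgeCharts

variable {m : ℕ} [NeZero m] {X : Type*} [TopologicalSpace X]

/-- The projection of a wedge onto its face. -/
noncomputable def faceProj (i : Fin m) (x : Wedge i) : Wedge i :=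
  toWedge i (setCoord i x.val (level i))

theorem faceProj_val {i : Fin m} (x : Wedge i) :
    (faceProj i x).val = setCoord i x.val (level i) :=
  toWedge_val (setCoord_mem_wedge x.2.1 le_rfl)

theorem faceProj_face {i : Fin m} (x : Wedge i) : (faceProj i x).val i = level i := by
  rw [faceProj_val, setCoord_self]

theorem faceProj_eq {i : Fin m} {x : Wedge i} (h : x.val i = level i) : faceProj i x = x := by
  refine Subtype.ext ?_
  rw [faceProj_val, ← h, setCoord_eq]

theorem continuous_faceProj (i : Fin m) : Continuous (faceProj i) :=
  (continuous_toWedge i).comp (continuous_setCoord continuous_subtype_val continuous_const)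

theorem continuous_wedgeCoord (i k : Fin m) : Continuous fun x : Wedge i => x.val k :=
  (continuous_coord k).comp continuous_subtype_val

variable [ChartedSpace (EuclideanHalfSpace m) X]

/-- A piecewise linear chart with values in a wedge. -/
def IsWedgeChart {i : Fin m} (Φ : OpenPartialHomeomorph X (Wedge i)) : Prop :=
  ∀ q ∈ Φ.source,
    AffineSelection m (𝓝 q) (fun x => (chartAt (EuclideanHalfSpace m) q x).val)
      (fun x => (Φ x).val) ∧
    AffineSelection m (𝓝 q) (fun x => (Φ x).val)
      (fun x => (chartAt (EuclideanHalfSpace m) q x).val)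

theorem isWedgeChart_trans [HasGroupoid X (plGroupoid m)]
    {φ : OpenPartialHomeomorph X (EuclideanHalfSpace m)}
    (hφ : φ ∈ plCharts m X) (i : Fin m) (d : ℝ) :
    IsWedgeChart (φ.transHomeomorph (wedgeHomeo i d)) := by
  intro q hq
  have h1 : q ∈ φ.source := hq
  refine ⟨(affineSelection_of_mem (chartAt_mem_plCharts q) hφ (mem_chart_source _ q) h1).trans
    (affineSelection_wedgeHomeo i d φ), ?_⟩
  refine AffineSelection.trans ?_
    (affineSelection_of_mem hφ (chartAt_mem_plCharts q) h1 (mem_chart_source _ q))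
  refine (affineSelection_wedgeHomeo_symm (l := 𝓝 q) i d
    (φ.transHomeomorph (wedgeHomeo i d))).congr .rfl (.of_forall fun x => ?_)
  simp

/-- Near every point of a clean submanifold of the boundary there is a wedge chart in which the
submanifold is the face. -/
theorem IsCleanInBdry.exists_wedgeChart [HasGroupoid X (plGroupoid m)] {A : Set X}
    (hA : IsCleanInBdry m A) {p : X} (hp : p ∈ A) {U : Set X} (hU : U ∈ 𝓝 p) :
    ∃ (i : Fin m) (Φ : OpenPartialHomeomorph X (Wedge i)), p ∈ Φ.source ∧ Φ.source ⊆ U ∧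
      IsWedgeChart Φ ∧ ∀ q ∈ Φ.source, q ∈ A ↔ (Φ q).val i = level i := by
  obtain ⟨φ, hφ, hps, hφU, i, -, hi⟩ := hA.exists_chart hp hU
  refine ⟨i, φ.transHomeomorph (wedgeHomeo i ((φ p).val i)), hps, hφU,
    isWedgeChart_trans hφ _ _, fun q hq => ?_⟩
  have hqs : q ∈ φ.source := hq
  have e : (φ.transHomeomorph (wedgeHomeo i ((φ p).val i))) q =
    wedgeHomeo i ((φ p).val i) (φ q) := rfl
  rw [e, wedgeHomeo_face, ← mem_bdry_iff hφ hqs]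
  constructor
  · intro hqA
    exact ⟨hA.1 hqA, fun _ => (hi q ⟨hqs, hA.1 hqA⟩).1 hqA⟩
  · rintro ⟨hb, h⟩
    refine (hi q ⟨hqs, hb⟩).2 ?_
    by_cases h0 : i = 0
    · subst h0
      rw [(mem_bdry_iff hφ hps).1 (hA.1 hp)]; exact (φ q).2
    · exact h h0

end WedgeCharts

/-! ### Matching charts along an identification of faces -/

section Transfer

variable {m : ℕ} [NeZero m] {P Q : Type*} [TopologicalSpace P] [TopologicalSpace Q]

/-- Matching wedge charts on the two sides of an identification of faces. -/
theorem exists_matching_chart {D : Set P} {A : Set Q} (h : D ≃ₜ A) {i j : Fin m}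
    {Φ : OpenPartialHomeomorph P (Wedge i)} {Ψ : OpenPartialHomeomorph Q (Wedge j)}
    (hΦ : ∀ x ∈ Φ.source, x ∈ D ↔ (Φ x).val i = level i)
    (hΨ : ∀ x ∈ Ψ.source, x ∈ A ↔ (Ψ x).val j = level j)
    (hsrc : ∀ d : D, (d : P) ∈ Φ.source → (h d : Q) ∈ Ψ.source) (p : D)
    (hsel : ∀ a : A, (a : Q) ∈ Ψ.source → (h.symm a : P) ∈ Φ.source →
      AffineSelection m (𝓝 a) (fun q : A => (Ψ q).val) (fun q : A => (Φ (h.symm q)).val)) :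
    ∃ Φ' : OpenPartialHomeomorph Q (Wedge i), Φ'.source ⊆ Ψ.source ∧
      (∀ d : D, (h d : Q) ∈ Φ'.source ↔ (d : P) ∈ Φ.source) ∧
      (∀ d : D, (d : P) ∈ Φ.source → Φ' (h d) = Φ d) ∧
      (∀ y ∈ Φ'.source, y ∈ A ↔ (Φ' y).val i = level i) ∧
      ∀ y ∈ Φ'.source, AffineSelection m (𝓝 y) (fun q => (Ψ q).val) (fun q => (Φ' q).val) := by
  classical
  -- `a y` is the foot of `y` on the face `A` in the chart `Ψ`, and `c x` is the foot of `x` on `D`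
  -- in `Φ`. The fallback values `h p` and `p` only fill in outside `O₁` and `V₁`.
  let a : Q → A := fun y => if hy : Ψ.symm (faceProj j (Ψ y)) ∈ A then ⟨_, hy⟩ else h p
  let c : Wedge i → D := fun x => if hx : Φ.symm (faceProj i x) ∈ D then ⟨_, hx⟩ else p
  -- The new chart takes the face coordinates of the foot from `Φ`, through `h.symm`, and the height
  -- above the face from `Ψ`. The map `s`, read in `Ψ`, is its inverse.
  let f : Q → Wedge i := fun y =>
    toWedge i (setCoord i (Φ (h.symm (a y))).val (level i + ((Ψ y).val j - level j)))
  let s : Wedge i → Wedge j := fun x =>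
    toWedge j (setCoord j (Ψ (h (c x))).val (level j + (x.val i - level i)))
  let O₁ : Set Q := Ψ.source ∩ Ψ ⁻¹' (faceProj j ⁻¹' Ψ.target)
  let V₁ : Set (Wedge i) := faceProj i ⁻¹' Φ.target
  have hO₁ : IsOpen O₁ :=
    Ψ.isOpen_inter_preimage (Ψ.open_target.preimage (continuous_faceProj j))
  have hV₁ : IsOpen V₁ := Φ.open_target.preimage (continuous_faceProj i)
  have ha : ∀ y ∈ O₁, (a y : Q) = Ψ.symm (faceProj j (Ψ y)) := by
    intro y hy
    have : Ψ.symm (faceProj j (Ψ y)) ∈ A := by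
      rw [hΨ _ (Ψ.map_target hy.2), Ψ.right_inv hy.2, faceProj_face]
    simp only [a, this, dite_true]
  have has : ∀ y ∈ O₁, (a y : Q) ∈ Ψ.source := fun y hy => by
    rw [ha y hy]; exact Ψ.map_target hy.2
  have hΨa : ∀ y ∈ O₁, Ψ (a y) = faceProj j (Ψ y) := fun y hy => by
    rw [ha y hy, Ψ.right_inv hy.2]
  have hc : ∀ x ∈ V₁, (c x : P) = Φ.symm (faceProj i x) := by
    intro x hx
    have : Φ.symm (faceProj i x) ∈ D := by
      rw [hΦ _ (Φ.map_target hx), Φ.right_inv hx, faceProj_face]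
    simp only [c, this, dite_true]
  have hcs : ∀ x ∈ V₁, (c x : P) ∈ Φ.source := fun x hx => by
    rw [hc x hx]; exact Φ.map_target hx
  have hΦc : ∀ x ∈ V₁, Φ (c x) = faceProj i x := fun x hx => by
    rw [hc x hx, Φ.right_inv hx]
  have hac : ContinuousOn a O₁ := by
    rw [IsInducing.subtypeVal.continuousOn_iff]
    refine (Ψ.continuousOn_symm.comp ((continuous_faceProj j).comp_continuousOn
      (Ψ.continuousOn.mono inter_subset_left)) fun y hy => hy.2).congr ha
  have hcc : ContinuousOn c V₁ := by
    rw [IsInducing.subtypeVal.continuousOn_iff]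
    exact (Φ.continuousOn_symm.comp (continuous_faceProj i).continuousOn fun x hx => hx).congr hc
  let O : Set Q := O₁ ∩ (fun y => (h.symm (a y) : P)) ⁻¹' Φ.source
  have hbc : ContinuousOn (fun y => (h.symm (a y) : P)) O₁ :=
    (continuous_subtype_val.comp h.symm.continuous).comp_continuousOn hac
  have hO : IsOpen O := hbc.isOpen_inter_preimage hO₁ Φ.open_source
  have hsc : ContinuousOn s V₁ := by
    refine (continuous_toWedge j).comp_continuousOn (continuousOn_setCoord ?_ ?_)
    · refine continuous_subtype_val.comp_continuousOn (Ψ.continuousOn.comp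
        ((continuous_subtype_val.comp h.continuous).comp_continuousOn hcc) fun x hx => ?_)
      exact hsrc _ (hcs x hx)
    · have := continuous_wedgeCoord i i
      fun_prop
  let V : Set (Wedge i) := V₁ ∩ s ⁻¹' Ψ.target
  have hV : IsOpen V := hsc.isOpen_inter_preimage hV₁ Ψ.open_target
  have hfc : ContinuousOn f O := by
    refine (continuous_toWedge i).comp_continuousOn (continuousOn_setCoord ?_ ?_)
    · exact continuous_subtype_val.comp_continuousOn (Φ.continuousOn.comp
        (hbc.mono inter_subset_left) fun y hy => hy.2)
    · have := (continuous_wedgeCoord j j).comp_continuousOn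
        (Ψ.continuousOn.mono (fun y (hy : y ∈ O) => hy.1.1))
      exact continuousOn_const.add (this.sub continuousOn_const)
  have hfval : ∀ y, (f y).val =
      setCoord i (Φ (h.symm (a y))).val (level i + ((Ψ y).val j - level j)) := fun y =>
    toWedge_val (setCoord_mem_wedge (Φ _).2.1 (by have := (Ψ y).2.2; linarith))
  have hsval : ∀ x, (s x).val =
      setCoord j (Ψ (h (c x))).val (level j + (x.val i - level i)) := fun x =>
    toWedge_val (setCoord_mem_wedge (Ψ _).2.1 (by have := x.2.2; linarith))
  have hbface : ∀ y ∈ O, (Φ (h.symm (a y))).val i = level i := fun y hy =>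
    (hΦ _ hy.2).1 (h.symm (a y)).2
  have h1 : ∀ y ∈ O, f y ∈ V → Ψ.symm (s (f y)) = y := by
    intro y hy hfy
    have e1 : faceProj i (f y) = Φ (h.symm (a y)) := by
      refine Subtype.ext ?_
      rw [faceProj_val, hfval, setCoord_setCoord, ← hbface y hy, setCoord_eq]
    have e2 : c (f y) = h.symm (a y) := by
      refine Subtype.ext ?_
      rw [hc _ hfy.1, e1, Φ.left_inv hy.2]
    have e3 : s (f y) = Ψ y := by
      refine Subtype.ext ?_
      rw [hsval, e2, h.apply_symm_apply, hΨa y hy.1, faceProj_val, setCoord_setCoord, hfval,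
        setCoord_self, add_sub_cancel_left, add_sub_cancel, setCoord_eq]
    rw [e3, Ψ.left_inv hy.1.1]
  have h2 : ∀ x ∈ V, Ψ.symm (s x) ∈ O → f (Ψ.symm (s x)) = x := by
    intro x hx hy
    have hΨs : Ψ (Ψ.symm (s x)) = s x := Ψ.right_inv hx.2
    have hh : (Ψ (h (c x))).val j = level j := (hΨ _ (hsrc _ (hcs x hx.1))).1 (h (c x)).2
    have e1 : faceProj j (s x) = Ψ (h (c x)) := by
      refine Subtype.ext ?_
      rw [faceProj_val, hsval, setCoord_setCoord, ← hh, setCoord_eq]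
    have e2 : a (Ψ.symm (s x)) = h (c x) := by
      refine Subtype.ext ?_
      rw [ha _ hy.1, hΨs, e1, Ψ.left_inv (hsrc _ (hcs x hx.1))]
    refine Subtype.ext ?_
    rw [hfval, e2, h.symm_apply_apply, hΨs, hΦc x hx.1, faceProj_val, setCoord_setCoord, hsval,
      setCoord_self, add_sub_cancel_left, add_sub_cancel, setCoord_eq]
  let Φ' := localHomeo f (fun x => Ψ.symm (s x)) hO hV hfc
    (Ψ.continuousOn_symm.comp (hsc.mono inter_subset_left) fun x hx => hx.2) h1 h2
  have hface : ∀ d : D, (d : P) ∈ Φ.source → (h d : Q) ∈ O₁ ∧ a (h d) = h d := by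
    intro d hd
    have hΨh := (hΨ _ (hsrc d hd)).1 (h d).2
    have e : faceProj j (Ψ (h d)) = Ψ (h d) := faceProj_eq hΨh
    have h3 : (h d : Q) ∈ O₁ := ⟨hsrc d hd, by
      rw [mem_preimage, mem_preimage, e]; exact Ψ.map_source (hsrc d hd)⟩
    refine ⟨h3, Subtype.ext ?_⟩
    rw [ha _ h3, e, Ψ.left_inv (hsrc d hd)]
  have hfΦ : ∀ d : D, (d : P) ∈ Φ.source → f (h d) = Φ d := by
    intro d hd
    refine Subtype.ext ?_
    have hΨh := (hΨ _ (hsrc d hd)).1 (h d).2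
    rw [hfval, (hface d hd).2, h.symm_apply_apply, hΨh, sub_self, add_zero,
      ← (hΦ _ hd).1 d.2, setCoord_eq]
  have hiff : ∀ d : D, (h d : Q) ∈ Φ'.source ↔ (d : P) ∈ Φ.source := by
    intro d
    constructor
    · rintro ⟨⟨h3, h4⟩, -⟩
      have hΨh := (hΨ _ h3.1).1 (h d).2
      have : a (h d) = h d := by
        refine Subtype.ext ?_
        rw [ha _ h3, faceProj_eq hΨh, Ψ.left_inv h3.1]
      rw [mem_preimage, this, h.symm_apply_apply] at h4
      exact h4
    · intro hd
      refine ⟨⟨(hface d hd).1, ?_⟩, ?_⟩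
      · rw [mem_preimage, (hface d hd).2, h.symm_apply_apply]; exact hd
      · change f (h d) ∈ V
        have e : faceProj i (Φ d) = Φ d := faceProj_eq ((hΦ _ hd).1 d.2)
        have h5 : Φ d ∈ V₁ := by
          change faceProj i (Φ d) ∈ Φ.target
          rw [e]; exact Φ.map_source hd
        rw [hfΦ d hd]
        refine ⟨h5, ?_⟩
        have e2 : c (Φ d) = d := Subtype.ext (by rw [hc _ h5, e, Φ.left_inv hd])
        have e3 : s (Φ d) = Ψ (h d) := by
          refine Subtype.ext ?_
          rw [hsval, e2, (hΦ _ hd).1 d.2, sub_self, add_zero,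
            ← (hΨ _ (hsrc d hd)).1 (h d).2, setCoord_eq]
        rw [mem_preimage, e3]
        exact Ψ.map_source (hsrc d hd)
  refine ⟨Φ', fun y hy => hy.1.1.1, hiff, hfΦ, ?_, ?_⟩
  · intro y hy
    constructor
    · intro hyA
      obtain ⟨d, hd⟩ := h.surjective ⟨y, hyA⟩
      have hyd : y = (h d : Q) := by rw [hd]
      have hds : (d : P) ∈ Φ.source := (hiff d).1 (hyd ▸ hy)
      change (f y).val i = _
      rw [hyd, hfΦ d hds]
      exact (hΦ _ hds).1 d.2
    · intro hyl
      have hyl' : (f y).val i = level i := hyl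
      rw [hfval, setCoord_self] at hyl'
      exact (hΨ y hy.1.1.1).2 (by linarith)
  · intro y hy
    have hyO : y ∈ O := hy.1
    have e1 : AffineSelection m (𝓝 y) (fun q => (Ψ q).val) (fun q => (Ψ (a q)).val) := by
      refine (AffineSelection.setCoord (AffineSelection.refl (u := fun q => (Ψ q).val))
        (.const (level j)) j).congr .rfl ?_
      filter_upwards [hO₁.mem_nhds hyO.1] with q hq
      rw [hΨa q hq, faceProj_val]
    have e2 : AffineSelection m (𝓝 y) (fun q => (Ψ (a q)).val)
        (fun q => (Φ (h.symm (a q))).val) :=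
      (hsel (a y) (has y hyO.1) hyO.2).comp_tendsto (hac.continuousAt (hO₁.mem_nhds hyO.1))
    refine ((e1.trans e2).setCoord
      ((RealSelection.const (level i)).add ((RealSelection.coord j).sub
        (.const (level j)))) i).congr .rfl (.of_forall fun q => ?_)
    exact (hfval q).symm

end Transfer

/-! ### Charts across a seam -/

section Glue

variable {m : ℕ} [NeZero m] {P Q T : Type*} [TopologicalSpace P] [TopologicalSpace Q]
  [TopologicalSpace T]

theorem nhdsWithin_range_eq {κ : P → T} (hκ : IsClosedEmbedding κ) (x : P) :
    𝓝[range κ] (κ x) = map κ (𝓝 x) :=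
  (hκ.isEmbedding.map_nhds_eq x).symm

theorem nhdsWithin_range_eq_bot {κ : P → T} (hκ : IsClosedEmbedding κ) {t : T}
    (ht : t ∉ range κ) : 𝓝[range κ] t = ⊥ := by
  rw [← hκ.isClosed_range.closure_eq] at ht
  exact not_neBot.1 fun h => ht (mem_closure_iff_nhdsWithin_neBot.2 h)

/-- Reflection in the hyperplane containing the face of a wedge. -/
noncomputable def reflectFace (i : Fin m) (x : EuclideanSpace ℝ (Fin m)) :
    EuclideanSpace ℝ (Fin m) := setCoord i x (2 * level i - x i)

theorem reflectFace_reflectFace (i : Fin m) (x : EuclideanSpace ℝ (Fin m)) :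
    reflectFace i (reflectFace i x) = x := by
  rw [reflectFace, reflectFace, setCoord_setCoord, setCoord_self, sub_sub_cancel, setCoord_eq]

theorem reflectFace_face {i : Fin m} {x : EuclideanSpace ℝ (Fin m)} (h : x i = level i) :
    reflectFace i x = x := by
  rw [reflectFace]
  nth_rw 3 [← setCoord_eq i x]
  congr 1
  rw [h]; ring

theorem continuous_reflectFace (i : Fin m) : Continuous (reflectFace i) :=
  continuous_setCoord continuous_id (by fun_prop)

/-- Two wedge charts that match along the faces glue to a chart. -/
theorem exists_glued_chart {D : Set P} {A : Set Q} (h : D ≃ₜ A) {i : Fin m}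
    {Φ : OpenPartialHomeomorph P (Wedge i)} {Φ' : OpenPartialHomeomorph Q (Wedge i)}
    (hΦ : ∀ x ∈ Φ.source, x ∈ D ↔ (Φ x).val i = level i)
    (hΦ' : ∀ x ∈ Φ'.source, x ∈ A ↔ (Φ' x).val i = level i)
    (hsrc : ∀ d : D, (h d : Q) ∈ Φ'.source ↔ (d : P) ∈ Φ.source)
    (hval : ∀ d : D, (d : P) ∈ Φ.source → Φ' (h d) = Φ d)
    (htwo : i = 0 → ∀ x ∈ Φ.source, (Φ x).val 0 ≤ 2)
    {κ : P → T} {κ' : Q → T} (hκ : IsClosedEmbedding κ) (hκ' : IsClosedEmbedding κ')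
    (hov : ∀ x y, κ x = κ' y ↔ ∃ d : D, (d : P) = x ∧ (h d : Q) = y) (p : D)
    (hp : (p : P) ∈ Φ.source) (hU : range κ ∪ range κ' ∈ 𝓝 (κ p)) :
    ∃ f : OpenPartialHomeomorph T (EuclideanHalfSpace m), κ p ∈ f.source ∧
      f.source ⊆ range κ ∪ range κ' ∧ (f (κ p)).val i = level i ∧
      (∀ t ∈ f.source, t ∈ range κ' ↔ level i ≤ (f t).val i) ∧
      (∀ x, κ x ∈ f.source → x ∈ Φ.source ∧
        AffineSelection m (𝓝 x) (fun q => (Φ q).val) (fun q => (f (κ q)).val)) ∧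
      ∀ y, κ' y ∈ f.source → y ∈ Φ'.source ∧
        AffineSelection m (𝓝 y) (fun q => (Φ' q).val) (fun q => (f (κ' q)).val) := by
  classical
  have : Nonempty P := ⟨p⟩
  have : Nonempty Q := ⟨h p⟩
  obtain ⟨g, hg, -⟩ := exists_leftInverse_continuousOn hκ.isEmbedding
  obtain ⟨g', hg', -⟩ := exists_leftInverse_continuousOn hκ'.isEmbedding
  -- The side of `P` is reflected below the face and the side of `Q` stays above; reflection fixes
  -- the face, so the formulas agree on the overlap. For `i = 0` the face has level `1`, which
  -- leaves room below it, and `htwo` keeps the reflected coordinate `2 - x 0` nonnegative.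
  let F : T → EuclideanHalfSpace m := fun t =>
    if t ∈ range κ then toHalf m (reflectFace i (Φ (g t)).val) else toHalf m (Φ' (g' t)).val
  let O : Set T := interior (range κ ∪ range κ') ∩ ((κ '' Φ.sourceᶜ)ᶜ ∩ (κ' '' Φ'.sourceᶜ)ᶜ)
  have hO : IsOpen O := isOpen_interior.inter
    ((hκ.isClosedMap _ Φ.open_source.isClosed_compl).isOpen_compl.inter
      (hκ'.isClosedMap _ Φ'.open_source.isClosed_compl).isOpen_compl)
  have hOP : ∀ x, κ x ∈ O → x ∈ Φ.source := fun x hx => by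
    by_contra hcon; exact hx.2.1 ⟨x, hcon, rfl⟩
  have hOQ : ∀ y, κ' y ∈ O → y ∈ Φ'.source := fun y hy => by
    by_contra hcon; exact hy.2.2 ⟨y, hcon, rfl⟩
  have hOcov : ∀ t ∈ O, t ∈ range κ ∨ t ∈ range κ' := fun t ht =>
    (interior_subset ht.1 : t ∈ range κ ∪ range κ')
  have hFP : ∀ x, F (κ x) = toHalf m (reflectFace i (Φ x).val) := fun x => by
    simp [F, hg]
  have hFQ : ∀ y, κ' y ∈ O → F (κ' y) = toHalf m (Φ' y).val := by
    intro y hy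
    by_cases hmem : κ' y ∈ range κ
    · obtain ⟨x, hx⟩ := hmem
      obtain ⟨d, rfl, hd⟩ := (hov x y).1 hx
      have hds : (d : P) ∈ Φ.source := hOP d (hx ▸ hy)
      rw [← hx, hFP, ← hd, hval d hds, reflectFace_face ((hΦ _ hds).1 d.2)]
    · simp only [F, if_neg hmem, hg']
  have hrange : ∀ t ∈ O, 𝓝 t = 𝓝[range κ] t ⊔ 𝓝[range κ'] t := by
    intro t ht
    rw [← nhdsWithin_union, nhdsWithin_eq_nhds.2]
    exact mem_interior_iff_mem_nhds.1 ht.1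
  have hFc : ContinuousOn F O := by
    intro t ht
    refine ContinuousAt.continuousWithinAt ?_
    rw [ContinuousAt, hrange t ht, tendsto_sup]
    constructor
    · by_cases hmem : t ∈ range κ
      · obtain ⟨x, rfl⟩ := hmem
        rw [nhdsWithin_range_eq hκ, tendsto_map'_iff]
        have : ContinuousAt (fun x => toHalf m (reflectFace i (Φ x).val)) x :=
          (continuous_toHalf.comp ((continuous_reflectFace i).comp
            continuous_subtype_val)).continuousAt.comp (Φ.continuousAt (hOP x ht))
        rw [hFP]
        exact this.tendsto.congr fun q => (hFP q).symm
      · rw [nhdsWithin_range_eq_bot hκ hmem]; exact tendsto_bot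
    · by_cases hmem : t ∈ range κ'
      · obtain ⟨y, rfl⟩ := hmem
        rw [nhdsWithin_range_eq hκ', tendsto_map'_iff]
        have : ContinuousAt (fun y => toHalf m (Φ' y).val) y :=
          (continuous_toHalf.comp continuous_subtype_val).continuousAt.comp
            (Φ'.continuousAt (hOQ y ht))
        rw [hFQ y ht]
        refine this.tendsto.congr' ?_
        filter_upwards [(hO.preimage hκ'.continuous).mem_nhds ht] with q hq
        exact (hFQ q hq).symm
      · rw [nhdsWithin_range_eq_bot hκ' hmem]; exact tendsto_bot
  let r : EuclideanHalfSpace m → Wedge i := fun z => toWedge i (reflectFace i z.val)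
  let r' : EuclideanHalfSpace m → Wedge i := fun z => toWedge i z.val
  have hr : Continuous r :=
    (continuous_toWedge i).comp ((continuous_reflectFace i).comp continuous_val)
  have hr' : Continuous r' := (continuous_toWedge i).comp continuous_val
  let V : Set (EuclideanHalfSpace m) := r ⁻¹' Φ.target ∩ r' ⁻¹' Φ'.target
  have hV : IsOpen V := (Φ.open_target.preimage hr).inter (Φ'.open_target.preimage hr')
  let s : EuclideanHalfSpace m → T := fun z =>
    if z.val i ≤ level i then κ (Φ.symm (r z)) else κ' (Φ'.symm (r' z))
  have hrr' : ∀ z : EuclideanHalfSpace m, z.val i = level i → r z = r' z := fun z hz => by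
    simp only [r, r', reflectFace_face hz]
  have hr'val : ∀ z : EuclideanHalfSpace m, level i ≤ z.val i → (r' z).val = z.val :=
    fun z hz => toWedge_val ⟨z.2, hz⟩
  have hrval : ∀ z : EuclideanHalfSpace m, z.val i ≤ level i →
      (r z).val = reflectFace i z.val :=
    fun z hz => toWedge_val (setCoord_mem_wedge z.2 (by linarith))
  have hsc : ContinuousOn s V := by
    have h1 : ContinuousOn (fun z => κ (Φ.symm (r z))) V := hκ.continuous.comp_continuousOn
      (Φ.continuousOn_symm.comp hr.continuousOn fun z hz => hz.1)
    have h2 : ContinuousOn (fun z => κ' (Φ'.symm (r' z))) V := hκ'.continuous.comp_continuousOn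
      (Φ'.continuousOn_symm.comp hr'.continuousOn fun z hz => hz.2)
    refine ContinuousOn.if ?_ (h1.mono inter_subset_left) (h2.mono inter_subset_left)
    rintro z ⟨hz, hzi⟩
    have hzi' : z.val i = level i :=
      frontier_le_subset_eq (continuous_valCoord i) continuous_const hzi
    rw [hov]
    have e0 := hΦ _ (Φ.map_target hz.1)
    rw [Φ.right_inv hz.1, hrr' z hzi', hr'val z hzi'.ge] at e0
    have hd := e0.2 hzi'
    rw [← hrr' z hzi'] at hd
    refine ⟨⟨_, hd⟩, rfl, ?_⟩
    have hds : ((⟨_, hd⟩ : D) : P) ∈ Φ.source := Φ.map_target hz.1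
    have e2 := hval _ hds
    rw [← Φ'.left_inv ((hsrc _).2 hds), e2, ← hrr' z hzi']
    congr 1
    exact Φ.right_inv hz.1
  have hrefl : ∀ x ∈ Φ.source, 0 ≤ reflectFace i (Φ x).val 0 := by
    intro x hx
    rw [reflectFace]
    by_cases hi : (0 : Fin m) = i
    · subst hi
      rw [setCoord_self]
      have := htwo rfl x hx
      simp only [level, if_true]; linarith
    · rw [setCoord_ne hi]; exact (Φ x).2.1
  have h1 : ∀ t ∈ O, F t ∈ V → s (F t) = t := by
    intro t ht hFt
    by_cases hmem : t ∈ range κ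
    · obtain ⟨x, rfl⟩ := hmem
      have hx := hOP x ht
      have e1 : (F (κ x)).val = reflectFace i (Φ x).val := by
        rw [hFP, toHalf_val (hrefl x hx)]
      have e2 : (F (κ x)).val i ≤ level i := by
        rw [e1, reflectFace, setCoord_self]; have := (Φ x).2.2; linarith
      have e3 : r (F (κ x)) = Φ x := Subtype.ext (by
        rw [hrval _ e2, e1, reflectFace_reflectFace])
      simp only [s, e2, if_true]
      rw [e3, Φ.left_inv hx]
    · obtain ⟨y, rfl⟩ := (hOcov t ht).resolve_left hmem
      have hy := hOQ y ht
      have e1 : (F (κ' y)).val = (Φ' y).val := by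
        rw [hFQ y ht, toHalf_val (Φ' y).2.1]
      have e2 : ¬ (F (κ' y)).val i ≤ level i := by
        rw [e1]
        intro hle
        have hyA : y ∈ A := (hΦ' y hy).2 (le_antisymm hle (Φ' y).2.2)
        obtain ⟨d, hd⟩ := h.surjective ⟨y, hyA⟩
        exact hmem ⟨d, (hov _ _).2 ⟨d, rfl, by rw [hd]⟩⟩
      have e3 : r' (F (κ' y)) = Φ' y := Subtype.ext (by
        rw [hr'val _ (not_le.1 e2).le, e1])
      simp only [s, e2, if_false]
      rw [e3, Φ'.left_inv hy]
  have h2 : ∀ z ∈ V, s z ∈ O → F (s z) = z := by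
    intro z hz hsz
    by_cases hzi : z.val i ≤ level i
    · simp only [s, hzi, if_true]
      rw [hFP, Φ.right_inv hz.1, hrval z hzi, reflectFace_reflectFace, val_toHalf]
    · simp only [s, hzi, if_false] at hsz ⊢
      rw [hFQ _ hsz, Φ'.right_inv hz.2, hr'val z (not_le.1 hzi).le, val_toHalf]
  have hFp : (F (κ p)).val = (Φ p).val := by
    rw [hFP, toHalf_val (hrefl _ hp), reflectFace_face ((hΦ _ hp).1 p.2)]
  have hpl : (F (κ p)).val i = level i := by rw [hFp]; exact (hΦ _ hp).1 p.2
  have hκp : κ p = κ' (h p) := (hov _ _).2 ⟨p, rfl, rfl⟩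
  have hpO : κ p ∈ O := by
    refine ⟨mem_interior_iff_mem_nhds.2 hU, ?_, ?_⟩
    · rintro ⟨x, hx, hxp⟩
      exact hx (hκ.injective hxp ▸ hp)
    · rintro ⟨y, hy, hyp⟩
      rw [hκp] at hyp
      exact hy (hκ'.injective hyp ▸ (hsrc p).2 hp)
  refine ⟨localHomeo F s hO hV hFc hsc h1 h2, ⟨hpO, ?_⟩, fun t ht => hOcov t ht.1, hpl, ?_, ?_, ?_⟩
  · have e1 : r (F (κ p)) = Φ p := Subtype.ext (by
      rw [hrval _ hpl.le, hFp, reflectFace_face ((hΦ _ hp).1 p.2)])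
    refine ⟨?_, ?_⟩
    · rw [mem_preimage, e1]; exact Φ.map_source hp
    · rw [mem_preimage, ← hrr' _ hpl, e1, ← hval p hp]
      exact Φ'.map_source ((hsrc p).2 hp)
  · rintro t ⟨ht, -⟩
    change _ ↔ _ ≤ (F t).val i
    constructor
    · rintro ⟨y, rfl⟩
      rw [hFQ y ht, toHalf_val (Φ' y).2.1]; exact (Φ' y).2.2
    · intro hle
      by_cases hmem : t ∈ range κ
      · obtain ⟨x, rfl⟩ := hmem
        have hx := hOP x ht
        rw [hFP, toHalf_val (hrefl x hx), reflectFace, setCoord_self] at hle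
        have hxD : x ∈ D := (hΦ x hx).2 (le_antisymm (by linarith) (Φ x).2.2)
        exact ⟨h ⟨x, hxD⟩, ((hov _ _).2 ⟨⟨x, hxD⟩, rfl, rfl⟩).symm⟩
      · exact (hOcov t ht).resolve_left hmem
  · rintro x ⟨hx, -⟩
    refine ⟨hOP x hx, ?_⟩
    refine (AffineSelection.setCoord (AffineSelection.refl (u := fun q => (Φ q).val))
      ((RealSelection.const (2 * level i)).sub (.coord i)) i).congr .rfl ?_
    filter_upwards [Φ.open_source.mem_nhds (hOP x hx)] with q hq
    change reflectFace i (Φ q).val = (F (κ q)).val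
    rw [hFP, toHalf_val (hrefl q hq)]
  · rintro y ⟨hy, -⟩
    refine ⟨hOQ y hy, AffineSelection.refl.congr .rfl ?_⟩
    filter_upwards [(hO.preimage hκ'.continuous).mem_nhds hy] with q hq
    change (Φ' q).val = (F (κ' q)).val
    rw [hFQ q hq, toHalf_val (Φ' q).2.1]

variable [ChartedSpace (EuclideanHalfSpace m) P] [ChartedSpace (EuclideanHalfSpace m) Q]
  [HasGroupoid P (plGroupoid m)] [HasGroupoid Q (plGroupoid m)]

/-- The chart of a space obtained by gluing two manifolds along clean submanifolds of their
boundaries, near a point of the seam. -/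
theorem exists_seam_chart {D : Set P} {A : Set Q} (hD : IsCleanInBdry m D)
    (hA : IsCleanInBdry m A) (h : D ≃ₜ A)
    (hpl : IsPL m (fun q : A => (h.symm q : P)))
    {κ : P → T} {κ' : Q → T} (hκ : IsClosedEmbedding κ) (hκ' : IsClosedEmbedding κ')
    (hov : ∀ x y, κ x = κ' y ↔ ∃ d : D, (d : P) = x ∧ (h d : Q) = y) (p : D)
    (hU : range κ ∪ range κ' ∈ 𝓝 (κ p)) :
    ∃ (f : OpenPartialHomeomorph T (EuclideanHalfSpace m)) (i : Fin m), κ p ∈ f.source ∧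
      f.source ⊆ range κ ∪ range κ' ∧ (f (κ p)).val i = level i ∧
      (∀ t ∈ f.source, t ∈ range κ' ↔ level i ≤ (f t).val i) ∧
      (∀ x, κ x ∈ f.source → AffineSelection m (𝓝 x)
        (fun q => (chartAt (EuclideanHalfSpace m) x q).val) (fun q => (f (κ q)).val)) ∧
      ∀ y, κ' y ∈ f.source → AffineSelection m (𝓝 y)
        (fun q => (chartAt (EuclideanHalfSpace m) y q).val) (fun q => (f (κ' q)).val) := by
  obtain ⟨j, Ψ, hpΨ, -, hΨw, hΨ⟩ := hA.exists_wedgeChart (h p).2 univ_mem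
  -- The chart on the side of `P` has to avoid this closed set of points of `D`, which `h` sends
  -- outside the domain of `Ψ`.
  have hK : IsClosed (Subtype.val '' {d : D | (h d : Q) ∉ Ψ.source}) := by
    refine hD.2.1.isClosedEmbedding_subtypeVal.isClosedMap _ ?_
    exact (Ψ.open_source.preimage (continuous_subtype_val.comp h.continuous)).isClosed_compl
  obtain ⟨i, Φ₀, hpΦ₀, hΦ₀s, hΦ₀w, hΦ₀⟩ := hD.exists_wedgeChart p.2
    (hK.isOpen_compl.mem_nhds (by
      rintro ⟨d, hd, hdp⟩
      exact hd (Subtype.ext hdp ▸ hpΨ)))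
  -- For `i = 0` the chart is cut down to `x 0 < 2`, so that reflection in the face `x 0 = 1` stays
  -- in the half-space.
  let W : Set P := Φ₀.source ∩ Φ₀ ⁻¹' {x | i = 0 → x.val 0 < 2}
  have hW : IsOpen W := by
    refine Φ₀.isOpen_inter_preimage ?_
    by_cases hi : i = 0
    · simpa [hi] using isOpen_lt (continuous_wedgeCoord i 0) continuous_const
    · simp [hi]
  let Φ := Φ₀.restrOpen W hW
  have hΦsub : Φ.source ⊆ Φ₀.source := fun x hx => hx.1
  have hpΦ : (p : P) ∈ Φ.source := by
    refine ⟨hpΦ₀, hpΦ₀, ?_⟩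
    rintro rfl
    have := (hΦ₀ _ hpΦ₀).1 p.2
    simp only [this, level, if_true]; norm_num
  have hΦ : ∀ x ∈ Φ.source, x ∈ D ↔ (Φ x).val i = level i := fun x hx => hΦ₀ x (hΦsub hx)
  have hsrc : ∀ d : D, (d : P) ∈ Φ.source → (h d : Q) ∈ Ψ.source := by
    intro d hd
    by_contra hcon
    exact hΦ₀s (hΦsub hd) ⟨d, hcon, rfl⟩
  have hsel : ∀ a : A, (a : Q) ∈ Ψ.source → (h.symm a : P) ∈ Φ.source →
      AffineSelection m (𝓝 a) (fun q : A => (Ψ q).val) (fun q : A => (Φ (h.symm q)).val) := by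
    intro a ha ha'
    have h1 := (hΨw a ha).2.comp_tendsto (continuous_subtype_val (p := (· ∈ A))).continuousAt
    have h2 := hpl.2 a
    have h3 := (hΦ₀w _ (hΦsub ha')).1.comp_tendsto
      (continuous_subtype_val.comp h.symm.continuous).continuousAt
    exact (h1.trans h2).trans h3
  obtain ⟨Φ', hs', hsrc', hval', hΦ', hsel'⟩ := exists_matching_chart h hΦ hΨ hsrc p hsel
  obtain ⟨f, h1, h2, h3, h4, h5, h6⟩ := exists_glued_chart h hΦ hΦ' hsrc' hval'
    (fun hi x hx => (hx.2.2 hi).le) hκ hκ' hov p hpΦ hU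
  refine ⟨f, i, h1, h2, h3, h4, fun x hx => ?_, fun y hy => ?_⟩
  · exact (hΦ₀w x (hΦsub (h5 x hx).1)).1.trans (h5 x hx).2
  · have hy' := (h6 y hy).1
    exact ((hΨw y (hs' hy')).1.trans (hsel' y hy')).trans (h6 y hy).2

end Glue

/-! ### Disjoint unions of cobordisms -/

section DisjUnionFacts

variable {k m : ℕ} [NeZero m] (c : Fin k → RelCobordism.{u} m)

/-- The inclusion of a summand. -/
abbrev summand (j : Fin k) (x : (c j).W) : DisjUnion c := ⟨j, x⟩

theorem isOpenEmbedding_summand (j : Fin k) : IsOpenEmbedding (summand c j) :=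
  IsOpenEmbedding.sigmaMk (σ := fun j => (c j).W) (i := j)

/-- The chart of a disjoint union that is induced by a chart of a summand. -/
noncomputable def liftChart {j : Fin k} (φ : OpenPartialHomeomorph (c j).W (EuclideanHalfSpace m)) :
    OpenPartialHomeomorph (DisjUnion c) (EuclideanHalfSpace m) :=
  φ.lift_openEmbedding (isOpenEmbedding_summand c j)

theorem liftChart_summand {j : Fin k}
    (φ : OpenPartialHomeomorph (c j).W (EuclideanHalfSpace m)) (x : (c j).W) :
    liftChart c φ (summand c j x) = φ x :=
  φ.lift_openEmbedding_apply (isOpenEmbedding_summand c j)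

theorem chartAt_summand (j : Fin k) (x y : (c j).W) :
    chartAt (EuclideanHalfSpace m) (summand c j x) (summand c j y) =
      chartAt (EuclideanHalfSpace m) x y :=
  liftChart_summand c _ y

theorem nhds_summand (j : Fin k) (x : (c j).W) : 𝓝 (summand c j x) = map (summand c j) (𝓝 x) :=
  ((isOpenEmbedding_summand c j).map_nhds_eq x).symm

theorem summand_mem_bdry {j : Fin k} {x : (c j).W} :
    summand c j x ∈ bdry m (DisjUnion c) ↔ x ∈ bdry m (c j).W := by
  rw [mem_bdry_iff_chartAt, mem_bdry_iff_chartAt, chartAt_summand]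

theorem lift_mem_plCharts {j : Fin k} {φ : OpenPartialHomeomorph (c j).W (EuclideanHalfSpace m)}
    (hφ : φ ∈ plCharts m (c j).W) :
    liftChart c φ ∈ plCharts m (DisjUnion c) := by
  refine mem_plCharts fun p hp => ⟨chartAt _ p, chartAt_mem_plCharts p, mem_chart_source _ p, ?_⟩
  obtain ⟨x, hx, rfl⟩ := hp
  rw [nhds_summand, affineSelection_map_iff]
  refine (affineSelection_of_mem (chartAt_mem_plCharts x) hφ (mem_chart_source _ x) hx).congr
    (.of_forall fun q => ?_) (.of_forall fun q => ?_)
  · exact congrArg Subtype.val (chartAt_summand c j x q).symm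
  · exact congrArg Subtype.val (liftChart_summand c φ q).symm

theorem summand_mem_edge {S : Set (DisjUnion c)} {j : Fin k} {x : (c j).W}
    (h : summand c j x ∈ edge m S) : x ∈ edge m (summand c j ⁻¹' S) := by
  refine ⟨h.1, ?_⟩
  have h1 : x ∈ summand c j ⁻¹' closure (bdry m (DisjUnion c) \ S) := h.2
  rw [(isOpenEmbedding_summand c j).isOpenMap.preimage_closure_eq_closure_preimage
    (isOpenEmbedding_summand c j).continuous] at h1
  refine closure_mono ?_ h1
  rintro y ⟨hy, hy'⟩
  exact ⟨(summand_mem_bdry c).1 hy, hy'⟩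

/-- A disjoint union of clean submanifolds of the boundaries is clean. -/
theorem isCleanInBdry_sigma {S : Set (DisjUnion c)}
    (hS : ∀ j, IsCleanInBdry m (summand c j ⁻¹' S)) : IsCleanInBdry m S := by
  refine ⟨?_, isClosed_sigma_iff.2 fun j => (hS j).2.1, ?_⟩
  · rintro ⟨j, x⟩ hx
    exact (summand_mem_bdry c).2 ((hS j).1 hx)
  · rintro ⟨j, x⟩ ⟨hx, hx'⟩
    obtain ⟨φ, hφ, hxφ, i, hi⟩ := (hS j).2.2 x (summand_mem_edge c ⟨hx, hx'⟩)
    refine ⟨_, lift_mem_plCharts c hφ, ⟨x, hxφ, rfl⟩, i, ?_⟩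
    rintro _ ⟨⟨y, hy, rfl⟩, hyb⟩
    change summand c j y ∈ S ↔ (liftChart c φ (summand c j x)).val i ≤
      (liftChart c φ (summand c j y)).val i
    rw [liftChart_summand, liftChart_summand]
    exact hi y ⟨hy, (summand_mem_bdry c).1 hyb⟩

theorem isCleanInBdry_unionA : IsCleanInBdry m (unionA c) :=
  isCleanInBdry_sigma c fun j => (c j).cleanA

theorem disjoint_unionA_unionB : Disjoint (unionA c) (unionB c) := by
  rw [Set.disjoint_left]
  rintro ⟨j, x⟩ hx hx'
  exact Set.disjoint_left.1 (c j).disj hx hx'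

/-- If each `A j` is homotopy equivalent to `W j` then the disjoint union of the `W j` retracts to
the disjoint union of the `A j`. -/
theorem isSDR_unionA (h : ∀ j, InclIsHEquiv (c j).A univ) : IsSDR (unionA c) univ := by
  have h1 : ∀ j, IsSDR (c j).A univ := fun j =>
    ((c j).cleanA.isNDR (c j).cleanA.2.1.isCompact).isSDR (h j)
  choose H hH using h1
  have hc : ∀ j, Continuous (H j) := fun j => by
    have := (hH j).cont
    rwa [univ_prod_univ, continuousOn_univ] at this
  refine ⟨fun p => ⟨p.1.1, H p.1.1 (p.1.2, p.2)⟩, subset_univ _, ?_, fun _ _ _ => mem_univ _,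
    ?_, ?_, ?_, ?_⟩
  · have : Continuous (Sigma.map (β₂ := fun j => (c j).W) id H) :=
      Continuous.sigma_map hc
    exact (this.comp (Homeomorph.sigmaProdDistrib (Y := ℝ)
      (X := fun j => (c j).W)).continuous).continuousOn
  · rintro ⟨j, x⟩ - t ht
    exact congrArg (Sigma.mk j) ((hH j).zero x (mem_univ _) t ht)
  · rintro ⟨j, x⟩ - t ht
    exact congrArg (Sigma.mk j) ((hH j).one x (mem_univ _) t ht)
  · rintro ⟨j, x⟩ -
    exact (hH j).mem x (mem_univ _)
  · rintro ⟨j, x⟩ hx t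
    exact congrArg (Sigma.mk j) ((hH j).fixed x hx t)

end DisjUnionFacts

/-- The only obstruction to lowering a coordinate is the wall `x 0 = 0`. This shows that the points
with `x i = c` in a local model are limits of points outside the submanifold. -/
theorem exists_lt_coord {m : ℕ} [NeZero m] {V : Set (EuclideanHalfSpace m)} (hV : IsOpen V)
    {z : EuclideanHalfSpace m} (hz : z ∈ V) {i : Fin m} (hi : i = 0 → 0 < z.val 0) :
    ∃ z' ∈ V, z'.val i < z.val i := by
  have hc : Continuous fun t : ℝ => toHalf m (setCoord i z.val (z.val i - t)) :=
    continuous_toHalf.comp (continuous_setCoord continuous_const (by fun_prop))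
  obtain ⟨δ, hδ, hsub⟩ := Metric.isOpen_iff.1 (hV.preimage hc) 0 (by
    rw [mem_preimage, sub_zero, setCoord_eq, val_toHalf]; exact hz)
  obtain ⟨s, hs0, hsδ, hs⟩ : ∃ s > 0, s < δ ∧ 0 ≤ setCoord i z.val (z.val i - s) 0 := by
    by_cases h : i = 0
    · subst h
      refine ⟨min (δ / 2) (z.val 0), lt_min (half_pos hδ) (hi rfl),
        (min_le_left _ _).trans_lt (half_lt_self hδ), ?_⟩
      rw [setCoord_self, sub_nonneg]; exact min_le_right _ _
    · refine ⟨δ / 2, half_pos hδ, half_lt_self hδ, ?_⟩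
      rw [setCoord_ne (Ne.symm h)]; exact z.2
  refine ⟨_, hsub (show s ∈ Metric.ball (0 : ℝ) δ by simp [abs_of_pos hs0, hsδ]), ?_⟩
  rw [toHalf_val hs, setCoord_self]; linarith

/-! ### Chains of pieces, and their tails -/

section Chains

variable {m : ℕ} [NeZero m] {P : ℕ → Type u} [∀ i, TopologicalSpace (P i)]
  [∀ i, ChartedSpace (EuclideanHalfSpace m) (P i)] [∀ i, HasGroupoid (P i) (plGroupoid m)]
  {A D : ∀ i, Set (P i)} {h : ∀ i, D i ≃ₜ A (i + 1)}
  {T : Type*} [TopologicalSpace T] {κ : ∀ i, P i → T}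

/-- The maps `κ i` identify the consecutive gluing of the `P i` along the `h i` with a closed
subset of `T`. -/
structure IsChain (h : ∀ i, D i ≃ₜ A (i + 1)) (κ : ∀ i, P i → T) : Prop where
  emb : ∀ i, IsClosedEmbedding (κ i)
  lf : LocallyFinite fun i => range (κ i)
  overlap : ∀ i x y, κ i x = κ (i + 1) y ↔ ∃ d : D i, (d : P i) = x ∧ (h i d : P (i + 1)) = y
  far : ∀ i j, i + 1 < j → Disjoint (range (κ i)) (range (κ j))

/-- The union of the pieces from the `n`-th on. -/
def tail (κ : ∀ i, P i → T) (n : ℕ) : Set T := ⋃ k, range (κ (n + k))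

theorem mem_tail {n : ℕ} {t : T} : t ∈ tail κ n ↔ ∃ k ≥ n, t ∈ range (κ k) := by
  rw [tail, mem_iUnion]
  exact ⟨fun ⟨k, hk⟩ => ⟨n + k, by omega, hk⟩, fun ⟨k, hk, ht⟩ =>
    ⟨k - n, by rwa [Nat.add_sub_cancel' hk]⟩⟩

namespace IsChain

variable (hκ : IsChain h κ)
include hκ

/-- Consecutive pieces meet only in points identified by `h`, and other pieces do not meet. -/
theorem inter_subset {j k : ℕ} (hjk : j < k) :
    range (κ j) ∩ range (κ k) ⊆ κ k '' A k := by
  rintro t ⟨⟨x, rfl⟩, y, hy⟩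
  rcases (Nat.succ_le_of_lt hjk).eq_or_lt with rfl | hlt
  · obtain ⟨d, -, hd⟩ := (hκ.overlap j x y).1 hy.symm
    exact ⟨y, hd ▸ (h j d).2, hy⟩
  · exact absurd ⟨y, hy⟩ (Set.disjoint_left.1 (hκ.far j k hlt) (mem_range_self x))

theorem image_subset (k : ℕ) : κ (k + 1) '' A (k + 1) ⊆ range (κ k) := by
  rintro _ ⟨a, ha, rfl⟩
  obtain ⟨d, hd⟩ := (h k).surjective ⟨a, ha⟩
  exact ⟨d, (hκ.overlap k _ _).2 ⟨d, rfl, by rw [hd]⟩⟩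

theorem lf_shift (n : ℕ) : LocallyFinite fun k => range (κ (n + k)) :=
  hκ.lf.comp_injective (add_right_injective n)

theorem isClosed_tail (n : ℕ) : IsClosed (tail κ n) :=
  (hκ.lf_shift n).isClosed_iUnion fun k => (hκ.emb (n + k)).isClosed_range

theorem isSDR_tail (hA : ∀ i, IsSDR (A i) univ) (n : ℕ) : IsSDR (κ n '' A n) (tail κ n) :=
  isSDR_iUnion (Z := fun k => range (κ (n + k))) (A := fun k => κ (n + k) '' A (n + k))
    (fun k => (hκ.emb _).isClosed_range) (hκ.lf_shift n)
    (fun k => by simpa only [image_univ] using (hA (n + k)).image (hκ.emb (n + k)).isEmbedding)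
    (fun k => hκ.image_subset (n + k)) fun j k hjk => hκ.inter_subset (by omega)

/-- Every index other than `k` and `k + 1` is at distance at least two from one of them, so no other
piece contains a point of this seam; by local finiteness the others keep away from a neighborhood.
-/
theorem nhds_seam {k : ℕ} {t : T} (ht : t ∈ κ (k + 1) '' A (k + 1))
    (hint : t ∈ interior (tail κ 0)) : range (κ k) ∪ range (κ (k + 1)) ∈ 𝓝 t := by
  have hc : IsClosed (⋃ j : {j // j ≠ k ∧ j ≠ k + 1}, range (κ j)) :=
    (hκ.lf.comp_injective Subtype.val_injective).isClosed_iUnion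
      fun j => (hκ.emb j).isClosed_range
  have ht1 : t ∈ range (κ (k + 1)) := image_subset_range _ _ ht
  have ht0 : t ∈ range (κ k) := hκ.image_subset k ht
  have hnot : t ∉ ⋃ j : {j // j ≠ k ∧ j ≠ k + 1}, range (κ j) := by
    rw [mem_iUnion]
    rintro ⟨⟨j, hj1, hj2⟩, htj⟩
    rcases lt_or_gt_of_ne hj1 with hlt | hlt
    · exact Set.disjoint_left.1 (hκ.far j (k + 1) (by omega)) htj ht1
    · exact Set.disjoint_left.1 (hκ.far k j (by omega)) ht0 htj
  filter_upwards [hc.isOpen_compl.mem_nhds hnot, mem_interior_iff_mem_nhds.1 hint] with s hs hs'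
  obtain ⟨j, -, hj⟩ := mem_tail.1 hs'
  by_contra hcon
  refine hs (mem_iUnion.2 ⟨⟨j, ?_, ?_⟩, hj⟩)
  · rintro rfl; exact hcon (.inl hj)
  · rintro rfl; exact hcon (.inr hj)

/-- The seam chart is restricted to the complement of all other pieces. There the tail from `k + 1`
on is just piece `k + 1`, the upper side of the chart. -/
theorem exists_chart (hA : ∀ i, IsCleanInBdry m (A i)) (hD : ∀ i, IsCleanInBdry m (D i))
    (hpl : ∀ i, IsPL m (fun q : A (i + 1) => ((h i).symm q : P i)))
    {k : ℕ} {t : T} (ht : t ∈ κ (k + 1) '' A (k + 1)) (hint : t ∈ interior (tail κ 0)) :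
    ∃ (f : OpenPartialHomeomorph T (EuclideanHalfSpace m)) (i : Fin m), t ∈ f.source ∧
      f.source ⊆ range (κ k) ∪ range (κ (k + 1)) ∧ (f t).val i = level i ∧
      (∀ s ∈ f.source, s ∈ tail κ (k + 1) ↔ (f t).val i ≤ (f s).val i) ∧
      ∀ j x, κ j x ∈ f.source → AffineSelection m (𝓝 x)
        (fun q => (chartAt (EuclideanHalfSpace m) x q).val) (fun q => (f (κ j q)).val) := by
  have hU := hκ.nhds_seam ht hint
  obtain ⟨a, ha, rfl⟩ := ht
  obtain ⟨p, hp⟩ := (h k).surjective ⟨a, ha⟩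
  have e : κ k p = κ (k + 1) a := (hκ.overlap k _ _).2 ⟨p, rfl, by rw [hp]⟩
  rw [← e] at hU
  obtain ⟨f, i, h1, h2, h3, h4, h5, h6⟩ := exists_seam_chart (hD k) (hA (k + 1)) (h k) (hpl k)
    (hκ.emb k) (hκ.emb (k + 1)) (hκ.overlap k) p hU
  let O := ⋃ j : {j // j ≠ k ∧ j ≠ k + 1}, range (κ j)
  have hO : IsClosed O := (hκ.lf.comp_injective Subtype.val_injective).isClosed_iUnion
      fun j => (hκ.emb j).isClosed_range
  have hnot : ∀ s ∈ range (κ k) ∩ range (κ (k + 1)), s ∉ O := by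
    intro t ⟨ht0, ht1⟩
    rw [mem_iUnion]
    rintro ⟨⟨j, hj1, hj2⟩, htj⟩
    rcases lt_or_gt_of_ne hj1 with hlt | hlt
    · exact Set.disjoint_left.1 (hκ.far j (k + 1) (by omega)) htj ht1
    · exact Set.disjoint_left.1 (hκ.far k j (by omega)) ht0 htj
  refine ⟨f.restrOpen Oᶜ hO.isOpen_compl, i, ⟨e ▸ h1, hnot _ ⟨⟨p, e⟩, mem_range_self a⟩⟩,
    fun s hs => h2 hs.1, ?_, ?_, ?_⟩
  · change (f _).val i = _
    rw [← e]; exact h3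
  · intro s hs
    change _ ↔ (f (κ (k + 1) a)).val i ≤ (f s).val i
    rw [← e, h3, ← h4 s hs.1, mem_tail]
    constructor
    · rintro ⟨j, hj, hsj⟩
      by_cases hjk : j = k + 1
      · subst hjk; exact hsj
      · exact absurd (mem_iUnion.2 ⟨⟨j, by omega, hjk⟩, hsj⟩) hs.2
    · exact fun hs => ⟨k + 1, le_rfl, hs⟩
  · intro j x hx
    by_cases hjk : j = k
    · subst hjk; exact h5 x hx.1
    by_cases hjk' : j = k + 1
    · subst hjk'; exact h6 x hx.1
    · exact (hx.2 (mem_iUnion.2 ⟨⟨j, hjk, hjk'⟩, mem_range_self x⟩)).elim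

/-- A point of the tail off the seam avoids the finitely many earlier pieces, hence is interior. At
a point of the seam the chart contains nearby points below the face, and these are outside the tail.
-/
theorem frontier_tail (hA : ∀ i, IsCleanInBdry m (A i)) (hD : ∀ i, IsCleanInBdry m (D i))
    (hpl : ∀ i, IsPL m (fun q : A (i + 1) => ((h i).symm q : P i)))
    (hint : tail κ 1 ⊆ interior (tail κ 0)) (k : ℕ) :
    frontier (tail κ (k + 1)) = κ (k + 1) '' A (k + 1) := by
  have hmono : tail κ (k + 1) ⊆ tail κ 1 := fun t ht => by
    rw [mem_tail] at ht ⊢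
    obtain ⟨j, hj, h⟩ := ht
    exact ⟨j, by omega, h⟩
  rw [(hκ.isClosed_tail _).frontier_eq]
  refine Subset.antisymm ?_ ?_
  · rintro t ⟨ht, ht'⟩
    by_contra hcon
    refine ht' (mem_interior_iff_mem_nhds.2 ?_)
    have hc : IsClosed (⋃ j ∈ Iic k, range (κ j)) :=
      (finite_Iic k).isClosed_biUnion fun j _ => (hκ.emb j).isClosed_range
    have hnot : t ∉ ⋃ j ∈ Iic k, range (κ j) := by
      rw [mem_iUnion₂]
      rintro ⟨j, hj, htj⟩
      obtain ⟨l, hl, htl⟩ := mem_tail.1 ht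
      have hjk : j ≤ k := hj
      by_cases hjl : j + 1 < l
      · exact Set.disjoint_left.1 (hκ.far j l hjl) htj htl
      · have e1 : j = k := by omega
        have e2 : l = k + 1 := by omega
        subst e1 e2
        exact hcon (hκ.inter_subset (Nat.lt_succ_self j) ⟨htj, htl⟩)
    filter_upwards [hc.isOpen_compl.mem_nhds hnot,
      mem_interior_iff_mem_nhds.1 (hint (hmono ht))] with s hs hs'
    obtain ⟨j, -, hj⟩ := mem_tail.1 hs'
    refine mem_tail.2 ⟨j, ?_, hj⟩
    by_contra hlt
    exact hs (mem_iUnion₂.2 ⟨j, by simp only [mem_Iic]; omega, hj⟩)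
  · intro t ht
    have htt : t ∈ tail κ (k + 1) := mem_tail.2 ⟨_, le_rfl, image_subset_range _ _ ht⟩
    refine ⟨htt, fun hti => ?_⟩
    obtain ⟨f, i, h1, -, h3, h4, -⟩ := hκ.exists_chart hA hD hpl ht (hint (hmono htt))
    have hV : IsOpen (f '' (f.source ∩ interior (tail κ (k + 1)))) :=
      f.isOpen_image_of_subset_source (f.open_source.inter isOpen_interior) inter_subset_left
    obtain ⟨_, ⟨s, hs, rfl⟩, hlt⟩ := exists_lt_coord hV (mem_image_of_mem f ⟨h1, hti⟩) (i := i) (by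
      rintro rfl
      rw [h3]; simp [level])
    exact absurd ((h4 s hs.1).1 (interior_subset hs.2)) (not_le.2 hlt)

/-- Local finiteness makes the neighborhood filter a finite supremum over pieces, so finitely many
affine maps suffice once they do on each piece. -/
theorem nhds_eq_iSup {t : T} (hint : t ∈ interior (tail κ 0)) :
    ∃ s : Set ℕ, s.Finite ∧ 𝓝 t = ⨆ k : s, 𝓝[range (κ k)] t := by
  obtain ⟨U, hU, hs⟩ := hκ.lf t
  refine ⟨_, hs, ?_⟩
  have : (⋃ k ∈ {i | (range (κ i) ∩ U).Nonempty}, range (κ k)) ∈ 𝓝 t := by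
    filter_upwards [hU, mem_interior_iff_mem_nhds.1 hint] with x hx hx'
    obtain ⟨j, -, hj⟩ := mem_tail.1 hx'
    exact mem_biUnion (x := j) ⟨x, hj, hx⟩ hj
  rw [← nhdsWithin_eq_nhds.2 this, nhdsWithin_biUnion hs, iSup_subtype']

/-- Selections can be tested on the pieces. -/
theorem affineSelection {t : T} (hint : t ∈ interior (tail κ 0))
    {u v : T → EuclideanSpace ℝ (Fin m)}
    (H : ∀ j x, κ j x = t →
      AffineSelection m (𝓝 x) (fun q => u (κ j q)) (fun q => v (κ j q))) :
    AffineSelection m (𝓝 t) u v := by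
  obtain ⟨s, hs, e⟩ := hκ.nhds_eq_iSup hint
  have := hs.to_subtype
  rw [e]
  refine AffineSelection.iSup fun k => ?_
  by_cases hk : t ∈ range (κ k)
  · obtain ⟨x, rfl⟩ := hk
    rw [nhdsWithin_range_eq (hκ.emb k), affineSelection_map_iff]
    exact H k x rfl
  · rw [nhdsWithin_range_eq_bot (hκ.emb k) hk]
    exact ⟨∅, Set.finite_empty, eventually_bot⟩

/-- If a chain in a manifold is piecewise linear on each piece, then the maps that are piecewise
linear charts on each piece are charts. -/
theorem mem_plCharts [ChartedSpace (EuclideanHalfSpace m) T] [HasGroupoid T (plGroupoid m)]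
    (hκpl : ∀ j x, AffineSelection m (𝓝 x)
        (fun q => (chartAt (EuclideanHalfSpace m) x q).val)
        (fun q => (chartAt (EuclideanHalfSpace m) (κ j x) (κ j q)).val))
    {f : OpenPartialHomeomorph T (EuclideanHalfSpace m)}
    (hint : f.source ⊆ interior (tail κ 0))
    (hf : ∀ j x, κ j x ∈ f.source → AffineSelection m (𝓝 x)
        (fun q => (chartAt (EuclideanHalfSpace m) x q).val) (fun q => (f (κ j q)).val)) :
    f ∈ plCharts m T := by
  refine PLTop.mem_plCharts fun t ht =>
    ⟨chartAt _ t, chartAt_mem_plCharts t, mem_chart_source _ t, ?_⟩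
  refine hκ.affineSelection (hint ht) ?_
  rintro j x rfl
  have ho : IsOpen (κ j ⁻¹' (chartAt (EuclideanHalfSpace m) (κ j x)).source) :=
    (chartAt (EuclideanHalfSpace m) (κ j x)).open_source.preimage (hκ.emb j).continuous
  -- The chart of `T` restricted to the piece is injective and PL, so it can be inverted; PL
  -- embeddings need to be PL in one direction only.
  refine AffineSelection.trans ?_ (hf j x ht)
  refine AffineSelection.symm (ho.mem_nhds (mem_chart_source _ (κ j x))) (mem_chart_source _ x)
    ?_ ?_ (hκpl j x)
  · exact (chart_val_continuousOn (chartAt (EuclideanHalfSpace m) (κ j x))).comp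
      (hκ.emb j).continuous.continuousOn fun _ h => h
  · intro a ha b hb hab
    exact (hκ.emb j).injective (chart_val_injOn _ ha hb hab)

theorem isClean_tail [ChartedSpace (EuclideanHalfSpace m) T] [HasGroupoid T (plGroupoid m)]
    (hA : ∀ i, IsCleanInBdry m (A i)) (hD : ∀ i, IsCleanInBdry m (D i))
    (hpl : ∀ i, IsPL m (fun q : A (i + 1) => ((h i).symm q : P i)))
    (hκpl : ∀ j x, AffineSelection m (𝓝 x)
        (fun q => (chartAt (EuclideanHalfSpace m) x q).val)
        (fun q => (chartAt (EuclideanHalfSpace m) (κ j x) (κ j q)).val))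
    (hint : tail κ 1 ⊆ interior (tail κ 0)) (k : ℕ) : IsClean m (tail κ (k + 1)) := by
  refine ⟨hκ.isClosed_tail _, fun t ht => ?_⟩
  rw [hκ.frontier_tail hA hD hpl hint] at ht
  have htt : t ∈ tail κ 1 := mem_tail.2 ⟨k + 1, by omega, image_subset_range _ _ ht⟩
  obtain ⟨f, i, h1, h2, h3, h4, h5⟩ := hκ.exists_chart hA hD hpl ht (hint htt)
  have hri : f.restrOpen _ isOpen_interior ∈ plCharts m T :=
    hκ.mem_plCharts hκpl (f := f.restrOpen _ (isOpen_interior (s := tail κ 0)))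
      (fun s hs => hs.2) fun j x hx => h5 j x hx.1
  exact ⟨_, hri, ⟨h1, hint htt⟩, i, fun s hs => h4 s hs.1⟩

end IsChain

end Chains

/-! ### The quotient space of a gluing -/

section Gluing

variable {P : ℕ → Type u} [∀ i, TopologicalSpace (P i)] {A D : ∀ i, Set (P i)}
  {h : ∀ i, D i ≃ₜ A (i + 1)} {r : (Σ i, P i) → (Σ i, P i) → Prop}

/-- The relation `r` identifies each `d` in `D i` with `h i d`, and `D i` is disjoint from
`A i`. -/
structure IsGluing (h : ∀ i, D i ≃ₜ A (i + 1)) (r : (Σ i, P i) → (Σ i, P i) → Prop) : Prop where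
  rel : ∀ x y, r x y ↔ ∃ i, ∃ d : D i, x = ⟨i, d⟩ ∧ y = ⟨i + 1, h i d⟩
  disj : ∀ i, Disjoint (A i) (D i)
  closedA : ∀ i, IsClosed (A i)
  closedD : ∀ i, IsClosed (D i)

/-- The map of a piece to the gluing. -/
def glueMap (r : (Σ i, P i) → (Σ i, P i) → Prop) (i : ℕ) (x : P i) : Quot r := Quot.mk r ⟨i, x⟩

namespace IsGluing

variable (hr : IsGluing h r)
include hr

theorem rel_right_unique {x y z} (h1 : r x y) (h2 : r x z) : y = z := by
  obtain ⟨i, d, rfl, rfl⟩ := (hr.rel _ _).1 h1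
  obtain ⟨j, d', e, rfl⟩ := (hr.rel _ _).1 h2
  obtain ⟨rfl, e⟩ := Sigma.mk.inj_iff.1 e
  obtain rfl := Subtype.ext (eq_of_heq e)
  rfl

theorem rel_left_unique {x y z} (h1 : r x z) (h2 : r y z) : x = y := by
  obtain ⟨i, d, rfl, rfl⟩ := (hr.rel _ _).1 h1
  obtain ⟨j, d', rfl, e⟩ := (hr.rel _ _).1 h2
  obtain ⟨e1, e⟩ := Sigma.mk.inj_iff.1 e
  obtain rfl : i = j := Nat.succ_injective e1
  obtain rfl := (h i).injective (Subtype.ext (eq_of_heq e))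
  rfl

theorem not_rel_rel {x y z} (h1 : r x y) (h2 : r y z) : False := by
  obtain ⟨i, d, rfl, rfl⟩ := (hr.rel _ _).1 h1
  obtain ⟨j, d', e, rfl⟩ := (hr.rel _ _).1 h2
  obtain ⟨rfl, e⟩ := Sigma.mk.inj_iff.1 e
  refine Set.disjoint_left.1 (hr.disj (i + 1)) (h i d).2 ?_
  rw [eq_of_heq e]; exact d'.2

/-- Since `A i` and `D i` are disjoint, two identifications never follow each other, so a class has
at most two points. -/
theorem mk_eq_iff {x y : Σ i, P i} : Quot.mk r x = Quot.mk r y ↔ x = y ∨ r x y ∨ r y x := by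
  constructor
  · intro e
    have h1 := Quot.eqvGen_exact e
    clear e
    induction h1 with
    | rel x y hxy => exact .inr (.inl hxy)
    | refl x => exact .inl rfl
    | symm x y _ ih =>
      rcases ih with rfl | ih | ih
      exacts [.inl rfl, .inr (.inr ih), .inr (.inl ih)]
    | trans x y z _ _ ih1 ih2 =>
      rcases ih1 with rfl | ih1 | ih1
      · exact ih2
      · rcases ih2 with rfl | ih2 | ih2
        · exact .inr (.inl ih1)
        · exact (hr.not_rel_rel ih1 ih2).elim
        · exact .inl (hr.rel_left_unique ih1 ih2)
      · rcases ih2 with rfl | ih2 | ih2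
        · exact .inr (.inr ih1)
        · exact .inl (hr.rel_right_unique ih1 ih2)
        · exact (hr.not_rel_rel ih2 ih1).elim
  · rintro (rfl | e | e)
    exacts [rfl, Quot.sound e, (Quot.sound e).symm]

/-- The saturation of a closed set meets each piece in the set itself, the preimage under the
outgoing `h` and the image under the incoming one; all three are closed because `A i` and `D i` are.
The topology of the quotient is controlled by this fact. -/
theorem isClosedMap_mk : IsClosedMap (Quot.mk r) := by
  intro C hC
  have hC' : ∀ i, IsClosed (Sigma.mk i ⁻¹' C) := isClosed_sigma_iff.1 hC
  rw [← isQuotientMap_quot_mk.isClosed_preimage, isClosed_sigma_iff]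
  have h1 : ∀ i, IsClosed (Subtype.val '' {d : D i | (h i d : P (i + 1)) ∈ Sigma.mk (i + 1) ⁻¹' C}) :=
    fun i => (hr.closedD i).isClosedEmbedding_subtypeVal.isClosedMap _
      ((hC' (i + 1)).preimage (continuous_subtype_val.comp (h i).continuous))
  have h2 : ∀ i, IsClosed ((fun d : D i => (h i d : P (i + 1))) ''
      {d : D i | (d : P i) ∈ Sigma.mk i ⁻¹' C}) := fun i =>
    ((hr.closedA (i + 1)).isClosedEmbedding_subtypeVal.comp (h i).isClosedEmbedding).isClosedMap _
      ((hC' i).preimage continuous_subtype_val)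
  have key : ∀ i x, (x ∈ Sigma.mk i ⁻¹' (Quot.mk r ⁻¹' (Quot.mk r '' C))) ↔
      (⟨i, x⟩ ∈ C ∨ (∃ y ∈ C, r ⟨i, x⟩ y)) ∨ ∃ y ∈ C, r y ⟨i, x⟩ := by
    intro i x
    constructor
    · rintro ⟨y, hy, e⟩
      rcases hr.mk_eq_iff.1 e with rfl | e | e
      exacts [.inl (.inl hy), .inr ⟨y, hy, e⟩, .inl (.inr ⟨y, hy, e⟩)]
    · rintro ((hx | ⟨y, hy, e⟩) | ⟨y, hy, e⟩)
      exacts [⟨_, hx, rfl⟩, ⟨y, hy, (Quot.sound e).symm⟩, ⟨y, hy, Quot.sound e⟩]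
  have key1 : ∀ i x, (∃ y ∈ C, r ⟨i, x⟩ y) ↔
      x ∈ Subtype.val '' {d : D i | (h i d : P (i + 1)) ∈ Sigma.mk (i + 1) ⁻¹' C} := by
    intro i x
    constructor
    · rintro ⟨y, hy, e'⟩
      obtain ⟨j, d, e, rfl⟩ := (hr.rel _ _).1 e'
      obtain ⟨rfl, e⟩ := Sigma.mk.inj_iff.1 e
      exact ⟨d, hy, (eq_of_heq e).symm⟩
    · rintro ⟨d, hd, rfl⟩
      exact ⟨_, hd, (hr.rel _ _).2 ⟨i, d, rfl, rfl⟩⟩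
  rintro (_ | i)
  · have : Sigma.mk 0 ⁻¹' (Quot.mk r ⁻¹' (Quot.mk r '' C)) = Sigma.mk 0 ⁻¹' C ∪
        Subtype.val '' {d : D 0 | (h 0 d : P 1) ∈ Sigma.mk 1 ⁻¹' C} := by
      ext x
      rw [key, key1, or_iff_left]
      · rfl
      · rintro ⟨y, -, e⟩
        obtain ⟨j, d, -, e⟩ := (hr.rel _ _).1 e
        exact absurd (Sigma.mk.inj_iff.1 e).1 (Nat.succ_ne_zero j).symm
    rw [this]
    exact (hC' 0).union (h1 0)
  · have : Sigma.mk (i + 1) ⁻¹' (Quot.mk r ⁻¹' (Quot.mk r '' C)) = (Sigma.mk (i + 1) ⁻¹' C ∪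
        Subtype.val '' {d : D (i + 1) | (h (i + 1) d : P (i + 1 + 1)) ∈ Sigma.mk (i + 1 + 1) ⁻¹' C})
        ∪ (fun d : D i => (h i d : P (i + 1))) '' {d : D i | (d : P i) ∈ Sigma.mk i ⁻¹' C} := by
      ext x
      rw [key, key1]
      refine or_congr Iff.rfl ⟨?_, ?_⟩
      · rintro ⟨y, hy, e'⟩
        obtain ⟨j, d, rfl, e⟩ := (hr.rel _ _).1 e'
        obtain ⟨e1, e⟩ := Sigma.mk.inj_iff.1 e
        obtain rfl : i = j := Nat.succ_injective e1
        exact ⟨d, hy, (eq_of_heq e).symm⟩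
      · rintro ⟨d, hd, rfl⟩
        exact ⟨_, hd, (hr.rel _ _).2 ⟨i, d, rfl, rfl⟩⟩
    rw [this]
    exact ((hC' _).union (h1 _)).union (h2 i)

theorem isChain : IsChain h (glueMap r) where
  emb i := by
    refine IsClosedEmbedding.of_continuous_injective_isClosedMap
      (continuous_quot_mk.comp continuous_sigmaMk) ?_ (hr.isClosedMap_mk.comp isClosedMap_sigmaMk)
    intro x y e
    rcases hr.mk_eq_iff.1 e with e | e | e
    · exact eq_of_heq (Sigma.mk.inj_iff.1 e).2
    · obtain ⟨j, d, e1, e2⟩ := (hr.rel _ _).1 e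
      have h1 := (Sigma.mk.inj_iff.1 e1).1
      have h2 := (Sigma.mk.inj_iff.1 e2).1
      omega
    · obtain ⟨j, d, e1, e2⟩ := (hr.rel _ _).1 e
      have h1 := (Sigma.mk.inj_iff.1 e1).1
      have h2 := (Sigma.mk.inj_iff.1 e2).1
      omega
  lf := by
    rintro ⟨i, x⟩
    -- A point of piece `i` can lie only in pieces of index at most `i + 1`, so the complement of
    -- all pieces from `i + 2` on is a neighborhood of it that meets finitely many pieces.
    have hcl : IsClosed (Quot.mk r '' {y : Σ i, P i | i + 2 ≤ y.1}) := by
      refine hr.isClosedMap_mk _ (isClosed_sigma_iff.2 fun j => ?_)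
      by_cases hj : i + 2 ≤ j
      · convert isClosed_univ
        ext y
        exact ⟨fun _ => trivial, fun _ => hj⟩
      · convert isClosed_empty
        ext y
        exact ⟨fun h => hj h, fun h => h.elim⟩
    refine ⟨_, hcl.isOpen_compl.mem_nhds ?_, (finite_Iio (i + 2)).subset ?_⟩
    · rintro ⟨⟨j, y⟩, hy, e⟩
      have hy' : i + 2 ≤ j := hy
      rcases hr.mk_eq_iff.1 e with e | e | e
      · have := (Sigma.mk.inj_iff.1 e).1
        omega
      · obtain ⟨k, d, e1, e2⟩ := (hr.rel _ _).1 e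
        have h1 := (Sigma.mk.inj_iff.1 e1).1
        have h2 := (Sigma.mk.inj_iff.1 e2).1
        omega
      · obtain ⟨k, d, e1, e2⟩ := (hr.rel _ _).1 e
        have h1 := (Sigma.mk.inj_iff.1 e1).1
        have h2 := (Sigma.mk.inj_iff.1 e2).1
        omega
    · rintro j ⟨_, ⟨y, rfl⟩, hy⟩
      by_contra hj
      exact hy ⟨⟨j, y⟩, not_lt (α := ℕ).1 hj, rfl⟩
  overlap i x y := by
    constructor
    · intro e
      rcases hr.mk_eq_iff.1 e with e | e | e
      · exact absurd (Sigma.mk.inj_iff.1 e).1 (Nat.succ_ne_self i).symm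
      · obtain ⟨k, d, e1, e2⟩ := (hr.rel _ _).1 e
        obtain ⟨rfl, e1⟩ := Sigma.mk.inj_iff.1 e1
        exact ⟨d, (eq_of_heq e1).symm, (eq_of_heq (Sigma.mk.inj_iff.1 e2).2).symm⟩
      · obtain ⟨k, d, e1, e2⟩ := (hr.rel _ _).1 e
        have h1 := (Sigma.mk.inj_iff.1 e1).1
        have h2 := (Sigma.mk.inj_iff.1 e2).1
        omega
    · rintro ⟨d, rfl, rfl⟩
      exact Quot.sound ((hr.rel _ _).2 ⟨i, d, rfl, rfl⟩)
  far i j hij := by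
    rw [Set.disjoint_left]
    rintro _ ⟨x, rfl⟩ ⟨y, e⟩
    rcases hr.mk_eq_iff.1 e with e | e | e
    · have := (Sigma.mk.inj_iff.1 e).1
      omega
    · obtain ⟨k, d, e1, e2⟩ := (hr.rel _ _).1 e
      have h1 := (Sigma.mk.inj_iff.1 e1).1
      have h2 := (Sigma.mk.inj_iff.1 e2).1
      omega
    · obtain ⟨k, d, e1, e2⟩ := (hr.rel _ _).1 e
      have h1 := (Sigma.mk.inj_iff.1 e1).1
      have h2 := (Sigma.mk.inj_iff.1 e2).1
      omega

/-- The quotient map is closed with finite fibers. Disjoint open neighborhoods of two fibers yield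
disjoint neighborhoods of the points: the complements of the images of their complements. -/
theorem t2Space [∀ i, T2Space (P i)] : T2Space (Quot r) := by
  have hfin : ∀ s, (Quot.mk r ⁻¹' {s}).Finite := by
    rintro ⟨x⟩
    have h1 : {y | r x y}.Finite :=
      Set.Subsingleton.finite fun y hy z hz => hr.rel_right_unique hy hz
    have h2 : {y | r y x}.Finite :=
      Set.Subsingleton.finite fun y hy z hz => hr.rel_left_unique hy hz
    refine ((finite_singleton x).union (h1.union h2)).subset fun y hy => ?_
    rcases hr.mk_eq_iff.1 hy with rfl | e | e
    exacts [.inl rfl, .inr (.inr e), .inr (.inl e)]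
  refine ⟨fun s t hst => ?_⟩
  obtain ⟨U, V, hU, hV, hsU, htV, hUV⟩ := SeparatedNhds.of_isCompact_isCompact
    (hfin s).isCompact (hfin t).isCompact (disjoint_singleton.2 hst |>.preimage _)
  refine ⟨_, _, (hr.isClosedMap_mk _ hU.isClosed_compl).isOpen_compl,
    (hr.isClosedMap_mk _ hV.isClosed_compl).isOpen_compl, ?_, ?_, ?_⟩
  · rintro ⟨x, hx, e⟩
    exact hx (hsU e)
  · rintro ⟨x, hx, e⟩
    exact hx (htV e)
  · rw [Set.disjoint_left]
    rintro ⟨x⟩ hx hx'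
    have h1 : x ∈ U := by_contra fun h => hx ⟨x, h, rfl⟩
    have h2 : x ∈ V := by_contra fun h => hx' ⟨x, h, rfl⟩
    exact Set.disjoint_left.1 hUV h1 h2

omit hr in
theorem sigmaCompactSpace [∀ i, CompactSpace (P i)] : SigmaCompactSpace (Quot r) := by
  refine ⟨?_⟩
  rw [← (Quot.mk_surjective (r := r)).range_eq]
  exact isSigmaCompact_range continuous_quot_mk

end IsGluing

/-- A closed embedding of the target of a chain gives a chain. -/
theorem IsChain.comp {T T' : Type*} [TopologicalSpace T] [TopologicalSpace T'] {κ : ∀ i, P i → T}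
    (hκ : IsChain h κ) {e : T → T'} (he : IsClosedEmbedding e) :
    IsChain h (fun i x => e (κ i x)) where
  emb i := he.comp (hκ.emb i)
  lf := by
    intro t
    by_cases ht : t ∈ range e
    · obtain ⟨s, rfl⟩ := ht
      obtain ⟨U, hU, hf⟩ := hκ.lf s
      obtain ⟨V, hV, hVU⟩ := he.isInducing.nhds_eq_comap s ▸ hU
      refine ⟨V, hV, hf.subset ?_⟩
      rintro j ⟨_, ⟨x, rfl⟩, hx⟩
      exact ⟨κ j x, mem_range_self x, hVU hx⟩
    · refine ⟨_, he.isClosed_range.isOpen_compl.mem_nhds ht, Set.finite_empty.subset ?_⟩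
      rintro j ⟨_, ⟨x, rfl⟩, hx⟩
      exact hx ⟨_, rfl⟩
  overlap i x y := by rw [he.injective.eq_iff]; exact hκ.overlap i x y
  far i j hij := by
    rw [Set.disjoint_left]
    rintro _ ⟨x, rfl⟩ ⟨y, hy⟩
    exact Set.disjoint_left.1 (hκ.far i j hij) ⟨x, rfl⟩ ⟨y, he.injective hy⟩

end Gluing

/-! ### Chains in a manifold fill out pseudo-collars -/

section

variable {m : ℕ} [NeZero m] {P : ℕ → Type u} [∀ i, TopologicalSpace (P i)]
  [∀ i, ChartedSpace (EuclideanHalfSpace m) (P i)] [∀ i, HasGroupoid (P i) (plGroupoid m)]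
  {A D : ∀ i, Set (P i)} {h : ∀ i, D i ≃ₜ A (i + 1)}
  {T : Type*} [TopologicalSpace T] {κ : ∀ i, P i → T}

theorem tail_anti {n k : ℕ} (hnk : n ≤ k) : tail κ k ⊆ tail κ n := fun t ht => by
  rw [mem_tail] at ht ⊢
  obtain ⟨j, hj, h⟩ := ht
  exact ⟨j, hnk.trans hj, h⟩

/-- A frontier point of the whole chain lies on `A 0`, whereas piece `0` meets the later pieces only
along `D 0`, which is disjoint from `A 0`. -/
theorem IsChain.tail_one_subset_interior (hκ : IsChain h κ) (hAD : Disjoint (A 0) (D 0))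
    (hfr : frontier (tail κ 0) ⊆ κ 0 '' A 0) : tail κ 1 ⊆ interior (tail κ 0) := by
  intro t ht
  by_contra hcon
  have h1 : t ∈ frontier (tail κ 0) :=
    (hκ.isClosed_tail 0).frontier_eq ▸ ⟨tail_anti zero_le_one ht, hcon⟩
  obtain ⟨a, ha, rfl⟩ := hfr h1
  obtain ⟨k, hk, y, hy⟩ := mem_tail.1 ht
  rcases hk.eq_or_lt with rfl | hlt
  · obtain ⟨d, hd, -⟩ := (hκ.overlap 0 a y).1 hy.symm
    exact Set.disjoint_left.1 hAD ha (hd ▸ d.2)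
  · exact Set.disjoint_left.1 (hκ.far 0 k hlt) (mem_range_self a) ⟨y, hy⟩

theorem IsChain.isCompact_closure_compl_tail (hκ : IsChain h κ) [∀ i, CompactSpace (P i)]
    (hc : IsCompact (closure (tail κ 0)ᶜ)) (n : ℕ) : IsCompact (closure (tail κ n)ᶜ) := by
  have h1 : IsCompact (⋃ j ∈ Iio n, range (κ j)) :=
    (finite_Iio n).isCompact_biUnion fun j _ => isCompact_range (hκ.emb j).continuous
  have h2 : IsClosed (⋃ j ∈ Iio n, range (κ j)) :=
    (finite_Iio n).isClosed_biUnion fun j _ => (hκ.emb j).isClosed_range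
  refine (hc.union h1).of_isClosed_subset isClosed_closure
    (closure_minimal ?_ (isClosed_closure.union h2))
  intro t ht
  by_cases h0 : t ∈ tail κ 0
  · obtain ⟨j, -, hj⟩ := mem_tail.1 h0
    refine .inr (mem_iUnion₂.2 ⟨j, ?_, hj⟩)
    exact not_le (α := ℕ).1 fun hn => ht (mem_tail.2 ⟨j, hn, hj⟩)
  · exact .inl (subset_closure h0)

/-- A chain of compact pieces in a manifold, with a deformation of each piece onto its initial end,
fills out a pseudo-collar. -/
theorem IsChain.isPseudoCollar [ChartedSpace (EuclideanHalfSpace m) T]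
    [HasGroupoid T (plGroupoid m)] [∀ i, CompactSpace (P i)] (hκ : IsChain h κ)
    (hA : ∀ i, IsCleanInBdry m (A i)) (hD : ∀ i, IsCleanInBdry m (D i))
    (hpl : ∀ i, IsPL m (fun q : A (i + 1) => ((h i).symm q : P i)))
    (hκpl : ∀ j x, AffineSelection m (𝓝 x)
        (fun q => (chartAt (EuclideanHalfSpace m) x q).val)
        (fun q => (chartAt (EuclideanHalfSpace m) (κ j x) (κ j q)).val))
    (hAD : Disjoint (A 0) (D 0)) (hSDR : ∀ i, IsSDR (A i) univ)
    (hN : IsCleanNbhdInfinity m (tail κ 0)) (hfr : κ 0 '' A 0 = frontier (tail κ 0)) :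
    IsPseudoCollar m (tail κ 0) := by
  have hint := hκ.tail_one_subset_interior hAD hfr.ge
  have key : ∀ n, IsHomotopyCollar m (tail κ n) := by
    rintro (_ | n)
    · exact ⟨hN, hfr ▸ (hκ.isSDR_tail hSDR 0).inclIsHEquiv⟩
    · refine ⟨⟨hκ.isClean_tail hA hD hpl hκpl hint n, hκ.isCompact_closure_compl_tail hN.2 _⟩, ?_⟩
      rw [hκ.frontier_tail hA hD hpl hint]
      exact (hκ.isSDR_tail hSDR (n + 1)).inclIsHEquiv
  refine ⟨key 0, fun K hK => ?_⟩
  -- A compact set meets only finitely many pieces, so a later tail misses it.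
  obtain ⟨n, hn⟩ := (hκ.lf.finite_nonempty_inter_compact hK).bddAbove
  refine ⟨tail κ (n + 1), tail_anti (Nat.zero_le _), ?_, key _⟩
  rw [Set.disjoint_left]
  intro t ht htK
  obtain ⟨j, hj, htj⟩ := mem_tail.1 ht
  have : j ≤ n := hn ⟨t, htj, htK⟩
  omega

end

/-! ### Realizations are pseudo-collars -/

namespace Concatenation

variable {m : ℕ} [NeZero m] (C : Concatenation.{u} m)

theorem isGluing : IsGluing (P := fun i => DisjUnion (C.cob i)) (A := fun i => unionA (C.cob i))
    (D := C.D) C.h C.Glue where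
  rel x y := by
    constructor
    · rintro ⟨i, b⟩
      exact ⟨i, b, rfl, rfl⟩
    · rintro ⟨i, b, rfl, rfl⟩
      exact .glue i b
  disj i := (disjoint_unionA_unionB (C.cob i)).mono_right (C.D_sub i)
  closedA i := (isCleanInBdry_unionA (C.cob i)).2.1
  closedD i := (C.D_clean i).2.1

theorem isChain_piece : IsChain (P := fun i => DisjUnion (C.cob i)) (A := fun i => unionA (C.cob i))
    (D := C.D) C.h C.piece := C.isGluing.isChain

theorem range_eq_tail {T : Type*} [TopologicalSpace T] (e : C.Space → T) :
    range e = tail (fun i p => e (C.piece i p)) 0 := by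
  ext t
  rw [mem_tail]
  constructor
  · rintro ⟨⟨i, p⟩, rfl⟩
    exact ⟨i, Nat.zero_le i, p, rfl⟩
  · rintro ⟨i, -, p, rfl⟩
    exact ⟨_, rfl⟩

/-- A clean neighborhood of infinity that realizes a concatenation is a pseudo-collar. -/
theorem Realizes.isPseudoCollar {C : Concatenation.{u} m} {M : Type u} [TopologicalSpace M]
    [ChartedSpace (EuclideanHalfSpace m) M] [HasGroupoid M (plGroupoid m)] {N : Set M}
    {e : C.Space → M} (h : C.Realizes N e) : IsPseudoCollar m N := by
  obtain ⟨hN, he, hr, hpl, hfr⟩ := h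
  have hκ := C.isChain_piece.comp ⟨he, hr ▸ hN.1.1⟩
  rw [C.range_eq_tail] at hr
  subst hr
  refine hκ.isPseudoCollar (fun i => isCleanInBdry_unionA _) C.D_clean C.h_symm_pl ?_
    (C.isGluing.disj 0) (fun i => isSDR_unionA _ (C.hequiv i)) hN hfr
  intro j x
  have h1 := (hpl j).2 ⟨x, mem_univ x⟩
  have h2 : Tendsto (fun q : DisjUnion (C.cob j) => (⟨q, mem_univ q⟩ : (univ : Set _))) (𝓝 x)
      (𝓝 ⟨x, mem_univ x⟩) := (continuous_id.subtype_mk _).tendsto x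
  exact h1.comp_tendsto h2

end Concatenation

/-! ### The PL structure on a space filled by a chain -/

section

variable {m : ℕ} [NeZero m] {P : ℕ → Type u} [∀ i, TopologicalSpace (P i)]
  [∀ i, ChartedSpace (EuclideanHalfSpace m) (P i)] [∀ i, HasGroupoid (P i) (plGroupoid m)]
  {A D : ∀ i, Set (P i)} {h : ∀ i, D i ≃ₜ A (i + 1)}
  {T : Type*} [TopologicalSpace T] {κ : ∀ i, P i → T}

/-- Away from the seams, a chart of a piece is a chart of the whole chain. -/
theorem IsChain.exists_chart_piece (hκ : IsChain h κ) (huniv : tail κ 0 = univ) {k : ℕ} {x : P k}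
    (hx : ∀ j ≠ k, κ k x ∉ range (κ j)) :
    ∃ f : OpenPartialHomeomorph T (EuclideanHalfSpace m), κ k x ∈ f.source ∧
      ∀ j y, κ j y ∈ f.source → AffineSelection m (𝓝 y)
        (fun q => (chartAt (EuclideanHalfSpace m) y q).val) (fun q => (f (κ j q)).val) := by
  have : Nonempty (P k) := ⟨x⟩
  obtain ⟨g, hg, hgc⟩ := exists_leftInverse_continuousOn (hκ.emb k).isEmbedding
  let O := ⋃ j : {j // j ≠ k}, range (κ j)
  have hO : IsClosed O := (hκ.lf.comp_injective Subtype.val_injective).isClosed_iUnion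
    fun j => (hκ.emb j).isClosed_range
  have hOr : Oᶜ ⊆ range (κ k) := by
    intro t ht
    obtain ⟨j, -, hj⟩ := mem_tail.1 (huniv ▸ mem_univ t : t ∈ tail κ 0)
    by_cases hjk : j = k
    · subst hjk; exact hj
    · exact (ht (mem_iUnion.2 ⟨⟨j, hjk⟩, hj⟩)).elim
  let φ := chartAt (EuclideanHalfSpace m) x
  have hopen : IsOpen (Oᶜ ∩ g ⁻¹' φ.source) :=
    (hgc.mono hOr).isOpen_inter_preimage hO.isOpen_compl φ.open_source
  refine ⟨localHomeo (fun s => φ (g s)) (fun y => κ k (φ.symm y)) hopen φ.open_target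
    (φ.continuousOn.comp (hgc.mono (inter_subset_left.trans hOr)) fun s hs => hs.2)
    ((hκ.emb k).continuous.comp_continuousOn φ.continuousOn_symm) ?_ ?_, ?_, ?_⟩
  · intro s hs _
    rw [φ.left_inv hs.2]
    obtain ⟨y, rfl⟩ := hOr hs.1
    rw [hg]
  · intro y hy _
    rw [hg, φ.right_inv hy]
  · have h0 : g (κ k x) ∈ φ.source := by rw [hg]; exact mem_chart_source _ x
    refine ⟨⟨?_, h0⟩, φ.map_source h0⟩
    simp only [O, mem_compl_iff, mem_iUnion, not_exists]
    exact fun j => hx j j.2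
  · intro j y hy
    by_cases hjk : j = k
    · subst hjk
      have hyφ : y ∈ φ.source := hg y ▸ hy.1.2
      refine (affineSelection_of_mem (chartAt_mem_plCharts y) (chartAt_mem_plCharts x)
        (mem_chart_source _ y) hyφ).congr .rfl (.of_forall fun q => ?_)
      change _ = (φ (g (κ j q))).val
      rw [hg]
    · exact (hy.1.1 (mem_iUnion.2 ⟨⟨j, hjk⟩, mem_range_self y⟩)).elim

/-- A chain that fills out the space makes it a PL manifold, if nothing is glued to the initial
end. -/
theorem IsChain.exists_chartedSpace (hκ : IsChain h κ) (huniv : tail κ 0 = univ)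
    (hA : ∀ i, IsCleanInBdry m (A i)) (hD : ∀ i, IsCleanInBdry m (D i))
    (hpl : ∀ i, IsPL m (fun q : A (i + 1) => ((h i).symm q : P i))) (hA0 : A 0 = ∅) :
    ∃ (_ : ChartedSpace (EuclideanHalfSpace m) T) (_ : HasGroupoid T (plGroupoid m)),
      ∀ j x, AffineSelection m (𝓝 x) (fun q => (chartAt (EuclideanHalfSpace m) x q).val)
        (fun q => (chartAt (EuclideanHalfSpace m) (κ j x) (κ j q)).val) := by
  have hint : ∀ t, t ∈ interior (tail κ 0) := fun t => by rw [huniv, interior_univ]; trivial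
  have key : ∀ t : T, ∃ f : OpenPartialHomeomorph T (EuclideanHalfSpace m), t ∈ f.source ∧
      ∀ j y, κ j y ∈ f.source → AffineSelection m (𝓝 y)
        (fun q => (chartAt (EuclideanHalfSpace m) y q).val) (fun q => (f (κ j q)).val) := by
    intro t
    by_cases hs : ∃ k, t ∈ κ (k + 1) '' A (k + 1)
    · obtain ⟨k, hk⟩ := hs
      obtain ⟨f, -, h1, -, -, -, h2⟩ := hκ.exists_chart hA hD hpl hk (hint t)
      exact ⟨f, h1, h2⟩
    · have hs' : ∀ k, t ∉ κ k '' A k := by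
        rintro (_ | k) hk
        · simp [hA0] at hk
        · exact hs ⟨k, hk⟩
      obtain ⟨k, -, x, rfl⟩ := mem_tail.1 (huniv ▸ mem_univ t : t ∈ tail κ 0)
      refine hκ.exists_chart_piece huniv fun j hj hx => ?_
      rcases lt_or_gt_of_ne hj with hlt | hlt
      · exact hs' k (hκ.inter_subset hlt ⟨hx, mem_range_self x⟩)
      · exact hs' j (hκ.inter_subset hlt ⟨mem_range_self x, hx⟩)
  choose f hf1 hf2 using key
  -- All maps that are PL on every piece are admitted as charts. Two of them are compatible because
  -- on each piece the first can be inverted and followed by the second.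
  let inst : ChartedSpace (EuclideanHalfSpace m) T :=
    { atlas := {f | ∀ j y, κ j y ∈ f.source → AffineSelection m (𝓝 y)
        (fun q => (chartAt (EuclideanHalfSpace m) y q).val) (fun q => (f (κ j q)).val)}
      chartAt := f
      mem_chart_source := hf1
      chart_mem_atlas := hf2 }
  refine ⟨inst, ⟨?_⟩, fun j x => hf2 (κ j x) j x (hf1 _)⟩
  have comp : ∀ φ ∈ atlas (EuclideanHalfSpace m) T, ∀ ψ ∈ atlas (EuclideanHalfSpace m) T,
      ∀ p ∈ φ.source ∩ ψ.source,
        AffineSelection m (𝓝 p) (fun q => (φ q).val) (fun q => (ψ q).val) := by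
    intro φ hφ ψ hψ p hp
    refine hκ.affineSelection (hint p) ?_
    rintro j x rfl
    refine AffineSelection.trans ?_ (hψ j x hp.2)
    refine AffineSelection.symm ((φ.open_source.preimage (hκ.emb j).continuous).mem_nhds hp.1)
      (mem_chart_source _ x) ?_ ?_ (hφ j x hp.1)
    · exact (chart_val_continuousOn φ).comp (hκ.emb j).continuous.continuousOn fun _ h => h
    · exact fun a ha b hb hab => (hκ.emb j).injective (chart_val_injOn _ ha hb hab)
  intro φ ψ hφ hψ
  exact symm_trans_mem_plGroupoid_iff.2 fun p hp => ⟨comp φ hφ ψ hψ p hp, comp ψ hψ φ hφ p hp.symm⟩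

theorem isCleanInBdry_empty {X : Type*} [TopologicalSpace X]
    [ChartedSpace (EuclideanHalfSpace m) X] : IsCleanInBdry m (∅ : Set X) :=
  ⟨empty_subset _, isClosed_empty, fun _ hp => hp.1.elim⟩

end

/-! ### Realizing a concatenation by doubling its first piece -/

namespace Concatenation

variable {m : ℕ} [NeZero m] (C : Concatenation.{u} m)

/-- The pieces of the concatenation, with an additional copy of the first one in front. -/
abbrev collared : ℕ → Type u
  | 0 => DisjUnion (C.cob 0)
  | i + 1 => DisjUnion (C.cob i)

instance collaredTop : ∀ i, TopologicalSpace (C.collared i)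
  | 0 => inferInstanceAs (TopologicalSpace (DisjUnion (C.cob 0)))
  | i + 1 => inferInstanceAs (TopologicalSpace (DisjUnion (C.cob i)))

noncomputable instance collaredCharted : ∀ i, ChartedSpace (EuclideanHalfSpace m) (C.collared i)
  | 0 => inferInstanceAs (ChartedSpace (EuclideanHalfSpace m) (DisjUnion (C.cob 0)))
  | i + 1 => inferInstanceAs (ChartedSpace (EuclideanHalfSpace m) (DisjUnion (C.cob i)))

instance collaredGroupoid : ∀ i, HasGroupoid (C.collared i) (plGroupoid m)
  | 0 => inferInstanceAs (HasGroupoid (DisjUnion (C.cob 0)) (plGroupoid m))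
  | i + 1 => inferInstanceAs (HasGroupoid (DisjUnion (C.cob i)) (plGroupoid m))

instance collaredT2 : ∀ i, T2Space (C.collared i)
  | 0 => inferInstanceAs (T2Space (DisjUnion (C.cob 0)))
  | i + 1 => inferInstanceAs (T2Space (DisjUnion (C.cob i)))

instance collaredCompact : ∀ i, CompactSpace (C.collared i)
  | 0 => inferInstanceAs (CompactSpace (DisjUnion (C.cob 0)))
  | i + 1 => inferInstanceAs (CompactSpace (DisjUnion (C.cob i)))

/-- The initial ends of the pieces. -/
def collaredA : ∀ i, Set (C.collared i)
  | 0 => ∅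
  | i + 1 => unionA (C.cob i)

/-- The terminal ends of the pieces. -/
def collaredD : ∀ i, Set (C.collared i)
  | 0 => unionA (C.cob 0)
  | i + 1 => C.D i

/-- The gluing homeomorphisms, the first one being the identity. -/
def collaredH : ∀ i, C.collaredD i ≃ₜ C.collaredA (i + 1)
  | 0 => Homeomorph.refl (unionA (C.cob 0))
  | i + 1 => C.h i

/-- The identifications. -/
def collaredGlue (x y : Σ i, C.collared i) : Prop :=
  ∃ i, ∃ d : C.collaredD i, x = ⟨i, d⟩ ∧ y = ⟨i + 1, C.collaredH i d⟩

theorem collaredA_clean : ∀ i, IsCleanInBdry m (C.collaredA i)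
  | 0 => isCleanInBdry_empty
  | i + 1 => isCleanInBdry_unionA (C.cob i)

theorem collaredD_clean : ∀ i, IsCleanInBdry m (C.collaredD i)
  | 0 => isCleanInBdry_unionA (C.cob 0)
  | i + 1 => C.D_clean i

theorem collaredH_symm_pl : ∀ i,
    IsPL m (fun q : C.collaredA (i + 1) => ((C.collaredH i).symm q : C.collared i))
  | 0 => ⟨continuous_subtype_val, fun _ => AffineSelection.refl⟩
  | i + 1 => C.h_symm_pl i

theorem collared_isGluing : IsGluing C.collaredH C.collaredGlue where
  rel _ _ := Iff.rfl
  disj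
    | 0 => empty_disjoint _
    | i + 1 => C.isGluing.disj i
  closedA i := (C.collaredA_clean i).2.1
  closedD i := (C.collaredD_clean i).2.1

/-- The shift of the indices. -/
def shift (x : Σ i, DisjUnion (C.cob i)) : Σ i, C.collared i := ⟨x.1 + 1, x.2⟩

/-- The added identification involves the piece of index `0`, which the shift avoids; so the
adjunction space injects into the enlarged gluing. -/
theorem collaredGlue_shift_iff (x y : Σ i, DisjUnion (C.cob i)) :
    C.collaredGlue (C.shift x) (C.shift y) ↔ C.Glue x y := by
  rw [C.isGluing.rel]
  constructor
  · rintro ⟨_ | i, d, h1, h2⟩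
    · exact absurd (Sigma.mk.inj_iff.1 h1).1 (Nat.succ_ne_zero _)
    · obtain ⟨j, x⟩ := x
      obtain ⟨j', y⟩ := y
      obtain ⟨e1, h1⟩ := Sigma.mk.inj_iff.1 h1
      obtain ⟨e2, h2⟩ := Sigma.mk.inj_iff.1 h2
      obtain rfl : j = i := Nat.succ_injective e1
      obtain rfl : j' = j + 1 := Nat.succ_injective e2
      exact ⟨j, d, congrArg (Sigma.mk (β := fun i => DisjUnion (C.cob i)) j) (eq_of_heq h1),
        congrArg (Sigma.mk (β := fun i => DisjUnion (C.cob i)) (j + 1)) (eq_of_heq h2)⟩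
  · rintro ⟨i, d, rfl, rfl⟩
    exact ⟨i + 1, d, rfl, rfl⟩

theorem shift_injective : Function.Injective C.shift := by
  rintro ⟨i, x⟩ ⟨j, y⟩ e
  obtain ⟨e1, e⟩ := Sigma.mk.inj_iff.1 e
  obtain rfl : i = j := Nat.succ_injective e1
  exact congrArg (Sigma.mk i) (eq_of_heq e)

theorem isClosedMap_shift : IsClosedMap C.shift := by
  intro S hS
  refine isClosed_sigma_iff.2 ?_
  rintro (_ | i)
  · convert isClosed_empty
    ext x
    refine ⟨?_, fun h => h.elim⟩
    rintro ⟨y, -, e⟩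
    exact absurd (Sigma.mk.inj_iff.1 e).1 (Nat.succ_ne_zero _)
  · refine Eq.mpr (congrArg (IsClosed (X := DisjUnion (C.cob i))) ?_) (isClosed_sigma_iff.1 hS i)
    refine Set.ext fun x => ?_
    constructor
    · rintro ⟨⟨j, y⟩, hy, e⟩
      obtain ⟨e1, e⟩ := Sigma.mk.inj_iff.1 e
      obtain rfl : j = i := Nat.succ_injective e1
      obtain rfl := eq_of_heq e
      exact hy
    · exact fun hx => ⟨⟨i, x⟩, hx, rfl⟩

theorem continuous_shift : Continuous C.shift :=
  continuous_sigma fun i => continuous_sigmaMk (σ := C.collared) (i := i + 1)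

/-- The adjunction space is a subspace of the space with the additional piece. -/
def toCollared : C.Space → Quot C.collaredGlue :=
  Quot.lift (fun x => Quot.mk _ (C.shift x)) fun _ _ h =>
    Quot.sound ((C.collaredGlue_shift_iff _ _).2 h)

theorem isClosedEmbedding_toCollared : IsClosedEmbedding C.toCollared := by
  refine .of_continuous_injective_isClosedMap
    (continuous_quot_lift _ (continuous_quot_mk.comp C.continuous_shift)) ?_ ?_
  · rintro ⟨x⟩ ⟨y⟩ e
    refine C.isGluing.mk_eq_iff.2 ?_
    rcases C.collared_isGluing.mk_eq_iff.1 e with e | e | e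
    · exact .inl (C.shift_injective e)
    · exact .inr (.inl ((C.collaredGlue_shift_iff _ _).1 e))
    · exact .inr (.inr ((C.collaredGlue_shift_iff _ _).1 e))
  · intro S hS
    have : C.toCollared '' S = Quot.mk _ '' (C.shift '' (Quot.mk C.Glue ⁻¹' S)) := by
      rw [image_image]
      ext t
      constructor
      · rintro ⟨⟨x⟩, hx, rfl⟩
        exact ⟨x, hx, rfl⟩
      · rintro ⟨x, hx, rfl⟩
        exact ⟨Quot.mk _ x, hx, rfl⟩
    rw [this]
    exact C.collared_isGluing.isClosedMap_mk _ (C.isClosedMap_shift _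
      (hS.preimage continuous_quot_mk))

/-- Every concatenation is realized in some manifold. -/
theorem exists_realizes : ∃ (M : Type u) (_ : TopologicalSpace M)
    (_ : ChartedSpace (EuclideanHalfSpace m) M) (_ : HasGroupoid M (plGroupoid m)) (_ : T2Space M)
    (_ : SecondCountableTopology M) (N : Set M) (e : C.Space → M), C.Realizes N e := by
  -- The manifold is the whole enlarged gluing and `N` is its tail from index `1`. The extra copy of
  -- the first piece lies on the other side of `A 0`, so `A 0` becomes the frontier of `N`, and the
  -- complement of `N` lies in this compact copy.
  have hκ := C.collared_isGluing.isChain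
  have huniv : tail (glueMap C.collaredGlue) 0 = univ := by
    refine eq_univ_of_forall ?_
    rintro ⟨i, x⟩
    exact mem_tail.2 ⟨i, Nat.zero_le i, x, rfl⟩
  obtain ⟨i1, i2, hpl⟩ := hκ.exists_chartedSpace huniv C.collaredA_clean C.collaredD_clean
    C.collaredH_symm_pl rfl
  have hint : tail (glueMap C.collaredGlue) 1 ⊆ interior (tail (glueMap C.collaredGlue) 0) := by
    rw [huniv, interior_univ]; exact subset_univ _
  have hσ : SigmaCompactSpace (Quot C.collaredGlue) := IsGluing.sigmaCompactSpace
  have hH : SecondCountableTopology (EuclideanHalfSpace m) :=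
    inferInstanceAs (SecondCountableTopology {x : EuclideanSpace ℝ (Fin m) // 0 ≤ x 0})
  refine ⟨Quot C.collaredGlue, inferInstance, i1, i2, C.collared_isGluing.t2Space,
    ChartedSpace.secondCountable_of_sigmaCompact (EuclideanHalfSpace m) _,
    tail (glueMap C.collaredGlue) 1, C.toCollared, ⟨?_, ?_⟩,
    C.isClosedEmbedding_toCollared.isEmbedding, ?_, ?_, ?_⟩
  · exact hκ.isClean_tail C.collaredA_clean C.collaredD_clean C.collaredH_symm_pl hpl hint 0
  · exact hκ.isCompact_closure_compl_tail (by simp [huniv]) 1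
  · ext t
    constructor
    · rintro ⟨⟨i, x⟩, rfl⟩
      exact mem_tail.2 ⟨i + 1, by omega, x, rfl⟩
    · intro ht
      obtain ⟨_ | i, hi, x, rfl⟩ := mem_tail.1 ht
      · omega
      · exact ⟨C.piece i x, rfl⟩
  · exact fun i => ⟨C.isClosedEmbedding_toCollared.continuous.comp
      ((C.isChain_piece.emb i).continuous.comp continuous_subtype_val),
      fun p => (hpl (i + 1) p.1).comp_tendsto continuous_subtype_val.continuousAt⟩
  · exact (hκ.frontier_tail C.collaredA_clean C.collaredD_clean C.collaredH_symm_pl hint 0).symm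

end Concatenation

/-! ### Clean submanifolds are PL manifolds -/

section CleanSubmanifold

variable {m : ℕ} [NeZero m]

/-- Flattening the wedge identifies the boundary of the half-space with the face together with the
remaining wall, which exists only for `i ≠ 0`. -/
theorem wedgeHomeo_bdry (i : Fin m) (d : ℝ) (y : EuclideanHalfSpace m) :
    y.val 0 = 0 ↔ (wedgeHomeo i d y).val i = level i ∨ (i ≠ 0 ∧ (wedgeHomeo i d y).val 0 = 0) := by
  rw [wedgeHomeo_val]
  have hy := y.2
  by_cases hi : i = 0
  · subst hi
    simp [level, setCoord_self]
  · simp only [hi, if_false, level, setCoord_self, setCoord_ne (Ne.symm hi), ne_eq,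
      not_false_eq_true, true_and]
    constructor
    · intro h
      rcases le_total d (y.val i) with h' | h'
      · exact .inl (by rw [h, max_eq_right (by linarith), add_zero])
      · exact .inr (by rw [h, max_eq_right (by linarith), add_zero])
    · rintro (h | h)
      · have := le_max_right (d - y.val i) 0
        linarith
      · have := le_max_right (y.val i - d) 0
        linarith

variable {M : Type u} [TopologicalSpace M] [ChartedSpace (EuclideanHalfSpace m) M]
  [HasGroupoid M (plGroupoid m)] {Q : Set M}

/-- A local model of a clean submanifold, at a frontier point or an interior point. -/
def IsModel (Q : Set M) (φ : OpenPartialHomeomorph M (EuclideanHalfSpace m)) (i : Fin m)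
    (c : ℝ) : Prop :=
  φ ∈ plCharts m M ∧ (i = 0 → 0 ≤ c) ∧ ∀ q ∈ φ.source, q ∈ Q ↔ c ≤ (φ q).val i

/-- Interior points receive the trivial model `i = 0`, `c = 0`, in which `Q` is everything; so
frontier and interior points are treated alike. -/
theorem IsClean.exists_model (hQ : IsClean m Q) {p : M} (hp : p ∈ Q) :
    ∃ φ i c, IsModel (m := m) Q φ i c ∧ p ∈ φ.source := by
  by_cases h : p ∈ frontier Q
  · obtain ⟨φ, hφ, hps, i, hi⟩ := hQ.2 p h
    exact ⟨φ, i, _, ⟨hφ, by rintro rfl; exact (φ p).2, hi⟩, hps⟩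
  · have h1 : p ∈ interior Q := by
      by_contra hcon
      exact h ⟨subset_closure hp, hcon⟩
    refine ⟨_, 0, 0, ⟨chart_restrOpen_mem (chartAt_mem_plCharts p) isOpen_interior,
      fun _ => le_rfl, fun q hq => ⟨fun _ => Subtype.prop (chartAt (EuclideanHalfSpace m) p q), fun _ => interior_subset hq.2⟩⟩,
      ⟨mem_chart_source _ p, h1⟩⟩

theorem IsModel.restrOpen {φ : OpenPartialHomeomorph M (EuclideanHalfSpace m)} {i : Fin m} {c : ℝ}
    (h : IsModel Q φ i c) {U : Set M} (hU : IsOpen U) : IsModel Q (φ.restrOpen U hU) i c :=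
  ⟨chart_restrOpen_mem h.1 hU, h.2.1, fun q hq => h.2.2 q hq.1⟩

/-- The proviso `0 < c` for `i = 0` excludes the trivial model, where the points with `x 0 = 0` are
boundary points of `M` but not frontier points of `Q`. -/
theorem IsModel.mem_frontier_iff {φ : OpenPartialHomeomorph M (EuclideanHalfSpace m)} {i : Fin m}
    {c : ℝ} (h : IsModel Q φ i c) {q : M} (hq : q ∈ φ.source) :
    q ∈ frontier Q ↔ (φ q).val i = c ∧ (i = 0 → 0 < c) := by
  have hcont : ContinuousAt (fun q => (φ q).val i) q :=
    (continuous_valCoord i).continuousAt.comp (φ.continuousAt hq)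
  constructor
  · intro hf
    have hni : q ∉ interior Q := hf.2
    have hle : c ≤ (φ q).val i := by
      by_contra hlt
      obtain ⟨r, h1, h2⟩ := (mem_closure_iff_frequently.1 hf.1).and_eventually
        ((φ.open_source.eventually_mem hq).and (hcont.eventually_lt continuousAt_const (not_le.1 hlt)))
        |>.exists
      exact absurd ((h.2.2 r h2.1).1 h1) (not_le.2 h2.2)
    refine ⟨hle.antisymm' ?_, ?_⟩
    · by_contra hlt
      refine hni (mem_interior_iff_mem_nhds.2 ?_)
      filter_upwards [φ.open_source.mem_nhds hq,
        continuousAt_const.eventually_lt hcont (not_le.1 hlt)] with r h1 h2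
      exact (h.2.2 r h1).2 h2.le
    · rintro rfl
      by_contra hc
      refine hni (mem_interior_iff_mem_nhds.2 ?_)
      filter_upwards [φ.open_source.mem_nhds hq] with r h1
      exact (h.2.2 r h1).2 ((not_lt.1 hc).trans (φ r).2)
  · rintro ⟨h1, h2⟩
    refine ⟨subset_closure ((h.2.2 q hq).2 h1.ge), fun hint => ?_⟩
    have hV : IsOpen (φ '' (φ.source ∩ interior Q)) :=
      φ.isOpen_image_of_subset_source (φ.open_source.inter isOpen_interior) inter_subset_left
    obtain ⟨_, ⟨s, hs, rfl⟩, hlt⟩ := exists_lt_coord hV (mem_image_of_mem φ ⟨hq, hint⟩) (i := i) (by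
      rintro rfl
      rw [h1]; exact h2 rfl)
    exact absurd ((h.2.2 s hs.1).1 (interior_subset hs.2)) (not_le.2 (h1 ▸ hlt))

/-- A local model of a clean submanifold gives a chart of the submanifold. -/
theorem IsModel.exists_subchart {φ : OpenPartialHomeomorph M (EuclideanHalfSpace m)} {i : Fin m}
    {c : ℝ} (h : IsModel Q φ i c) (hne : Nonempty Q) :
    ∃ f : OpenPartialHomeomorph Q (EuclideanHalfSpace m),
      (∀ q : Q, q ∈ f.source ↔ (q : M) ∈ φ.source) ∧ ∀ q ∈ f.source,
        (wedgeHomeo i 0 (f q)).val = setCoord i (φ q).val ((φ q).val i - c + level i) := by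
  classical
  -- Coordinate `i` is translated from level `c` to `level i`, which turns `Q` into the wedge;
  -- `wedgeHomeo` then flattens the wedge. For `i = 0` the translation back stays in the half-space
  -- because `0 ≤ c`.
  let s : EuclideanHalfSpace m → EuclideanSpace ℝ (Fin m) := fun x =>
    setCoord i x.val (x.val i - c + level i)
  have hs : Continuous s := continuous_setCoord continuous_val
    (((continuous_valCoord i).sub continuous_const).add continuous_const)
  let s' : Wedge i → EuclideanHalfSpace m := fun w =>
    toHalf m (setCoord i w.val (w.val i + c - level i))
  have hs' : Continuous s' := continuous_toHalf.comp (continuous_setCoord continuous_subtype_val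
    (((continuous_wedgeCoord i i).add continuous_const).sub continuous_const))
  have hsW : ∀ x : EuclideanHalfSpace m, c ≤ x.val i → s x ∈ Wedge i := fun x hx =>
    setCoord_mem_wedge x.2 (by linarith)
  have hs'val : ∀ w : Wedge i, (s' w).val = setCoord i w.val (w.val i + c - level i) := by
    intro w
    refine toHalf_val ?_
    by_cases hi : i = 0
    · subst hi
      rw [setCoord_self]
      have h1 := w.2.2
      have h2 := h.2.1 rfl
      linarith
    · rw [setCoord_ne (Ne.symm hi)]; exact w.2.1
  have hss' : ∀ w : Wedge i, s (s' w) = w.val := by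
    intro w
    simp only [s, hs'val, setCoord_self, setCoord_setCoord]
    rw [show w.val i + c - level i - c + level i = w.val i by ring, setCoord_eq]
  have hs's : ∀ x : EuclideanHalfSpace m, c ≤ x.val i → s' (toWedge i (s x)) = x := by
    intro x hx
    refine Subtype.ext ?_
    rw [hs'val, toWedge_val (hsW x hx)]
    simp only [s, setCoord_self, setCoord_setCoord]
    rw [show x.val i - c + level i + c - level i = x.val i by ring, setCoord_eq]
  obtain ⟨p⟩ := id hne
  let τ : EuclideanHalfSpace m → M := fun y => φ.symm (s' (wedgeHomeo i 0 y))
  let V : Set (EuclideanHalfSpace m) := {y | s' (wedgeHomeo i 0 y) ∈ φ.target}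
  have hV : IsOpen V := φ.open_target.preimage (hs'.comp (wedgeHomeo i 0).continuous)
  have hτ : ContinuousOn τ V := φ.continuousOn_symm.comp
    (hs'.comp (wedgeHomeo i 0).continuous).continuousOn fun y hy => hy
  have hτQ : ∀ y ∈ V, τ y ∈ Q := by
    intro y hy
    rw [h.2.2 _ (φ.map_target hy), φ.right_inv hy, hs'val, setCoord_self]
    have := (wedgeHomeo i 0 y).2.2
    linarith
  let σ : EuclideanHalfSpace m → Q := fun y => if hy : τ y ∈ Q then ⟨τ y, hy⟩ else p
  have hσ : ∀ y ∈ V, (σ y : M) = τ y := fun y hy => by simp only [σ, dif_pos (hτQ y hy)]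
  let g : Q → EuclideanHalfSpace m := fun q => (wedgeHomeo i 0).symm (toWedge i (s (φ q)))
  have hg : ∀ q : Q, (q : M) ∈ φ.source → s' (wedgeHomeo i 0 (g q)) = φ q := by
    intro q hq
    simp only [g, Homeomorph.apply_symm_apply]
    exact hs's _ ((h.2.2 _ hq).1 q.2)
  have hO : IsOpen {q : Q | (q : M) ∈ φ.source} := φ.open_source.preimage continuous_subtype_val
  refine ⟨localHomeo g σ hO hV ?_ ?_ ?_ ?_, ?_, ?_⟩
  · exact (((wedgeHomeo i 0).symm.continuous.comp ((continuous_toWedge i).comp hs)).comp_continuousOn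
      φ.continuousOn).comp continuous_subtype_val.continuousOn fun q hq => hq
  · rw [IsEmbedding.subtypeVal.continuousOn_iff]
    exact hτ.congr hσ
  · intro q hq hqV
    refine Subtype.ext ?_
    rw [hσ _ hqV]
    simp only [τ]
    rw [hg q hq, φ.left_inv hq]
  · intro y hy hσy
    simp only [g]
    rw [hσ y hy]
    simp only [τ]
    rw [φ.right_inv hy, hss', toWedge_coe, Homeomorph.symm_apply_apply]
  · intro q
    refine ⟨fun hq => hq.1, fun hq => ⟨hq, ?_⟩⟩
    change s' (wedgeHomeo i 0 (g q)) ∈ φ.target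
    rw [hg q hq]; exact φ.map_source hq
  · intro q hq
    change (wedgeHomeo i 0 (g q)).val = s (φ q)
    simp only [g, Homeomorph.apply_symm_apply]
    exact toWedge_val (hsW _ ((h.2.2 _ hq.1).1 q.2))

/-- The defining property of the chart of a clean submanifold that belongs to a local model. -/
def IsSubchart (φ : OpenPartialHomeomorph M (EuclideanHalfSpace m)) (i : Fin m) (c : ℝ)
    (f : OpenPartialHomeomorph Q (EuclideanHalfSpace m)) : Prop :=
  (∀ q : Q, q ∈ f.source ↔ (q : M) ∈ φ.source) ∧ ∀ q ∈ f.source,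
    (wedgeHomeo i 0 (f q)).val = setCoord i (φ q).val ((φ q).val i - c + level i)

section Subchart

variable {φ : OpenPartialHomeomorph M (EuclideanHalfSpace m)} {i : Fin m} {c : ℝ}
  {f : OpenPartialHomeomorph Q (EuclideanHalfSpace m)} (hf : IsSubchart φ i c f)
include hf

theorem IsSubchart.selection {p : Q} (hp : p ∈ f.source) :
    AffineSelection m (𝓝 p) (fun q : Q => (φ q).val) (fun q => (f q).val) := by
  have h0 : AffineSelection m (𝓝 p) (fun q : Q => (φ q).val)
      (fun q : Q => (wedgeHomeo i 0 (f q)).val) := by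
    refine AffineSelection.congr (AffineSelection.refl.setCoord
      (((RealSelection.coord i).sub (.const (c := c))).add (.const (c := level i))) i) .rfl ?_
    filter_upwards [f.open_source.mem_nhds hp] with q hq
    exact (hf.2 q hq).symm
  refine (h0.trans (affineSelection_wedgeHomeo_symm i 0 fun q => wedgeHomeo i 0 (f q))).congr
    .rfl (.of_forall fun q => ?_)
  simp only [Homeomorph.symm_apply_apply]

theorem IsSubchart.selection_symm {p : Q} (hp : p ∈ f.source) :
    AffineSelection m (𝓝 p) (fun q => (f q).val) (fun q : Q => (φ q).val) := by
  refine (affineSelection_wedgeHomeo i 0 fun q => f q).trans ?_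
  refine AffineSelection.congr (AffineSelection.refl.setCoord
    (((RealSelection.coord i).add (.const (c := c))).sub (.const (c := level i))) i) .rfl ?_
  filter_upwards [f.open_source.mem_nhds hp] with q hq
  rw [hf.2 q hq, setCoord_self, setCoord_setCoord, show (φ q).val i - c + level i + c - level i =
    (φ q).val i by ring, setCoord_eq]

theorem IsSubchart.face {q : Q} (hq : q ∈ f.source) :
    (φ q).val i = c ↔ (f q).val 0 = 0 ∧ (i ≠ 0 → 0 ≤ (f q).val i) := by
  rw [← wedgeHomeo_face, hf.2 q hq, setCoord_self]
  constructor <;> intro h <;> linarith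

theorem IsSubchart.bdry {q : Q} (hq : q ∈ f.source) :
    (f q).val 0 = 0 ↔ (φ q).val i = c ∨ (i ≠ 0 ∧ (φ q).val 0 = 0) := by
  rw [wedgeHomeo_bdry i 0, hf.2 q hq, setCoord_self]
  refine or_congr ⟨fun h => by linarith, fun h => by linarith⟩ (and_congr_right fun hi => ?_)
  rw [setCoord_ne (Ne.symm hi)]

end Subchart

/-- Clean submanifolds are PL manifolds. -/
theorem IsClean.exists_chartedSpace (hQ : IsClean m Q) :
    ∃ (_ : ChartedSpace (EuclideanHalfSpace m) Q) (_ : HasGroupoid Q (plGroupoid m)),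
      (∀ x : Q, AffineSelection m (𝓝 x) (fun q => (chartAt (EuclideanHalfSpace m) x q).val)
        (fun q => (chartAt (EuclideanHalfSpace m) (x : M) q).val)) ∧
      (∀ x : Q, AffineSelection m (𝓝 x)
        (fun q => (chartAt (EuclideanHalfSpace m) (x : M) q).val)
        (fun q => (chartAt (EuclideanHalfSpace m) x q).val)) ∧
      (∀ x : Q, x ∈ bdry m Q ↔ (x : M) ∈ bdry m M ∨ (x : M) ∈ frontier Q) ∧
      ∀ F ⊆ frontier Q, IsClosed F → IsClosed (frontier Q \ F) →
        IsCleanInBdry m (Subtype.val ⁻¹' F : Set Q) := by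
  -- The atlas consists of the charts of `Q` that are PL in both directions relative to the ambient
  -- charts, so compatibility is a composition.
  let At : Set (OpenPartialHomeomorph Q (EuclideanHalfSpace m)) := {f | ∀ x ∈ f.source,
    AffineSelection m (𝓝 x) (fun q => (f q).val)
      (fun q => (chartAt (EuclideanHalfSpace m) (x : M) q).val) ∧
    AffineSelection m (𝓝 x) (fun q => (chartAt (EuclideanHalfSpace m) (x : M) q).val)
      (fun q => (f q).val)}
  have hAt : ∀ φ i c f, IsModel Q φ i c → IsSubchart (m := m) (Q := Q) φ i c f → f ∈ At := by
    intro φ i c f hm hf x hx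
    have hx' := (hf.1 x).1 hx
    exact ⟨(hf.selection_symm hx).trans ((affineSelection_of_mem hm.1
      (chartAt_mem_plCharts (x : M)) hx' (mem_chart_source _ _)).comp_tendsto
      continuous_subtype_val.continuousAt), AffineSelection.trans ((affineSelection_of_mem
      (chartAt_mem_plCharts (x : M)) hm.1 (mem_chart_source _ _) hx').comp_tendsto
      continuous_subtype_val.continuousAt) (hf.selection hx)⟩
  have hex : ∀ x : Q, ∃ f ∈ At, x ∈ f.source := by
    intro x
    obtain ⟨φ, i, c, hm, hx⟩ := hQ.exists_model x.2
    obtain ⟨f, hf⟩ := hm.exists_subchart ⟨x⟩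
    exact ⟨f, hAt φ i c f hm hf, (hf.1 x).2 hx⟩
  choose ch hch hchs using hex
  let inst : ChartedSpace (EuclideanHalfSpace m) Q :=
    { atlas := At, chartAt := ch, mem_chart_source := hchs, chart_mem_atlas := hch }
  have hgr : HasGroupoid Q (plGroupoid m) := ⟨fun {φ ψ} hφ hψ =>
    symm_trans_mem_plGroupoid_iff.2 fun p hp =>
      ⟨(hφ p hp.1).1.trans (hψ p hp.2).2, (hψ p hp.2).1.trans (hφ p hp.1).2⟩⟩
  have hmem : ∀ φ i c f, IsModel Q φ i c → IsSubchart (m := m) (Q := Q) φ i c f →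
      f ∈ plCharts m Q := fun φ i c f hm hf =>
    StructureGroupoid.subset_maximalAtlas _ (hAt φ i c f hm hf)
  have hbd : ∀ x : Q, x ∈ bdry m Q ↔ (x : M) ∈ bdry m M ∨ (x : M) ∈ frontier Q := by
    intro x
    obtain ⟨φ, i, c, hm, hx⟩ := hQ.exists_model x.2
    obtain ⟨f, hf⟩ := hm.exists_subchart ⟨x⟩
    have hf' : IsSubchart φ i c f := hf
    have hxf := (hf.1 x).2 hx
    have hge := (hm.2.2 x hx).1 x.2
    rw [mem_bdry_iff (hmem φ i c f hm hf) hxf, mem_bdry_iff hm.1 hx, hm.mem_frontier_iff hx,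
      hf'.bdry hxf]
    by_cases hi : i = 0
    · subst hi
      have h0 := hm.2.1 rfl
      simp only [ne_eq, not_true_eq_false, false_and, or_false, true_imp_iff]
      constructor
      · intro h
        rcases h0.eq_or_lt with h0 | h0
        · exact .inl (by rw [h, ← h0])
        · exact .inr ⟨h, h0⟩
      · rintro (h | h)
        · linarith
        · exact h.1
    · simp only [hi, ne_eq, not_false_eq_true, true_and, false_imp_iff, and_true]
      exact or_comm
  refine ⟨inst, hgr, fun x => (hch x x (hchs x)).1, fun x => (hch x x (hchs x)).2, hbd, ?_⟩
  intro F hF hFc hFc'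
  refine ⟨fun x hx => (hbd x).2 (.inr (hF hx)), hFc.preimage continuous_subtype_val, ?_⟩
  rintro p ⟨hpF, hp⟩
  obtain ⟨φ, i, c, hm', hx'⟩ := hQ.exists_model p.2
  -- Away from the closed set `frontier Q \ F` the part `F` is the entire frontier, that is, the
  -- face of the model.
  have hm := hm'.restrOpen hFc'.isOpen_compl
  have hx : (p : M) ∈ (φ.restrOpen _ hFc'.isOpen_compl).source := ⟨hx', fun h => h.2 hpF⟩
  generalize hφ : φ.restrOpen _ hFc'.isOpen_compl = φ' at hm hx
  have hdis : ∀ q ∈ φ'.source, q ∈ frontier Q → q ∈ F := by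
    subst hφ
    exact fun q hq hqf => by_contra fun hqF => hq.2 ⟨hqf, hqF⟩
  obtain ⟨f, hf⟩ := hm.exists_subchart ⟨p⟩
  have hf' : IsSubchart φ' i c f := hf
  have hxf := (hf.1 p).2 hx
  have hc := ((hm.mem_frontier_iff hx).1 (hF hpF)).2
  have hiff : ∀ q ∈ f.source, (q : M) ∈ F ↔ (f q).val 0 = 0 ∧ (i ≠ 0 → 0 ≤ (f q).val i) := by
    intro q hq
    rw [← hf'.face hq]
    have hq' := (hf.1 q).1 hq
    constructor
    · exact fun h => ((hm.mem_frontier_iff hq').1 (hF h)).1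
    · exact fun h => hdis _ hq' ((hm.mem_frontier_iff hq').2 ⟨h, hc⟩)
  have hfm := hmem φ' i c f hm hf
  obtain ⟨hp0, hpi⟩ := (hiff p hxf).1 hpF
  have hfreq := mem_closure_iff_frequently.1 hp
  -- For `i = 0` the face would be the entire boundary of `Q` near `p`, but an edge point is a limit
  -- of boundary points off `F`.
  have hi : i ≠ 0 := by
    rintro rfl
    obtain ⟨q, hq, hqs⟩ := (hfreq.and_eventually (f.open_source.mem_nhds hxf)).exists
    exact hq.2 ((hiff q hqs).2 ⟨(mem_bdry_iff hfm hqs).1 hq.1, fun h => absurd rfl h⟩)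
  -- If coordinate `i` were positive at `p`, it would be so nearby, and all boundary points near `p`
  -- would belong to `F`.
  have hz : (f p).val i = 0 := by
    refine ((hpi hi).eq_or_lt.resolve_right fun hlt => ?_).symm
    have hcont : ContinuousAt (fun q => (f q).val i) p :=
      (continuous_valCoord i).continuousAt.comp (f.continuousAt hxf)
    obtain ⟨q, hq, hqs, hq2⟩ := (hfreq.and_eventually ((f.open_source.eventually_mem hxf).and
      (continuousAt_const.eventually_lt hcont hlt))).exists
    exact hq.2 ((hiff q hqs).2 ⟨(mem_bdry_iff hfm hqs).1 hq.1, fun _ => hq2.le⟩)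
  refine ⟨f, hfm, hxf, i, fun q hq => ?_⟩
  rw [hz]
  have h0 := (mem_bdry_iff hfm hq.1).1 hq.2
  exact (hiff q hq.1).trans ⟨fun h => h.2 hi, fun h => ⟨h0, fun _ => h⟩⟩

end CleanSubmanifold

/-! ### The difference of nested clean submanifolds -/

section CleanDifference

variable {m : ℕ} [NeZero m] {M : Type u} [TopologicalSpace M]
  [ChartedSpace (EuclideanHalfSpace m) M] [HasGroupoid M (plGroupoid m)] {P Q : Set M}

theorem IsModel.congr {φ : OpenPartialHomeomorph M (EuclideanHalfSpace m)} {i : Fin m} {c : ℝ}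
    (h : IsModel Q φ i c) (e : ∀ q ∈ φ.source, q ∈ P ↔ q ∈ Q) : IsModel P φ i c :=
  ⟨h.1, h.2.1, fun q hq => (e q hq).trans (h.2.2 q hq)⟩

theorem IsModel.isClean_at {φ : OpenPartialHomeomorph M (EuclideanHalfSpace m)} {i : Fin m} {c : ℝ}
    (h : IsModel Q φ i c) {p : M} (hp : p ∈ φ.source) (hpc : (φ p).val i = c) :
    ∃ φ ∈ StructureGroupoid.maximalAtlas M (plGroupoid m), p ∈ φ.source ∧
      ∃ i : Fin m, ∀ q ∈ φ.source, q ∈ Q ↔ (φ p).val i ≤ (φ q).val i :=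
  ⟨φ, h.1, hp, i, fun q hq => hpc ▸ h.2.2 q hq⟩

/-- Reflecting a coordinate turns a local model of `Q` into a local model of the closure of the
complement. -/
theorem IsModel.flip {φ : OpenPartialHomeomorph M (EuclideanHalfSpace m)} {i : Fin m} {c : ℝ}
    (h : IsModel Q φ i c) {p : M} (hp : p ∈ φ.source) (hpQ : p ∈ frontier Q) :
    ∃ ψ, IsModel (interior Q)ᶜ ψ i c ∧ p ∈ ψ.source ∧ (ψ p).val i = c := by
  obtain ⟨hpc, hc⟩ := (h.mem_frontier_iff hp).1 hpQ
  let r : EuclideanHalfSpace m → EuclideanHalfSpace m := fun x =>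
    toHalf m (setCoord i x.val (2 * c - x.val i))
  have hr : Continuous r := continuous_toHalf.comp (continuous_setCoord continuous_val
    (continuous_const.sub (continuous_valCoord i)))
  -- For `i = 0` the reflection at level `c` preserves the half-space only on the strip `0 < x 0 < 2
  -- * c`.
  let O : Set (EuclideanHalfSpace m) := {x | i = 0 → 0 < x.val 0 ∧ x.val 0 < 2 * c}
  have hO : IsOpen O := by
    by_cases hi : i = 0
    · have : O = {x | 0 < x.val 0} ∩ {x | x.val 0 < 2 * c} := by ext x; simp [O, hi]
      rw [this]
      exact (isOpen_lt continuous_const (continuous_valCoord 0)).inter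
        (isOpen_lt (continuous_valCoord 0) continuous_const)
    · have : O = univ := by ext x; simp [O, hi]
      rw [this]; exact isOpen_univ
  have hrv : ∀ x ∈ O, (r x).val = setCoord i x.val (2 * c - x.val i) := by
    intro x hx
    refine toHalf_val ?_
    by_cases hi : i = 0
    · subst hi
      rw [setCoord_self]
      linarith [(hx rfl).2]
    · rw [setCoord_ne (Ne.symm hi)]; exact x.2
  have hrO : ∀ x ∈ O, r x ∈ O := by
    intro x hx hi
    subst hi
    rw [hrv x hx, setCoord_self]
    have := hx rfl
    constructor <;> linarith
  have hrr : ∀ x ∈ O, r (r x) = x := by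
    intro x hx
    refine Subtype.ext ?_
    rw [hrv _ (hrO x hx), hrv x hx, setCoord_self, setCoord_setCoord, sub_sub_cancel, setCoord_eq]
  have hO1 : IsOpen (φ.source ∩ φ ⁻¹' O) := φ.isOpen_inter_preimage hO
  have hO2 : IsOpen (O ∩ r ⁻¹' φ.target) := hO.inter (φ.open_target.preimage hr)
  let ψ := localHomeo (fun q => r (φ q)) (fun y => φ.symm (r y)) hO1 hO2
    (hr.comp_continuousOn (φ.continuousOn.mono inter_subset_left))
    (φ.continuousOn_symm.comp hr.continuousOn fun y hy => hy.2)
    (fun x hx _ => by rw [hrr _ hx.2, φ.left_inv hx.1])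
    (fun y hy _ => by rw [φ.right_inv hy.2, hrr _ hy.1])
  have hsrc : ∀ q ∈ φ.source, φ q ∈ O → q ∈ ψ.source := fun q hq hqO =>
    ⟨⟨hq, hqO⟩, hrO _ hqO, by rw [mem_preimage, hrr _ hqO]; exact φ.map_source hq⟩
  have hψ : ∀ q ∈ ψ.source, (ψ q).val = setCoord i (φ q).val (2 * c - (φ q).val i) :=
    fun q hq => hrv _ hq.1.2
  have hpO : φ p ∈ O := by
    rintro rfl
    have := hc rfl
    rw [hpc]
    constructor <;> linarith
  refine ⟨ψ, ⟨?_, h.2.1, ?_⟩, hsrc p hp hpO, ?_⟩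
  · refine mem_plCharts fun q hq => ⟨φ, h.1, hq.1.1, ?_⟩
    refine AffineSelection.congr (AffineSelection.refl.setCoord
      ((RealSelection.const (c := 2 * c)).sub (.coord i)) i) .rfl ?_
    filter_upwards [ψ.open_source.mem_nhds hq] with r hr
    exact (hψ r hr).symm
  · intro q hq
    rw [hψ q hq, setCoord_self]
    have hqs : q ∈ φ.source := hq.1.1
    have hf := h.mem_frontier_iff hqs
    have hQ := h.2.2 q hqs
    have : q ∈ interior Q ↔ c < (φ q).val i := by
      constructor
      · intro hqi
        refine (hQ.1 (interior_subset hqi)).lt_of_ne fun e => ?_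
        exact (hf.2 ⟨e.symm, hc⟩).2 hqi
      · intro hlt
        by_contra hcon
        exact hlt.ne' (hf.1 ⟨subset_closure (hQ.2 hlt.le), hcon⟩).1
    rw [mem_compl_iff, this, not_lt]
    constructor <;> intro h <;> linarith
  · rw [hψ p (hsrc p hp hpO), setCoord_self, hpc]; ring

theorem IsClean.exists_model_frontier (hQ : IsClean m Q) {p : M} (hp : p ∈ frontier Q) :
    ∃ φ i c, IsModel (m := m) Q φ i c ∧ p ∈ φ.source ∧ (φ p).val i = c := by
  obtain ⟨φ, i, c, hm, hps⟩ := hQ.exists_model (hQ.1.frontier_subset hp)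
  exact ⟨φ, i, c, hm, hps, ((hm.mem_frontier_iff hps).1 hp).1⟩

variable (hP : IsClean m P) (hQ : IsClean m Q) (hQP : Q ⊆ interior P)
include hP hQ hQP

/-- As `Q` lies in the interior of `P`, the frontiers are disjoint: near that of `P` the difference
looks like `P`, near that of `Q` like the complement of the interior of `Q`, whose model is the
flipped one. -/
theorem IsClean.exists_model_sdiff {p : M} (hp : p ∈ frontier P ∪ frontier Q) :
    ∃ φ i c, IsModel (m := m) (P \ interior Q) φ i c ∧ p ∈ φ.source ∧ (φ p).val i = c ∧
      (i = 0 → 0 < c) := by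
  rcases hp with hp | hp
  · obtain ⟨φ, i, c, hm, hps, hpc⟩ := hP.exists_model_frontier hp
    refine ⟨_, i, c, (hm.restrOpen hQ.1.isOpen_compl).congr fun q hq => ?_,
      ⟨hps, fun h => hp.2 (hQP h)⟩, hpc, ((hm.mem_frontier_iff hps).1 hp).2⟩
    exact ⟨fun h => h.1, fun h => ⟨h, fun hi => hq.2 (interior_subset hi)⟩⟩
  · obtain ⟨φ, i, c, hm, hps, hpc⟩ := hQ.exists_model_frontier hp
    obtain ⟨ψ, hψ, hpψ, hψc⟩ := hm.flip hps hp
    refine ⟨_, i, c, (hψ.restrOpen (isOpen_interior (s := P))).congr fun q hq => ?_,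
      ⟨hpψ, hQP (hQ.1.frontier_subset hp)⟩, hψc, ((hm.mem_frontier_iff hps).1 hp).2⟩
    exact ⟨fun h => h.2, fun h => ⟨interior_subset hq.2, h⟩⟩

theorem IsClean.frontier_sdiff : frontier (P \ interior Q) = frontier P ∪ frontier Q := by
  refine Subset.antisymm ?_ fun p hp => ?_
  · rw [sdiff_eq]
    refine (frontier_inter_subset _ _).trans (union_subset_union inter_subset_left ?_)
    rw [frontier_compl]
    exact inter_subset_right.trans frontier_interior_subset
  · obtain ⟨φ, i, c, hm, hps, hpc, hc⟩ := hP.exists_model_sdiff hQ hQP hp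
    exact (hm.mem_frontier_iff hps).2 ⟨hpc, hc⟩

theorem IsClean.sdiff : IsClean m (P \ interior Q) := by
  refine ⟨hP.1.sdiff isOpen_interior, fun p hp => ?_⟩
  rw [hP.frontier_sdiff hQ hQP] at hp
  obtain ⟨φ, i, c, hm, hps, hpc, -⟩ := hP.exists_model_sdiff hQ hQP hp
  exact hm.isClean_at hps hpc

end CleanDifference

theorem locallyCompactSpace_of_charted (m : ℕ) [NeZero m] (M : Type*) [TopologicalSpace M]
    [ChartedSpace (EuclideanHalfSpace m) M] : LocallyCompactSpace M := by
  have h : IsClosed {x : EuclideanSpace ℝ (Fin m) | 0 ≤ x 0} :=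
    isClosed_le continuous_const (continuous_coord 0)
  have hH : LocallyCompactSpace (EuclideanHalfSpace m) :=
    h.isClosedEmbedding_subtypeVal.locallyCompactSpace
  exact ChartedSpace.locallyCompactSpace (EuclideanHalfSpace m) M

/-! ### Nested homotopy collars -/

section Nested

variable {m : ℕ} [NeZero m] {M : Type u} [TopologicalSpace M]
  [ChartedSpace (EuclideanHalfSpace m) M] [HasGroupoid M (plGroupoid m)] [T2Space M]
  [SecondCountableTopology M]

/-- The frontier of a homotopy collar is a deformation retract. -/
theorem IsHomotopyCollar.isSDR {N : Set M} (hN : IsHomotopyCollar m N) :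
    IsSDR (frontier N) N := by
  have hM : LocallyCompactSpace M := locallyCompactSpace_of_charted m M
  obtain ⟨i1, i2, -, -, -, hF⟩ := hN.1.1.exists_chartedSpace
  have hsub : frontier N ⊆ N := hN.1.1.1.frontier_subset
  have hcl : IsCleanInBdry m (Subtype.val ⁻¹' frontier N : Set N) :=
    hF _ subset_rfl isClosed_frontier (by simp)
  have hcomp : IsCompact (frontier N) := hN.1.2.of_isClosed_subset isClosed_frontier
    (by rw [frontier_eq_closure_inter_closure]; exact inter_subset_right)
  have hcomp' : IsCompact (Subtype.val ⁻¹' frontier N : Set N) :=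
    hN.1.1.1.isClosedEmbedding_subtypeVal.isCompact_preimage hcomp
  have e1 : Subtype.val '' (Subtype.val ⁻¹' frontier N : Set N) = frontier N := by
    rw [Subtype.image_preimage_coe, inter_eq_right.2 hsub]
  have e2 : Subtype.val '' (univ : Set N) = N := by simp
  -- In the manifold `N` the frontier is a compact clean part of the boundary, so `IsNDR.isSDR`
  -- applies once the homotopy equivalence is moved into `N`.
  have h1 : InclIsHEquiv (Subtype.val ⁻¹' frontier N : Set N) univ := by
    refine .of_image IsEmbedding.subtypeVal ?_
    rw [e1, e2]; exact hN.2
  have h2 := ((hcl.isNDR hcomp').isSDR h1).image IsEmbedding.subtypeVal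
  rwa [e1, e2] at h2

/-- The part between two nested homotopy collars is homotopy equivalent to its initial end. -/
theorem IsHomotopyCollar.inclIsHEquiv_sdiff {N N' : Set M} (hN : IsHomotopyCollar m N)
    (hN' : IsHomotopyCollar m N') (hsub : N' ⊆ interior N) :
    InclIsHEquiv (frontier N) (N \ interior N') := by
  refine hN.2.of_isSDR_right ?_ fun p hp => ⟨hN.1.1.1.frontier_subset hp,
    fun h => hp.2 (hsub (interior_subset h))⟩
  obtain ⟨H, hH⟩ := hN'.isSDR
  -- The deformation of `N'` onto its frontier, extended by the identity, retracts `N` onto the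
  -- layer.
  have h1 := hH.union (C := N \ interior N') hN'.1.1.1 (hN.1.1.1.sdiff isOpen_interior)
    fun p hp => ⟨subset_closure hp.2, hp.1.2⟩
  have e1 : frontier N' ∪ N \ interior N' = N \ interior N' := union_eq_right.2 fun p hp =>
    ⟨interior_subset (hsub (hN'.1.1.1.frontier_subset hp)), hp.2⟩
  have e2 : N' ∪ N \ interior N' = N := by
    ext p
    constructor
    · rintro (h | h)
      exacts [interior_subset (hsub h), h.1]
    · intro h
      by_cases h' : p ∈ N'
      exacts [.inl h', .inr ⟨h, fun h'' => h' (interior_subset h'')⟩]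
  rw [e1, e2] at h1
  exact ⟨_, h1⟩

/-- A pseudo-collar contains a sequence of nested homotopy collars that leave every compact set. -/
theorem IsPseudoCollar.exists_seq {N : Set M} (hN : IsPseudoCollar m N) :
    ∃ S : ℕ → Set M, S 0 = N ∧ (∀ i, IsHomotopyCollar m (S i)) ∧
      (∀ i, S (i + 1) ⊆ interior (S i)) ∧ ∀ p, ∃ U ∈ 𝓝 p, ∃ n, ∀ i ≥ n, Disjoint (S i) U := by
  have hM : LocallyCompactSpace M := locallyCompactSpace_of_charted m M
  let K := CompactExhaustion.choice M
  have step : ∀ (i : ℕ) (S : {S : Set M // IsHomotopyCollar m S}),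
      ∃ S' : {S : Set M // IsHomotopyCollar m S}, S'.1 ⊆ interior S.1 ∧ Disjoint S'.1 (K i) := by
    intro i S
    -- Avoiding the compact set `closure S.1ᶜ` forces `S'` into the interior of `S`; avoiding `K i`
    -- makes the sequence leave every compact set.
    obtain ⟨S', -, h2, h3⟩ := hN.2 (closure S.1ᶜ ∪ K i) (S.2.1.2.union (K.isCompact i))
    rw [disjoint_union_right, closure_compl, disjoint_compl_right_iff_subset] at h2
    exact ⟨⟨S', h3⟩, h2⟩
  choose f hf1 hf2 using step
  let S : ℕ → {S : Set M // IsHomotopyCollar m S} := fun n => Nat.rec ⟨N, hN.1⟩ f n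
  refine ⟨fun i => (S i).1, rfl, fun i => (S i).2, fun i => hf1 i (S i), fun p => ?_⟩
  obtain ⟨n, hn⟩ := K.exists_mem_nhds p
  refine ⟨_, hn, n + 1, fun i hi => ?_⟩
  obtain ⟨j, rfl⟩ : ∃ j, i = j + 1 := ⟨i - 1, by omega⟩
  exact (hf2 j (S j)).mono_right (K.subset (by omega))

end Nested

/-! ### Edges, complements in the boundary, and the choice of `B` -/

section EdgeCharts

variable {m : ℕ} [NeZero m] {W : Type*} [TopologicalSpace W]
  [ChartedSpace (EuclideanHalfSpace m) W] [HasGroupoid W (plGroupoid m)] {A B D : Set W}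

/-- Moving along the boundary in a chart. -/
theorem exists_bdry_near {φ : OpenPartialHomeomorph W (EuclideanHalfSpace m)}
    (hφ : φ ∈ plCharts m W) {q : W} (hq : q ∈ φ.source) (hqb : q ∈ bdry m W) {i : Fin m}
    (hi : i ≠ 0) {O : Set W} (hO : O ∈ 𝓝 q) : ∃ δ > 0, ∀ t : ℝ, |t| < δ →
      ∃ q' ∈ O, q' ∈ φ.source ∩ bdry m W ∧ (φ q').val i = (φ q).val i + t := by
  let z : ℝ → EuclideanHalfSpace m := fun t => toHalf m (setCoord i (φ q).val ((φ q).val i + t))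
  have hz : Continuous z :=
    continuous_toHalf.comp (continuous_setCoord continuous_const (by fun_prop))
  have hzv : ∀ t, (z t).val = setCoord i (φ q).val ((φ q).val i + t) := fun t =>
    toHalf_val (by rw [setCoord_ne (Ne.symm hi)]; exact (φ q).2)
  have hz0 : z 0 = φ q := Subtype.ext (by rw [hzv, add_zero, setCoord_eq])
  have h1 : ∀ᶠ t in 𝓝 0, z t ∈ φ.target := hz.continuousAt.eventually
    (φ.open_target.mem_nhds (by rw [hz0]; exact φ.map_source hq))
  have h2 : ∀ᶠ t in 𝓝 0, φ.symm (z t) ∈ O := by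
    have : ContinuousAt (fun t => φ.symm (z t)) 0 := by
      refine ContinuousAt.comp ?_ hz.continuousAt
      rw [hz0]
      exact φ.continuousAt_symm (φ.map_source hq)
    refine this.eventually ?_
    change ∀ᶠ y in 𝓝 (φ.symm (z 0)), y ∈ O
    rwa [hz0, φ.left_inv hq]
  obtain ⟨δ, hδ, hsub⟩ := Metric.eventually_nhds_iff.1 (h1.and h2)
  refine ⟨δ, hδ, fun t ht => ?_⟩
  obtain ⟨ht1, ht2⟩ := hsub (y := t) (by simpa using ht)
  refine ⟨_, ht2, ⟨φ.map_target ht1, ?_⟩, ?_⟩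
  · rw [mem_bdry_iff hφ (φ.map_target ht1), φ.right_inv ht1, hzv, setCoord_ne (Ne.symm hi)]
    exact (mem_bdry_iff hφ hq).1 hqb
  · rw [φ.right_inv ht1, hzv, setCoord_self]

/-- A chart in which `A` is a half-space of the boundary. -/
structure IsEdgeChart (A : Set W) (φ : OpenPartialHomeomorph W (EuclideanHalfSpace m))
    (i : Fin m) (c : ℝ) : Prop where
  mem : φ ∈ plCharts m W
  ne : i ≠ 0
  iff : ∀ q ∈ φ.source ∩ bdry m W, q ∈ A ↔ c ≤ (φ q).val i

theorem IsCleanInBdry.exists_edgeChart (hA : IsCleanInBdry m A) {p : W} (hp : p ∈ edge m A)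
    {U : Set W} (hU : U ∈ 𝓝 p) :
    ∃ (φ : OpenPartialHomeomorph W (EuclideanHalfSpace m)) (i : Fin m),
      IsEdgeChart A φ i ((φ p).val i) ∧ p ∈ φ.source ∧ φ.source ⊆ U := by
  obtain ⟨φ, hφ, hps, hφU, i, hi, hiff⟩ := hA.exists_chart hp.1 hU
  exact ⟨φ, i, ⟨hφ, fun h => hi.1 h hp, hiff⟩, hps, hφU⟩

section

variable {φ : OpenPartialHomeomorph W (EuclideanHalfSpace m)} {i : Fin m} {c : ℝ}
  (h : IsEdgeChart A φ i c) {q : W} (hq : q ∈ φ.source ∩ bdry m W)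
include h hq

/-- Since `i ≠ 0`, coordinate `i` can be varied both ways within the boundary, so the points with `x
i < c` accumulate at those with `x i = c`. -/
theorem IsEdgeChart.mem_closure_iff : q ∈ closure (bdry m W \ A) ↔ (φ q).val i ≤ c := by
  constructor
  · intro hcl
    by_contra hlt
    have hcont : ContinuousAt (fun q => (φ q).val i) q :=
      (continuous_valCoord i).continuousAt.comp (φ.continuousAt hq.1)
    obtain ⟨r, hr, hrs, hr2⟩ := ((mem_closure_iff_frequently.1 hcl).and_eventually
      ((φ.open_source.eventually_mem hq.1).and
      (continuousAt_const.eventually_lt hcont (not_le.1 hlt)))).exists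
    exact hr.2 ((h.iff r ⟨hrs, hr.1⟩).2 hr2.le)
  · intro hle
    rw [mem_closure_iff_nhds]
    intro O hO
    obtain ⟨δ, hδ, hn⟩ := exists_bdry_near h.mem hq.1 hq.2 h.ne hO
    obtain ⟨q', hq'O, hq', e⟩ := hn (-(δ / 2)) (by rw [abs_neg, abs_of_pos] <;> linarith)
    refine ⟨q', hq'O, hq'.2, fun hA => ?_⟩
    have := (h.iff q' hq').1 hA
    linarith

theorem IsEdgeChart.mem_edge_iff : q ∈ edge m A ↔ (φ q).val i = c := by
  rw [edge, mem_inter_iff, h.iff q hq, h.mem_closure_iff hq]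
  exact ⟨fun h => h.2.antisymm h.1, fun h => ⟨h.ge, h.le⟩⟩

theorem IsEdgeChart.mem_closure_compl_iff :
    q ∈ closure (bdry m W \ closure (bdry m W \ A)) ↔ c ≤ (φ q).val i := by
  constructor
  · intro hcl
    rw [← h.iff q hq]
    by_contra hcon
    have hcont : ContinuousAt (fun q => (φ q).val i) q :=
      (continuous_valCoord i).continuousAt.comp (φ.continuousAt hq.1)
    rw [h.iff q hq, not_le] at hcon
    obtain ⟨r, hr, hrs, hr2⟩ := ((mem_closure_iff_frequently.1 hcl).and_eventually
      ((φ.open_source.eventually_mem hq.1).and (hcont.eventually_lt continuousAt_const hcon))).exists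
    exact hr.2 ((h.mem_closure_iff ⟨hrs, hr.1⟩).2 hr2.le)
  · intro hle
    rw [mem_closure_iff_nhds]
    intro O hO
    obtain ⟨δ, hδ, hn⟩ := exists_bdry_near h.mem hq.1 hq.2 h.ne hO
    obtain ⟨q', hq'O, hq', e⟩ := hn (δ / 2) (by rw [abs_of_pos] <;> linarith)
    refine ⟨q', hq'O, hq'.2, fun hA => ?_⟩
    have := (h.mem_closure_iff hq').1 hA
    linarith

end

theorem bdry_diff_subset_closure (A : Set W) : bdry m W \ closure (bdry m W \ A) ⊆ A :=
  fun _ hq => by_contra fun hA => hq.2 (subset_closure ⟨hq.1, hA⟩)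

theorem edge_closure_subset (hA : IsCleanInBdry m A) :
    edge m (closure (bdry m W \ A)) ⊆ edge m A :=
  fun _ hq => ⟨closure_minimal (bdry_diff_subset_closure A) hA.2.1 hq.2, hq.1⟩

/-- The closure of the complement of a clean submanifold of the boundary is clean. -/
theorem IsCleanInBdry.closure_sdiff (hA : IsCleanInBdry m A) :
    IsCleanInBdry m (closure (bdry m W \ A)) := by
  refine ⟨closure_minimal sdiff_subset isClosed_bdry, isClosed_closure, fun p hp => ?_⟩
  have hpA := edge_closure_subset hA hp
  have hpb : p ∈ bdry m W := hA.1 hpA.1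
  obtain ⟨φ, i, h, hps, -⟩ := hA.exists_edgeChart hpA univ_mem
  set c := (φ p).val i with hc
  -- Reflection of coordinate `i` at level `c` exchanges the two sides of the edge; as `i ≠ 0`, it
  -- preserves the half-space.
  let r : EuclideanHalfSpace m → EuclideanHalfSpace m := fun x =>
    toHalf m (setCoord i x.val (2 * c - x.val i))
  have hr : Continuous r := continuous_toHalf.comp (continuous_setCoord continuous_val
    (continuous_const.sub (continuous_valCoord i)))
  have hrv : ∀ x, (r x).val = setCoord i x.val (2 * c - x.val i) := fun x =>
    toHalf_val (by rw [setCoord_ne (Ne.symm h.ne)]; exact x.2)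
  have hrr : ∀ x, r (r x) = x := by
    intro x
    refine Subtype.ext ?_
    rw [hrv, hrv, setCoord_self, setCoord_setCoord, sub_sub_cancel, setCoord_eq]
  let e : EuclideanHalfSpace m ≃ₜ EuclideanHalfSpace m := ⟨⟨r, r, hrr, hrr⟩, hr, hr⟩
  have hmem : φ.trans e.toOpenPartialHomeomorph ∈ plCharts m W := by
    refine chart_trans_mem h.mem _ fun y _ => ?_
    refine AffineSelection.congr (AffineSelection.refl.setCoord
      ((RealSelection.const (c := 2 * c)).sub (.coord i)) i) .rfl (.of_forall fun q => ?_)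
    exact (hrv q).symm
  refine ⟨_, hmem, by simpa using hps, i, fun q hq => ?_⟩
  have hqs : q ∈ φ.source := by simpa using hq.1
  change _ ↔ (r (φ p)).val i ≤ (r (φ q)).val i
  rw [hrv, hrv, setCoord_self, setCoord_self, h.mem_closure_iff ⟨hqs, hq.2⟩, ← hc]
  constructor <;> intro h <;> linarith

/-- The closure of the complement of `A` has the expected interior. -/
theorem mem_iff_notMem_interior (hA : IsCleanInBdry m A) {q : W} (hq : q ∈ bdry m W) :
    q ∈ A ↔ q ∉ closure (bdry m W \ A) \ edge m (closure (bdry m W \ A)) := by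
  constructor
  · rintro hqA ⟨h1, h2⟩
    obtain ⟨φ, i, h, hps, -⟩ := hA.exists_edgeChart ⟨hqA, h1⟩ univ_mem
    exact h2 ⟨h1, (h.mem_closure_compl_iff ⟨hps, hq⟩).2 le_rfl⟩
  · intro h
    by_contra hqA
    exact h ⟨subset_closure ⟨hq, hqA⟩, fun he => hqA (edge_closure_subset hA he).1⟩

/-- A neighborhood of `A` in the boundary which deforms to `A` away from `D`. -/
structure IsEnlargement (A D A' : Set W) : Prop where
  clean : IsCleanInBdry m A'
  sub : A ⊆ A'
  disj : Disjoint A' D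
  deforms : ∃ H, Deforms A A' H ∧ ∀ x ∈ A' \ (A \ edge m A), ∀ t, H (x, t) ∈ A' \ (A \ edge m A)

/-- A homotopy equivalence from a clean submanifold of the boundary to a compact manifold yields a
relative h-cobordism. -/
theorem exists_complement [T2Space W] [CompactSpace W]
    {A' : Set W} (hA' : IsEnlargement (m := m) A D A')
    (hint : Disjoint A (closure (bdry m W \ A')))
    (hDb : D ⊆ bdry m W) (h : InclIsHEquiv A univ) :
    ∃ B, IsCleanInBdry m B ∧ D ⊆ B ∧ Disjoint A B ∧ Disjoint D (edge m B) ∧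
      InclIsPairHEquiv A (edge m A) univ
        (bdry m W \ ((A \ edge m A) ∪ (B \ edge m B))) := by
  obtain ⟨hc, hsub, hdisj, H, hH, hHV⟩ := hA'
  -- With `B` the closure of the complement of `A'`, the edge of `B` lies in `A'`, which misses `D`.
  refine ⟨closure (bdry m W \ A'), hc.closure_sdiff, fun x hx => subset_closure ⟨hDb hx,
    fun h => Set.disjoint_left.1 hdisj h hx⟩, hint,
    (hdisj.mono_left fun x hx => (edge_closure_subset hc hx).1).symm, ?_⟩
  have e : bdry m W \ ((A \ edge m A) ∪ (closure (bdry m W \ A') \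
      edge m (closure (bdry m W \ A')))) = A' \ (A \ edge m A) := by
    ext q
    constructor
    · rintro ⟨hq, hn⟩
      exact ⟨(mem_iff_notMem_interior hc hq).2 fun h => hn (.inr h), fun h => hn (.inl h)⟩
    · rintro ⟨hq, hn⟩
      refine ⟨hc.1 hq, ?_⟩
      rintro (h | h)
      exacts [hn h, (mem_iff_notMem_interior hc (hc.1 hq)).1 hq h]
  rw [e]
  -- `K` retracts `W` onto `A'` and fixes `A'`, in particular `V`; the second stage `H` preserves
  -- `V` by the definition of an enlargement.
  obtain ⟨K, hK⟩ := (hc.isNDR hc.2.1.isCompact).isSDR (h.of_isSDR_left ⟨H, hH⟩ (subset_univ _))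
  have hV : ∀ x ∈ (A' \ (A \ edge m A)), ∀ t,
      concatH K H (x, t) ∈ A' \ (A \ edge m A) := fun x hx t =>
    concatH_mem hK (fun x hx t => by rw [hK.fixed x hx.1.1]; exact hx.1)
      (fun x hx t => hHV x hx.1 t) x ⟨hx, mem_univ x⟩ t
  exact (hK.trans hH).inclIsPairHEquiv inter_subset_left
    (fun x hx => ⟨hsub hx.1, fun h => h.2 hx⟩) hV
    fun x hx => by_contra fun h => hx.1.2 ⟨hx.2, h⟩

end EdgeCharts

/-! ### A PL push of the half-space along its boundary -/

section Push

variable {m : ℕ} [NeZero m]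

/-- A bump function supported on a cube. -/
noncomputable def bump (c : EuclideanSpace ℝ (Fin m)) (ε : ℝ) (x : EuclideanSpace ℝ (Fin m)) : ℝ :=
  max 0 (ε - supDist x c)

theorem bump_nonneg (c : EuclideanSpace ℝ (Fin m)) (ε : ℝ) (x : EuclideanSpace ℝ (Fin m)) :
    0 ≤ bump c ε x := le_max_left _ _

theorem continuous_bump (c : EuclideanSpace ℝ (Fin m)) (ε : ℝ) : Continuous (bump c ε) :=
  continuous_const.max (continuous_const.sub (continuous_supDist c))

theorem abs_bump_sub_le (c : EuclideanSpace ℝ (Fin m)) (ε : ℝ) (x y : EuclideanSpace ℝ (Fin m)) :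
    |bump c ε x - bump c ε y| ≤ supDist x y := by
  unfold bump
  rw [max_comm 0, max_comm 0]
  refine (abs_max_sub_max_le_abs _ _ _).trans ?_
  rw [sub_sub_sub_cancel_left, abs_sub_comm]
  have h : x.ofLp - c.ofLp - (y.ofLp - c.ofLp) = x.ofLp - y.ofLp := sub_sub_sub_cancel_right _ _ _
  have := abs_norm_sub_norm_le (x.ofLp - c.ofLp) (y.ofLp - c.ofLp)
  rwa [h] at this

theorem bump_eq_zero {c x : EuclideanSpace ℝ (Fin m)} {ε : ℝ} (h : ε ≤ supDist x c) :
    bump c ε x = 0 := max_eq_left (by linarith)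

theorem bump_pos {c x : EuclideanSpace ℝ (Fin m)} {ε : ℝ} (h : supDist x c < ε) :
    0 < bump c ε x := lt_max_of_lt_right (by linarith)

theorem supDist_le_norm (x y : EuclideanSpace ℝ (Fin m)) : supDist x y ≤ ‖x - y‖ :=
  (supDist_le_iff (norm_nonneg _)).2 fun k => PiLp.norm_apply_le (x - y) k

theorem supDist_le_abs {x y : EuclideanSpace ℝ (Fin m)} {i : Fin m} (h : ∀ k ≠ i, x k = y k) :
    supDist x y ≤ |x i - y i| := by
  refine (supDist_le_iff (abs_nonneg _)).2 fun k => ?_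
  by_cases hk : k = i
  · rw [hk]
  · rw [h k hk, sub_self, abs_zero]; exact abs_nonneg _

/-- The push along a coordinate direction. -/
noncomputable def push (c : EuclideanSpace ℝ (Fin m)) (i : Fin m) (ε : ℝ)
    (x : EuclideanSpace ℝ (Fin m)) : EuclideanSpace ℝ (Fin m) :=
  setCoord i x (x i - bump c ε x / 2)

/-- The bump is 1-Lipschitz, so half of it perturbs the identity by a map with Lipschitz constant
`1/2`. The push is therefore a homeomorphism, without an explicit inverse. -/
theorem approximatesLinearOn_push (c : EuclideanSpace ℝ (Fin m)) (i : Fin m) (ε : ℝ) :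
    ApproximatesLinearOn (push c i ε) ((ContinuousLinearEquiv.refl ℝ (EuclideanSpace ℝ (Fin m))) :
      EuclideanSpace ℝ (Fin m) →L[ℝ] EuclideanSpace ℝ (Fin m)) univ (1 / 2) := by
  intro x _ y _
  have e : push c i ε x - push c i ε y - (x - y) =
      EuclideanSpace.single i (-(bump c ε x - bump c ε y) / 2) := by
    refine PiLp.ext fun k => ?_
    by_cases hk : k = i
    · subst hk
      simp only [push, PiLp.sub_apply, setCoord_self, PiLp.single_apply, if_true]
      ring
    · simp only [push, PiLp.sub_apply, setCoord_ne hk, PiLp.single_apply, hk, if_false]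
      ring
  change ‖push c i ε x - push c i ε y - (x - y)‖ ≤ _
  rw [e, PiLp.norm_single, Real.norm_eq_abs, abs_div, abs_neg, abs_two]
  have h1 := (abs_bump_sub_le c ε x y).trans (supDist_le_norm x y)
  simp only [NNReal.coe_div, NNReal.coe_one, NNReal.coe_ofNat]
  linarith

/-- The push as a homeomorphism. -/
noncomputable def pushHomeoE (c : EuclideanSpace ℝ (Fin m)) (i : Fin m) (ε : ℝ) :
    EuclideanSpace ℝ (Fin m) ≃ₜ EuclideanSpace ℝ (Fin m) :=
  (approximatesLinearOn_push c i ε).toHomeomorph _ (by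
    right
    have : Nontrivial (EuclideanSpace ℝ (Fin m)) := by
      refine ⟨EuclideanSpace.single 0 1, 0, fun h => ?_⟩
      have := congrArg norm h
      simp at this
    have e : ‖((ContinuousLinearEquiv.refl ℝ (EuclideanSpace ℝ (Fin m))).symm :
        EuclideanSpace ℝ (Fin m) →L[ℝ] EuclideanSpace ℝ (Fin m))‖₊ = 1 := by
      simp
    rw [e, inv_one]
    exact NNReal.half_lt_self one_ne_zero)

theorem pushHomeoE_apply (c : EuclideanSpace ℝ (Fin m)) (i : Fin m) (ε : ℝ)
    (x : EuclideanSpace ℝ (Fin m)) : pushHomeoE c i ε x = push c i ε x := rfl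

/-- The push of the half-space along a coordinate direction of the boundary. -/
noncomputable def pushHomeo (c : EuclideanSpace ℝ (Fin m)) {i : Fin m} (hi : i ≠ 0) (ε : ℝ) :
    EuclideanHalfSpace m ≃ₜ EuclideanHalfSpace m :=
  (pushHomeoE c i ε).subtype fun x => by
    rw [pushHomeoE_apply, push, setCoord_ne (Ne.symm hi)]

variable (c : EuclideanSpace ℝ (Fin m)) {i : Fin m} (hi : i ≠ 0) (ε : ℝ)

theorem pushHomeo_val (y : EuclideanHalfSpace m) :
    (pushHomeo c hi ε y).val = setCoord i y.val (y.val i - bump c ε y.val / 2) := rfl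

theorem pushHomeo_symm_ne (y : EuclideanHalfSpace m) {k : Fin m} (hk : k ≠ i) :
    ((pushHomeo c hi ε).symm y).val k = y.val k := by
  conv_rhs => rw [← (pushHomeo c hi ε).apply_symm_apply y, pushHomeo_val, setCoord_ne hk]

theorem pushHomeo_symm_self (y : EuclideanHalfSpace m) :
    y.val i = ((pushHomeo c hi ε).symm y).val i -
      bump c ε ((pushHomeo c hi ε).symm y).val / 2 := by
  conv_lhs => rw [← (pushHomeo c hi ε).apply_symm_apply y, pushHomeo_val, setCoord_self]

theorem pushHomeo_fix {y : EuclideanHalfSpace m} (hy : bump c ε y.val = 0) :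
    pushHomeo c hi ε y = y := by
  refine Subtype.ext ?_
  rw [pushHomeo_val, hy, zero_div, sub_zero, setCoord_eq]

/-- Here the supremum distance matters: it is a maximum of the absolute values of coordinate
differences, so the bump is piecewise affine. -/
theorem affineSelection_pushHomeo {X : Type*} {l : Filter X} (y : X → EuclideanHalfSpace m) :
    AffineSelection m l (fun q => (y q).val) (fun q => (pushHomeo c hi ε (y q)).val) := by
  simp only [pushHomeo_val]
  refine AffineSelection.refl.setCoord ((RealSelection.coord i).sub ?_) i
  have h1 : RealSelection m l (fun q => (y q).val) fun q => supDist (y q).val c := by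
    refine RealSelection.sup (v := fun q => WithLp.toLp 2 fun k => |(y q).val k - c k|)
      (fun k => ((RealSelection.coord k).sub (.const (c k))).abs) fun q => ?_
    obtain ⟨k, -, hk⟩ := Finset.exists_mem_eq_sup' (s := (Finset.univ : Finset (Fin m)))
      ⟨0, Finset.mem_univ _⟩ (fun k => |(y q).val k - c k|)
    refine ⟨k, le_antisymm ?_ (abs_sub_le_supDist _ _ k)⟩
    refine (supDist_le_iff (abs_nonneg _)).2 fun j => ?_
    exact (Finset.le_sup' (fun k => |(y q).val k - c k|) (Finset.mem_univ j)).trans hk.le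
  refine ((((RealSelection.const 0).max ((RealSelection.const ε).sub h1)).const_mul (1 / 2))).congr
    (.of_forall fun q => ?_)
  simp only [bump]; ring

/-- Raising the pushed coordinate back towards the level `c i`. -/
noncomputable def slide (c : EuclideanSpace ℝ (Fin m)) (i : Fin m) (ε t : ℝ)
    (y : EuclideanHalfSpace m) : EuclideanHalfSpace m :=
  toHalf m (setCoord i y.val
    (max (y.val i) (min (c i) (y.val i + max 0 (min 1 t) * bump c ε y.val))))

include hi in
theorem slide_val (t : ℝ) (y : EuclideanHalfSpace m) : (slide c i ε t y).val =
    setCoord i y.val (max (y.val i) (min (c i) (y.val i + max 0 (min 1 t) * bump c ε y.val))) :=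
  toHalf_val (by rw [setCoord_ne (Ne.symm hi)]; exact y.2)

theorem continuous_slide (i : Fin m) :
    Continuous fun p : ℝ × EuclideanHalfSpace m => slide c i ε p.1 p.2 := by
  unfold slide
  have h1 : Continuous fun p : ℝ × EuclideanHalfSpace m => p.2.val i :=
    (continuous_valCoord i).comp continuous_snd
  have h2 : Continuous fun p : ℝ × EuclideanHalfSpace m => bump c ε p.2.val :=
    (continuous_bump c ε).comp (continuous_val.comp continuous_snd)
  exact continuous_toHalf.comp (continuous_setCoord (continuous_val.comp continuous_snd)
    (by fun_prop))

include hi in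
theorem slide_fix {t : ℝ} {y : EuclideanHalfSpace m}
    (h : t ≤ 0 ∨ bump c ε y.val = 0 ∨ c i ≤ y.val i) : slide c i ε t y = y := by
  refine Subtype.ext ?_
  rw [slide_val c hi]
  have e : max (y.val i) (min (c i) (y.val i + max 0 (min 1 t) * bump c ε y.val)) = y.val i := by
    refine max_eq_left ?_
    rcases h with h | h | h
    · rw [max_eq_left ((min_le_right _ _).trans h)]; simp
    · rw [h]; simp
    · exact (min_le_left _ _).trans h
  rw [e, setCoord_eq]

/-- The points that are pushed across the level can slide back. -/
theorem le_add_bump {y : EuclideanHalfSpace m} (h : c i ≤ ((pushHomeo c hi ε).symm y).val i) :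
    c i ≤ y.val i + bump c ε y.val := by
  have h1 := pushHomeo_symm_self c hi ε y
  set x := (pushHomeo c hi ε).symm y
  -- `x` and `y` are `bump x / 2` apart and the bump is 1-Lipschitz, so `bump y` is at least `bump x
  -- / 2`, which equals `x i - y i`.
  have h2 := abs_bump_sub_le c ε x.val y.val
  have h3 : supDist x.val y.val ≤ |x.val i - y.val i| :=
    supDist_le_abs fun k hk => pushHomeo_symm_ne c hi ε y hk
  have h4 := bump_nonneg c ε x.val
  have e : x.val i - y.val i = bump c ε x.val / 2 := by linarith
  rw [e, abs_of_nonneg (by linarith)] at h3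
  have := (abs_le.1 (h2.trans h3)).2
  linarith

/-- The inverse push is monotone along the coordinate direction. -/
theorem pushHomeo_symm_mono {y y' : EuclideanHalfSpace m} (hy : ∀ k ≠ i, y'.val k = y.val k)
    (hle : y.val i ≤ y'.val i) :
    ((pushHomeo c hi ε).symm y).val i ≤ ((pushHomeo c hi ε).symm y').val i := by
  have h1 := pushHomeo_symm_self c hi ε y
  have h2 := pushHomeo_symm_self c hi ε y'
  have h5 : ∀ k ≠ i, ((pushHomeo c hi ε).symm y).val k = ((pushHomeo c hi ε).symm y').val k :=
    fun k hk => by rw [pushHomeo_symm_ne c hi ε y hk, pushHomeo_symm_ne c hi ε y' hk, hy k hk]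
  set x := (pushHomeo c hi ε).symm y
  set x' := (pushHomeo c hi ε).symm y'
  by_contra hlt
  have h3 := (abs_bump_sub_le c ε x.val x'.val).trans (supDist_le_abs h5)
  rw [abs_of_pos (a := x.val i - x'.val i) (by linarith)] at h3
  have := (abs_le.1 h3).2
  linarith

theorem le_pushHomeo_symm (y : EuclideanHalfSpace m) :
    y.val i ≤ ((pushHomeo c hi ε).symm y).val i := by
  have h1 := pushHomeo_symm_self c hi ε y
  have h4 := bump_nonneg c ε ((pushHomeo c hi ε).symm y).val
  linarith

/-- If `y` were not moved, the bump would vanish at its preimage, which would then be a fixed point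
and equal to `y`. -/
theorem lt_pushHomeo_symm {y : EuclideanHalfSpace m} (h : 0 < bump c ε y.val) :
    y.val i < ((pushHomeo c hi ε).symm y).val i := by
  have h1 := pushHomeo_symm_self c hi ε y
  refine lt_of_le_of_ne (le_pushHomeo_symm c hi ε y) fun e => ?_
  have h0 : bump c ε ((pushHomeo c hi ε).symm y).val = 0 := by linarith
  have h2 := pushHomeo_fix c hi ε h0
  rw [Homeomorph.apply_symm_apply] at h2
  rw [← h2] at h0
  exact h.ne' h0

end Push

/-! ### Enlarging a clean submanifold inside the boundary -/

section Enlarge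

variable {m : ℕ} [NeZero m] {W : Type*} [TopologicalSpace W]
  [ChartedSpace (EuclideanHalfSpace m) W] [HasGroupoid W (plGroupoid m)] {A D : Set W}

/-- A self-homeomorphism that is piecewise linear in charts. -/
def IsPLHomeo (m : ℕ) [NeZero m] {W : Type*} [TopologicalSpace W]
    [ChartedSpace (EuclideanHalfSpace m) W] (Ψ : W ≃ₜ W) : Prop :=
  ∀ q, AffineSelection m (𝓝 q) (fun x => (chartAt (EuclideanHalfSpace m) q x).val)
    (fun x => (chartAt (EuclideanHalfSpace m) (Ψ q) (Ψ x)).val)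

/-- Carrying charts along `Ψ` requires the inverse of `Ψ` to be PL, which `AffineSelection.symm`
provides. -/
theorem IsPLHomeo.symm_trans_mem {Ψ : W ≃ₜ W} (hΨ : IsPLHomeo m Ψ)
    {χ : OpenPartialHomeomorph W (EuclideanHalfSpace m)} (hχ : χ ∈ plCharts m W) :
    Ψ.symm.toOpenPartialHomeomorph.trans χ ∈ plCharts m W := by
  refine mem_plCharts fun p hp =>
    ⟨chartAt _ p, chartAt_mem_plCharts p, mem_chart_source _ p, ?_⟩
  have hb : Ψ.symm p ∈ χ.source := by simpa using hp
  have h1 := hΨ (Ψ.symm p)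
  rw [Ψ.apply_symm_apply] at h1
  have h2 := (affineSelection_of_mem hχ (chartAt_mem_plCharts (Ψ.symm p)) hb
    (mem_chart_source _ _)).trans h1
  have hU : Ψ ⁻¹' (chartAt (EuclideanHalfSpace m) p).source ∈ 𝓝 (Ψ.symm p) :=
    ((chartAt (EuclideanHalfSpace m) p).open_source.preimage Ψ.continuous).mem_nhds (by
      rw [mem_preimage, Ψ.apply_symm_apply]; exact mem_chart_source _ p)
  have h3 := AffineSelection.symm hU hb
    ((chart_val_continuousOn _).comp Ψ.continuous.continuousOn fun _ h => h)
    (fun a ha b hb hab => Ψ.injective (chart_val_injOn _ ha hb hab)) h2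
  refine (h3.comp_tendsto Ψ.symm.continuous.continuousAt).congr (.of_forall fun q => ?_) .rfl
  simp

theorem IsPLHomeo.mem_bdry_iff {Ψ : W ≃ₜ W} (hΨ : IsPLHomeo m Ψ) {p : W} :
    Ψ p ∈ bdry m W ↔ p ∈ bdry m W := by
  have h1 := hΨ.symm_trans_mem (chartAt_mem_plCharts p)
  rw [PLTop.mem_bdry_iff h1 (p := Ψ p) (by simp), mem_bdry_iff_chartAt]
  simp

theorem IsPLHomeo.image_bdry {Ψ : W ≃ₜ W} (hΨ : IsPLHomeo m Ψ) : Ψ '' bdry m W = bdry m W := by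
  ext p
  constructor
  · rintro ⟨q, hq, rfl⟩
    exact hΨ.mem_bdry_iff.2 hq
  · intro hp
    exact ⟨Ψ.symm p, hΨ.mem_bdry_iff.1 (by rwa [Ψ.apply_symm_apply]), Ψ.apply_symm_apply p⟩

theorem IsPLHomeo.image_closure_sdiff {Ψ : W ≃ₜ W} (hΨ : IsPLHomeo m Ψ) (A : Set W) :
    Ψ '' closure (bdry m W \ A) = closure (bdry m W \ Ψ '' A) := by
  rw [Ψ.image_closure, image_sdiff Ψ.injective, hΨ.image_bdry]

theorem mem_image_homeomorph {X : Type*} [TopologicalSpace X] {Ψ : X ≃ₜ X} {A : Set X} {q : X} :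
    q ∈ Ψ '' A ↔ Ψ.symm q ∈ A := by
  rw [Ψ.image_eq_preimage_symm, mem_preimage]

theorem IsCleanInBdry.image {Ψ : W ≃ₜ W} (hΨ : IsPLHomeo m Ψ) (hA : IsCleanInBdry m A) :
    IsCleanInBdry m (Ψ '' A) := by
  refine ⟨?_, Ψ.isClosedMap _ hA.2.1, ?_⟩
  · rintro _ ⟨a, ha, rfl⟩
    exact hΨ.mem_bdry_iff.2 (hA.1 ha)
  · rintro _ ⟨⟨b, hb, rfl⟩, hb'⟩
    rw [← hΨ.image_closure_sdiff, Ψ.injective.mem_set_image] at hb'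
    obtain ⟨χ, hχ, hbχ, i, hi⟩ := hA.2.2 b ⟨hb, hb'⟩
    refine ⟨_, hΨ.symm_trans_mem hχ, by simpa using hbχ, i, fun q hq => ?_⟩
    have hqs : Ψ.symm q ∈ χ.source := by simpa using hq.1
    have hqb : Ψ.symm q ∈ bdry m W := hΨ.mem_bdry_iff.1 (by
      rw [Ψ.apply_symm_apply]; exact hq.2)
    rw [mem_image_homeomorph, hi _ ⟨hqs, hqb⟩]
    simp

/-- A homeomorphism of the half-space that is supported on a compact subset of the target of a
chart extends to the manifold. -/
theorem exists_chartHomeo [T2Space W] (φ : OpenPartialHomeomorph W (EuclideanHalfSpace m))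
    {C : Set (EuclideanHalfSpace m)} (hC : IsCompact C) (hCt : C ⊆ φ.target)
    (g : EuclideanHalfSpace m ≃ₜ EuclideanHalfSpace m) (hg : ∀ y ∉ C, g y = y) :
    ∃ Ψ : W ≃ₜ W, (∀ x ∈ φ.source, Ψ x ∈ φ.source ∧ φ (Ψ x) = g (φ x)) ∧
      (∀ x ∈ φ.source, Ψ.symm x ∈ φ.source ∧ φ (Ψ.symm x) = g.symm (φ x)) ∧
      ∀ x, (x ∈ φ.source → φ x ∉ C) → Ψ x = x := by
  have hg' : ∀ y ∉ C, g.symm y = y := fun y hy => by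
    rw [Homeomorph.symm_apply_eq, hg y hy]
  have hm : ∀ y ∈ C, g y ∈ C := fun y hy => by
    by_contra h
    have := g.injective (hg _ h)
    exact h (this.symm ▸ hy)
  have hm' : ∀ y ∈ C, g.symm y ∈ C := fun y hy => by
    by_contra h
    have := g.symm.injective (hg' _ h)
    exact h (this.symm ▸ hy)
  have ht : ∀ y ∈ φ.target, g y ∈ φ.target := fun y hy => by
    by_cases h : y ∈ C
    · exact hCt (hm y h)
    · rwa [hg y h]
  have ht' : ∀ y ∈ φ.target, g.symm y ∈ φ.target := fun y hy => by
    by_cases h : y ∈ C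
    · exact hCt (hm' y h)
    · rwa [hg' y h]
  have key : ∀ (g₁ g₂ : EuclideanHalfSpace m → EuclideanHalfSpace m),
      (∀ y ∈ φ.target, g₁ y ∈ φ.target) → (∀ y, g₂ (g₁ y) = y) →
      ∀ x, chartExtend φ g₂ (chartExtend φ g₁ x) = x := by
    intro g₁ g₂ h1 h2 x
    by_cases hx : x ∈ φ.source
    · have h3 := h1 _ (φ.map_source hx)
      rw [chartExtend_of_mem hx, chartExtend_of_mem (φ.map_target h3), φ.right_inv h3, h2,
        φ.left_inv hx]
    · rw [chartExtend_of_eq (g := g₁) fun h => absurd h hx,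
        chartExtend_of_eq fun h => absurd h hx]
  have hcont : ∀ g₁ : EuclideanHalfSpace m → EuclideanHalfSpace m, Continuous g₁ →
      (∀ y ∉ C, g₁ y = y) → (∀ y ∈ C, g₁ y ∈ C) → Continuous (chartExtend φ g₁) := by
    intro g₁ h1 h2 h3
    exact (continuous_chartExtend φ hC hCt (g := fun (_ : Unit) => g₁) (h1.comp continuous_snd)
      (fun _ => h2) fun _ => h3).comp (continuous_id.prodMk (continuous_const (y := ())))
  refine ⟨⟨⟨chartExtend φ g, chartExtend φ g.symm, key g g.symm ht g.symm_apply_apply,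
    key g.symm g ht' g.apply_symm_apply⟩, hcont g g.continuous hg hm,
    hcont g.symm g.symm.continuous hg' hm'⟩, fun x hx => ?_, fun x hx => ?_, fun x hx => ?_⟩
  · change chartExtend φ g x ∈ _ ∧ φ (chartExtend φ g x) = _
    have := ht _ (φ.map_source hx)
    rw [chartExtend_of_mem hx, φ.right_inv this]
    exact ⟨φ.map_target this, rfl⟩
  · change chartExtend φ g.symm x ∈ _ ∧ φ (chartExtend φ g.symm x) = _
    have := ht' _ (φ.map_source hx)
    rw [chartExtend_of_mem hx, φ.right_inv this]
    exact ⟨φ.map_target this, rfl⟩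
  · exact chartExtend_of_eq fun h => hg _ (hx h)

/-- Near an edge point, `A` can be pushed outwards in the boundary. -/
theorem IsCleanInBdry.exists_push [T2Space W] (hA : IsCleanInBdry m A) (hD : IsClosed D)
    {p : W} (hp : p ∈ edge m A) (hpD : p ∉ D) : ∃ (Ψ : W ≃ₜ W) (U : Set W), U ∈ 𝓝 p ∧
      IsPLHomeo m Ψ ∧ (∀ x ∈ D, Ψ x = x) ∧ A ⊆ Ψ '' A ∧ (∀ b ∈ edge m A, Ψ b ∈ A → Ψ b = b) ∧
      (∀ a ∈ A ∩ U, a ∉ closure (bdry m W \ Ψ '' A)) ∧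
      ∃ H, Deforms A (Ψ '' A) H ∧
        ∀ x ∈ Ψ '' A \ (A \ edge m A), ∀ t, H (x, t) ∈ Ψ '' A \ (A \ edge m A) := by
  obtain ⟨φ, i, hφ, hps, hφD⟩ := hA.exists_edgeChart hp (hD.isOpen_compl.mem_nhds hpD)
  obtain ⟨ε, hε, hC⟩ := exists_cube_subset (φ.open_target.mem_nhds (φ.map_source hps))
  set c := (φ p).val with hc
  have hi := hφ.ne
  set C : Set (EuclideanHalfSpace m) := {x | supDist x.val c ≤ ε} with hCdef
  have hb0 : ∀ y ∉ C, bump c ε y.val = 0 := fun y hy => bump_eq_zero (not_le.1 hy).le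
  set g := pushHomeo c hi ε with hg
  obtain ⟨Ψ, h1, h2, h3⟩ := exists_chartHomeo φ (isCompact_cube c ε) hC g
    fun y hy => pushHomeo_fix c hi ε (hb0 y hy)
  have hK : IsClosed (φ.symm '' C) := ((isCompact_cube c ε).image_of_continuousOn
    (φ.continuousOn_symm.mono hC)).isClosed
  have hΨ : IsPLHomeo m Ψ := by
    intro q
    by_cases hq : q ∈ φ.source
    · have a1 := affineSelection_of_mem (chartAt_mem_plCharts q) hφ.mem (mem_chart_source _ q) hq
      have a2 := (affineSelection_of_mem hφ.mem (chartAt_mem_plCharts (Ψ q)) (h1 q hq).1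
        (mem_chart_source _ _)).comp_tendsto Ψ.continuous.continuousAt
      have a3 : AffineSelection m (𝓝 q) (fun x => (φ x).val) (fun x => (φ (Ψ x)).val) := by
        refine (affineSelection_pushHomeo c hi ε φ).congr .rfl ?_
        filter_upwards [φ.open_source.mem_nhds hq] with x hx
        rw [(h1 x hx).2]
      exact (a1.trans a3).trans a2
    · have hq' : q ∉ φ.symm '' C := by
        rintro ⟨y, hy, rfl⟩
        exact hq (φ.map_target (hC hy))
      have e : ∀ x ∉ φ.symm '' C, Ψ x = x := fun x hx =>
        h3 x fun hs hxC => hx ⟨_, hxC, φ.left_inv hs⟩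
      refine AffineSelection.refl.congr .rfl ?_
      filter_upwards [hK.isOpen_compl.mem_nhds hq'] with x hx
      rw [e q hq', e x hx]
  have hmem : ∀ x ∈ φ.source ∩ bdry m W, x ∈ Ψ '' A ↔ c i ≤ (g.symm (φ x)).val i := by
    intro x hx
    have hb : Ψ.symm x ∈ bdry m W := hΨ.mem_bdry_iff.1 (by rw [Ψ.apply_symm_apply]; exact hx.2)
    rw [← (h2 x hx.1).2, ← hφ.iff _ ⟨(h2 x hx.1).1, hb⟩, mem_image_homeomorph]
  have hfix : ∀ x ∉ φ.source, Ψ x = x := fun x hx => h3 x fun h => absurd h hx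
  have hsub : A ⊆ Ψ '' A := by
    intro a ha
    by_cases has : a ∈ φ.source
    · exact (hmem a ⟨has, hA.1 ha⟩).2
        (((hφ.iff a ⟨has, hA.1 ha⟩).1 ha).trans (le_pushHomeo_symm c hi ε _))
    · exact ⟨a, ha, hfix a has⟩
  have hsub' : Ψ '' A ⊆ bdry m W := (IsCleanInBdry.image hΨ hA).1
  have himg : ∀ x ∈ Ψ '' A, x ∉ φ.source → x ∈ A := by
    rintro _ ⟨a, ha, rfl⟩ hs
    have : a ∉ φ.source := fun h => hs (h1 a h).1
    rwa [hfix a this]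
  refine ⟨Ψ, φ.source ∩ {x | supDist (φ x).val c < ε}, ?_, hΨ, ?_, hsub, ?_, ?_, ?_⟩
  · refine inter_mem (φ.open_source.mem_nhds hps) ?_
    have a1 : ContinuousAt (fun x => supDist (φ x).val c) p :=
      ((continuous_supDist c).comp continuous_val).continuousAt.comp (φ.continuousAt hps)
    refine a1.eventually_lt continuousAt_const ?_
    change supDist c c < ε
    rwa [supDist_self]
  · exact fun x hx => hfix x fun h => hφD h hx
  -- An edge point has level `c i` and is lowered by half its bump; to land in `A` its bump must be
  -- `0`.
  · intro b hb hΨb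
    by_cases hbs : b ∈ φ.source
    · have hbb := hA.1 hb.1
      have e1 := (hφ.mem_edge_iff ⟨hbs, hbb⟩).1 hb
      have e2 := (hφ.iff _ ⟨(h1 b hbs).1, hΨ.mem_bdry_iff.2 hbb⟩).1 hΨb
      rw [(h1 b hbs).2, pushHomeo_val, setCoord_self, e1] at e2
      have e3 := bump_nonneg c ε (φ b).val
      have e4 : bump c ε (φ b).val = 0 := by linarith
      refine φ.injOn (h1 b hbs).1 hbs ?_
      rw [(h1 b hbs).2]
      exact pushHomeo_fix c hi ε e4
    · exact hfix b hbs
  -- Where the bump is positive the inverse push raises coordinate `i` strictly, so `a` lies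
  -- strictly inside `Ψ '' A`.
  · rintro a ⟨ha, has, haε⟩ hcl
    have e1 := (hφ.iff a ⟨has, hA.1 ha⟩).1 ha
    have e2 : c i < (g.symm (φ a)).val i := e1.trans_lt (lt_pushHomeo_symm c hi ε (bump_pos haε))
    have hcont : ContinuousAt (fun x => (g.symm (φ x)).val i) a :=
      ((continuous_valCoord i).comp g.symm.continuous).continuousAt.comp (φ.continuousAt has)
    obtain ⟨r, hr, hrs, hr2⟩ := ((mem_closure_iff_frequently.1 hcl).and_eventually
      ((φ.open_source.eventually_mem has).and (continuousAt_const.eventually_lt hcont e2))).exists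
    exact hr.2 ((hmem r ⟨hrs, hr.1⟩).2 hr2.le)
  -- The pushed-out part is deformed back by sliding it up to the level `c i`; `le_add_bump` shows
  -- that it arrives by time `1`.
  · let s : ℝ → EuclideanHalfSpace m → EuclideanHalfSpace m := slide c i ε
    have hsv := slide_val c hi ε
    have hsC : ∀ t, ∀ y ∈ C, s t y ∈ C := by
      intro t y hy
      rw [hCdef, mem_ofPred_eq, supDist_le_iff hε.le] at hy ⊢
      intro k
      simp only [s, hsv]
      by_cases hk : k = i
      · subst hk
        rw [setCoord_self]
        have hk := abs_le.1 (hy k)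
        have hb := mul_nonneg (le_max_left 0 (min 1 t)) (bump_nonneg c ε y.val)
        rw [abs_le]
        constructor
        · linarith [le_max_left (y.val k)
            (min (c k) (y.val k + max 0 (min 1 t) * bump c ε y.val))]
        · have : max (y.val k) (min (c k) (y.val k + max 0 (min 1 t) * bump c ε y.val)) ≤ c k + ε :=
            max_le (by linarith) ((min_le_left _ _).trans (by linarith))
          linarith
      · rw [setCoord_ne hk]; exact hy k
    have hst : ∀ t, ∀ y ∈ φ.target, s t y ∈ φ.target := by
      intro t y hy
      by_cases h : y ∈ C
      · exact hC (hsC t y h)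
      · rw [show s t y = y from slide_fix c hi ε (.inr (.inl (hb0 y h)))]; exact hy
    let H : W × ℝ → W := fun q => chartExtend φ (s q.2) q.1
    have hH : Continuous H := continuous_chartExtend φ (isCompact_cube c ε) hC
      (continuous_slide c ε i) (fun t y hy => slide_fix c hi ε (.inr (.inl (hb0 y hy)))) hsC
    have hHs : ∀ x ∈ φ.source, ∀ t, H (x, t) ∈ φ.source ∧ φ (H (x, t)) = s t (φ x) := by
      intro x hx t
      have := hst t _ (φ.map_source hx)
      simp only [H]
      rw [chartExtend_of_mem hx, φ.right_inv this]
      exact ⟨φ.map_target this, rfl⟩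
    have hHb : ∀ x ∈ φ.source ∩ bdry m W, ∀ t, H (x, t) ∈ bdry m W := by
      intro x hx t
      rw [PLTop.mem_bdry_iff hφ.mem (hHs x hx.1 t).1, (hHs x hx.1 t).2]
      simp only [s, hsv]
      rw [setCoord_ne (Ne.symm hi)]
      exact (PLTop.mem_bdry_iff hφ.mem hx.1).1 hx.2
    have hHfix : ∀ x ∈ A, ∀ t, H (x, t) = x := fun x hx t => chartExtend_of_eq fun hs =>
      slide_fix c hi ε (.inr (.inr ((hφ.iff x ⟨hs, hA.1 hx⟩).1 hx)))
    have hHmaps : ∀ x ∈ Ψ '' A, ∀ t, H (x, t) ∈ Ψ '' A := by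
      intro x hx t
      by_cases hs : x ∈ φ.source
      · have hxb := hsub' hx
        rw [hmem _ ⟨(hHs x hs t).1, hHb x ⟨hs, hxb⟩ t⟩, (hHs x hs t).2]
        refine ((hmem x ⟨hs, hxb⟩).1 hx).trans (pushHomeo_symm_mono c hi ε (fun k hk => ?_) ?_)
        · simp only [s, hsv]; rw [setCoord_ne hk]
        · simp only [s, hsv]; rw [setCoord_self]; exact le_max_left _ _
      · rw [hHfix x (himg x hx hs)]; exact hx
    refine ⟨H, ⟨hsub, hH.continuousOn, hHmaps, ?_, ?_, ?_, hHfix⟩, ?_⟩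
    · exact fun x _ t ht => chartExtend_of_eq fun _ => slide_fix c hi ε (.inl ht)
    · intro x _ t ht
      have : s t = s 1 := by
        funext y
        simp only [s, slide]
        rw [min_eq_left ht, min_self]
      simp only [H, this]
    · intro x hx
      by_cases hs : x ∈ φ.source
      · have hxb := hsub' hx
        rw [hφ.iff _ ⟨(hHs x hs 1).1, hHb x ⟨hs, hxb⟩ 1⟩, (hHs x hs 1).2]
        simp only [s, hsv]
        rw [setCoord_self, min_self, max_eq_right zero_le_one, one_mul,
          min_eq_left (le_add_bump c hi ε ((hmem x ⟨hs, hxb⟩).1 hx))]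
        exact le_max_right _ _
      · rw [hHfix x (himg x hx hs)]; exact himg x hx hs
    -- A point that starts below the level `c i` never rises above it, so it can reach `A` only
    -- along the edge.
    · rintro x ⟨hx, hxA⟩ t
      refine ⟨hHmaps x hx t, ?_⟩
      by_cases hA' : x ∈ A
      · rwa [hHfix x hA' t]
      have hs : x ∈ φ.source := by_contra fun h => hA' (himg x hx h)
      have hxb := hsub' hx
      rintro ⟨hin, hne⟩
      rw [hφ.iff x ⟨hs, hxb⟩, not_le] at hA'
      have hy := (hHs x hs t).2
      refine hne ((hφ.mem_edge_iff ⟨(hHs x hs t).1, hHb x ⟨hs, hxb⟩ t⟩).2 (le_antisymm ?_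
        ((hφ.iff _ ⟨(hHs x hs t).1, hHb x ⟨hs, hxb⟩ t⟩).1 hin)))
      rw [hy]
      simp only [s, hsv]
      rw [setCoord_self]
      exact max_le hA'.le (min_le_left _ _)

theorem Deforms.image_homeomorph {X : Type*} [TopologicalSpace X] (Ψ : X ≃ₜ X) {S T : Set X}
    {H : X × ℝ → X} (h : Deforms S T H) :
    Deforms (Ψ '' S) (Ψ '' T) fun q => Ψ (H (Ψ.symm q.1, q.2)) where
  sub := image_mono h.sub
  cont := Ψ.continuous.comp_continuousOn (h.cont.comp (by fun_prop) fun q hq =>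
    ⟨mem_image_homeomorph.1 hq.1, mem_univ _⟩)
  maps x hx t := mem_image_of_mem Ψ (h.maps _ (mem_image_homeomorph.1 hx) t)
  zero x hx t ht := by
    simp only [h.zero _ (mem_image_homeomorph.1 hx) t ht, Ψ.apply_symm_apply]
  one x hx t ht := by simp only [h.one _ (mem_image_homeomorph.1 hx) t ht]
  mem x hx := mem_image_of_mem Ψ (h.mem _ (mem_image_homeomorph.1 hx))
  fixed x hx t := by simp only [h.fixed _ (mem_image_homeomorph.1 hx) t, Ψ.apply_symm_apply]

/-- An enlargement can be made larger near any given edge point. -/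
theorem IsCleanInBdry.exists_isEnlargement_step [T2Space W] (hA : IsCleanInBdry m A)
    (hD : IsClosed D) {p : W} (hp : p ∈ edge m A) (hpD : p ∉ D) : ∃ U ∈ 𝓝 p, ∀ A',
      IsEnlargement (m := m) A D A' → ∃ A'', IsEnlargement (m := m) A D A'' ∧
        (∀ a ∈ A, a ∉ closure (bdry m W \ A') → a ∉ closure (bdry m W \ A'')) ∧
        ∀ a ∈ A ∩ U, a ∉ closure (bdry m W \ A'') := by
  obtain ⟨Ψ, U, hU, hΨ, hΨD, hsub, hedge, hint, H, hH, hHV⟩ := hA.exists_push hD hp hpD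
  refine ⟨U, hU, fun A' hA' => ⟨Ψ '' A', ⟨hA'.clean.image hΨ, hsub.trans (image_mono hA'.sub), ?_,
    ?_⟩, ?_, fun a ha hcl => hint a ha (closure_mono (sdiff_subset_sdiff_right
    (image_mono hA'.sub)) hcl)⟩⟩
  · rw [Set.disjoint_left]
    rintro _ ⟨b, hb, rfl⟩ hbD
    have : Ψ b = b := Ψ.injective (hΨD _ hbD)
    exact Set.disjoint_left.1 hA'.disj hb (this ▸ hbD)
  · obtain ⟨K, hK, hKV⟩ := hA'.deforms
    -- `Ψ '' A'` is deformed onto `Ψ '' A` by the conjugate of the old deformation, and then onto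
    -- `A` by the slide.
    have hK' := hK.image_homeomorph Ψ
    refine ⟨_, hK'.trans hH, fun x hx => concatH_mem hK' ?_ ?_ x ⟨hx, hx.1⟩⟩
    · rintro x ⟨⟨hx, hxA⟩, -⟩ t
      by_cases hxΨ : x ∈ Ψ '' A
      · rw [hK'.fixed x hxΨ t]
        exact ⟨hx, hxA⟩
      -- If the conjugated path enters `A`, the old path is at that moment in `A` but not in its
      -- interior, hence on the edge. By `hedge` the push fixes that point, so the new path is on
      -- the edge too.
      · have hb : Ψ.symm x ∈ A' \ (A \ edge m A) :=
          ⟨mem_image_homeomorph.1 hx, fun h => hxΨ (mem_image_homeomorph.2 h.1)⟩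
        have hb' := hKV _ hb t
        refine ⟨mem_image_of_mem Ψ hb'.1, fun h => ?_⟩
        have hbA : K (Ψ.symm x, t) ∈ A := (Ψ.injective.mem_set_image).1 (hsub h.1)
        have hbe : K (Ψ.symm x, t) ∈ edge m A := by_contra fun hne => hb'.2 ⟨hbA, hne⟩
        have e := hedge _ hbe h.1
        exact h.2 (by rw [e]; exact hbe)
    · rintro x ⟨⟨-, hxA⟩, hx⟩ t
      have := hHV x ⟨hx, hxA⟩ t
      exact ⟨image_mono hA'.sub this.1, this.2⟩
  · intro a ha hcl hcl'
    obtain ⟨b, hb, rfl⟩ := hsub ha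
    rw [← hΨ.image_closure_sdiff, Ψ.injective.mem_set_image] at hcl'
    -- A point of `A` that is not interior to the new enlargement comes from an edge point, which
    -- `Ψ` fixes; so it was not interior to `A'` either.
    have hbe : b ∈ edge m A := ⟨hb, closure_mono (sdiff_subset_sdiff_right hA'.sub) hcl'⟩
    have e := hedge b hbe ha
    rw [e] at hcl
    exact hcl hcl'

/-- Enlargements whose interior contains `A` exist. -/
theorem IsCleanInBdry.exists_isEnlargement [T2Space W] (hA : IsCleanInBdry m A)
    (hAc : IsCompact A) (hD : IsClosed D) (hAD : Disjoint A D) :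
    ∃ A', IsEnlargement (m := m) A D A' ∧ Disjoint A (closure (bdry m W \ A')) := by
  have h0 : IsEnlargement (m := m) A D A := ⟨hA, subset_rfl, hAD, _, Deforms.refl A, fun _ hx _ => hx⟩
  have key : ∀ A', IsEnlargement (m := m) A D A' → ∃ A'', IsEnlargement (m := m) A D A'' ∧
        (∀ a ∈ A, a ∉ closure (bdry m W \ A') → a ∉ closure (bdry m W \ A'')) ∧
        ∀ a ∈ A, a ∈ A → a ∉ closure (bdry m W \ A'') := by
    -- Compactness reduces to one point at a time. Quantifying over all enlargements `A'` lets the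
    -- local steps be performed one after the other.
    refine hAc.induction_on (p := fun s => ∀ A', IsEnlargement (m := m) A D A' →
      ∃ A'', IsEnlargement (m := m) A D A'' ∧
        (∀ a ∈ A, a ∉ closure (bdry m W \ A') → a ∉ closure (bdry m W \ A'')) ∧
        ∀ a ∈ A, a ∈ s → a ∉ closure (bdry m W \ A'')) ?_ ?_ ?_ ?_
    · exact fun A' h => ⟨A', h, fun _ _ h => h, fun _ _ h => h.elim⟩
    · intro s t hst ht A' h
      obtain ⟨A'', h1, h2, h3⟩ := ht A' h
      exact ⟨A'', h1, h2, fun a ha has => h3 a ha (hst has)⟩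
    · intro s t hs ht A' h
      obtain ⟨A₁, h1, h2, h3⟩ := hs A' h
      obtain ⟨A₂, h1', h2', h3'⟩ := ht A₁ h1
      refine ⟨A₂, h1', fun a ha h => h2' a ha (h2 a ha h), ?_⟩
      rintro a ha (has | hat)
      exacts [h2' a ha (h3 a ha has), h3' a ha hat]
    · intro p hp
      by_cases he : p ∈ edge m A
      · obtain ⟨U, hU, h⟩ := hA.exists_isEnlargement_step hD he (Set.disjoint_left.1 hAD hp)
        refine ⟨U, mem_nhdsWithin_of_mem_nhds hU, fun A' hA' => ?_⟩
        obtain ⟨A'', h1, h2, h3⟩ := h A' hA'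
        exact ⟨A'', h1, h2, fun a ha haU => h3 a ⟨ha, haU⟩⟩
      · have hn : p ∉ closure (bdry m W \ A) := fun h => he ⟨hp, h⟩
        refine ⟨_, mem_nhdsWithin_of_mem_nhds (isClosed_closure.isOpen_compl.mem_nhds hn),
          fun A' hA' => ⟨A', hA', fun _ _ h => h, fun a _ ha hcl => ha ?_⟩⟩
        exact closure_mono (sdiff_subset_sdiff_right hA'.sub) hcl
  obtain ⟨A', h1, -, h3⟩ := key A h0
  exact ⟨A', h1, Set.disjoint_left.2 fun a ha => h3 a ha ha⟩

end Enlarge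

/-! ### The layers of a pseudo-collar form a concatenation -/

section Layers

variable {m : ℕ} [NeZero m] {M : Type u} [TopologicalSpace M]
  [ChartedSpace (EuclideanHalfSpace m) M] [HasGroupoid M (plGroupoid m)] [T2Space M]
  [SecondCountableTopology M]

/-- The cobordism between two nested homotopy collars. -/
theorem IsHomotopyCollar.exists_cobordism {N N' : Set M} (hN : IsHomotopyCollar m N)
    (hN' : IsHomotopyCollar m N') (hsub : N' ⊆ interior N) :
    ∃ (c : RelCobordism.{u} m) (κ : c.W → M), IsEmbedding κ ∧ range κ = N \ interior N' ∧
      κ '' c.A = frontier N ∧ κ ⁻¹' frontier N' ⊆ c.B ∧ IsCleanInBdry m (κ ⁻¹' frontier N') ∧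
      Disjoint (κ ⁻¹' frontier N') (edge m c.B) ∧ c.PairHEquivA ∧ InclIsHEquiv c.A univ ∧
      ∀ x, AffineSelection m (𝓝 x) (fun q => (chartAt (EuclideanHalfSpace m) x q).val)
          (fun q => (chartAt (EuclideanHalfSpace m) (κ x) (κ q)).val) ∧
        AffineSelection m (𝓝 x) (fun q => (chartAt (EuclideanHalfSpace m) (κ x) (κ q)).val)
          (fun q => (chartAt (EuclideanHalfSpace m) x q).val) := by
  have hfr := hN.1.1.frontier_sdiff hN'.1.1 hsub
  have hcl := hN.1.1.sdiff hN'.1.1 hsub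
  set Q := N \ interior N' with hQ
  obtain ⟨i1, i2, hs1, hs2, hbd, hF⟩ := hcl.exists_chartedSpace
  -- The layer is closed in `closure N'ᶜ`, the complement of the interior of `N'`, which is compact.
  have hcomp : CompactSpace Q := isCompact_iff_compactSpace.1
    (hN'.1.2.of_isClosed_subset hcl.1 (by rw [closure_compl]; exact inter_subset_right))
  have hdis : Disjoint (frontier N) (frontier N') := Set.disjoint_left.2 fun p h h' =>
    h.2 (hsub (hN'.1.1.1.frontier_subset h'))
  have hA : IsCleanInBdry m (Subtype.val ⁻¹' frontier N : Set Q) := by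
    refine hF _ (hfr ▸ subset_union_left) isClosed_frontier ?_
    rw [hfr, union_sdiff_cancel_left hdis.le_bot]
    exact isClosed_frontier
  have hD : IsCleanInBdry m (Subtype.val ⁻¹' frontier N' : Set Q) := by
    refine hF _ (hfr ▸ subset_union_right) isClosed_frontier ?_
    rw [hfr, union_sdiff_cancel_right hdis.le_bot]
    exact isClosed_frontier
  have hAD : Disjoint (Subtype.val ⁻¹' frontier N : Set Q) (Subtype.val ⁻¹' frontier N') :=
    hdis.preimage _
  have himg : Subtype.val '' (Subtype.val ⁻¹' frontier N : Set Q) = frontier N := by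
    rw [Subtype.image_preimage_coe]
    exact inter_eq_right.2 ((hfr ▸ subset_union_left).trans hcl.1.frontier_subset)
  have hequiv : InclIsHEquiv (Subtype.val ⁻¹' frontier N : Set Q) univ := by
    refine .of_image IsEmbedding.subtypeVal ?_
    rw [himg, image_univ, Subtype.range_coe]
    exact hN.inclIsHEquiv_sdiff hN' hsub
  obtain ⟨A', hA', hint⟩ := hA.exists_isEnlargement hA.2.1.isCompact hD.2.1 hAD
  obtain ⟨B, hB, hDB, hAB, hDe, hpair⟩ := exists_complement hA' hint hD.1 hequiv
  exact ⟨{ W := Q, A := _, B := B, cleanA := hA, cleanB := hB, disj := hAB }, Subtype.val,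
    IsEmbedding.subtypeVal, Subtype.range_coe, himg, hDB, hD, hDe, hpair, hequiv,
    fun x => ⟨hs1 x, hs2 x⟩⟩

/-- The cobordism between two nested homotopy collars, as a one-element disjoint union. -/
theorem IsHomotopyCollar.exists_disjUnion {N N' : Set M} (hN : IsHomotopyCollar m N)
    (hN' : IsHomotopyCollar m N') (hsub : N' ⊆ interior N) :
    ∃ (c : RelCobordism.{u} m) (κ : DisjUnion (fun _ : Fin 1 => c) → M), IsClosedEmbedding κ ∧
      range κ = N \ interior N' ∧ κ '' unionA (fun _ => c) = frontier N ∧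
      κ ⁻¹' frontier N' ⊆ unionB (fun _ => c) ∧ IsCleanInBdry m (κ ⁻¹' frontier N') ∧
      Disjoint (κ ⁻¹' frontier N') (edge m (unionB (fun _ : Fin 1 => c))) ∧ c.PairHEquivA ∧
      InclIsHEquiv c.A univ ∧
      ∀ x, AffineSelection m (𝓝 x) (fun q => (chartAt (EuclideanHalfSpace m) x q).val)
          (fun q => (chartAt (EuclideanHalfSpace m) (κ x) (κ q)).val) ∧
        AffineSelection m (𝓝 x) (fun q => (chartAt (EuclideanHalfSpace m) (κ x) (κ q)).val)
          (fun q => (chartAt (EuclideanHalfSpace m) x q).val) := by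
  obtain ⟨c, κ, h1, h2, h3, h4, h5, h6, h7, h8, h9⟩ := hN.exists_cobordism hN' hsub
  -- Cobordisms need not be connected, so the whole layer can serve as a single summand.
  refine ⟨c, fun p => κ p.2, ?_, ?_, ?_, fun p hp => h4 hp, ?_, ?_, h7, h8, ?_⟩
  · refine Continuous.isClosedEmbedding (continuous_sigma fun _ => h1.continuous) ?_
    rintro ⟨j, x⟩ ⟨j', y⟩ e
    obtain rfl := Subsingleton.elim j j'
    exact congrArg (Sigma.mk j) (h1.injective e)
  · rw [← h2]
    ext p
    exact ⟨fun ⟨x, hx⟩ => ⟨x.2, hx⟩, fun ⟨x, hx⟩ => ⟨⟨0, x⟩, hx⟩⟩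
  · rw [← h3]
    ext p
    exact ⟨fun ⟨x, hx, e⟩ => ⟨x.2, hx, e⟩, fun ⟨x, hx, e⟩ => ⟨⟨0, x⟩, hx, e⟩⟩
  · exact isCleanInBdry_sigma _ fun _ => h5
  · rw [Set.disjoint_left]
    rintro ⟨j, x⟩ hx hx'
    exact Set.disjoint_left.1 h6 hx (summand_mem_edge (fun _ : Fin 1 => c) hx')
  · rintro ⟨j, x⟩
    rw [show (⟨j, x⟩ : DisjUnion fun _ : Fin 1 => c) = summand (fun _ => c) j x from rfl,
      nhds_summand, affineSelection_map_iff, affineSelection_map_iff]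
    have e : (fun q => (chartAt (EuclideanHalfSpace m) (summand (fun _ : Fin 1 => c) j x)
        (summand (fun _ => c) j q)).val) = fun q => (chartAt (EuclideanHalfSpace m) x q).val :=
      funext fun q => congrArg Subtype.val (chartAt_summand (fun _ : Fin 1 => c) j x q)
    refine ⟨(h9 x).1.congr (.of_forall fun q => (congrFun e q).symm) .rfl,
      (h9 x).2.congr .rfl (.of_forall fun q => (congrFun e q).symm)⟩

/-- The identification of two embedded subsets with the same image. -/
noncomputable def homeoOfImageEq {X Y Z : Type*} [TopologicalSpace X] [TopologicalSpace Y]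
    [TopologicalSpace Z] {f : X → Z} {g : Y → Z} (hf : IsEmbedding f) (hg : IsEmbedding g)
    {S : Set X} {T : Set Y} (e : f '' S = g '' T) : S ≃ₜ T :=
  ((hf.homeomorphImage S).trans (Homeomorph.setCongr e)).trans (hg.homeomorphImage T).symm

theorem homeoOfImageEq_apply {X Y Z : Type*} [TopologicalSpace X] [TopologicalSpace Y]
    [TopologicalSpace Z] {f : X → Z} {g : Y → Z} (hf : IsEmbedding f) (hg : IsEmbedding g)
    {S : Set X} {T : Set Y} (e : f '' S = g '' T) (x : S) : g (homeoOfImageEq hf hg e x) = f x := by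
  have h1 : ∀ y : g '' T, g ((hg.homeomorphImage T).symm y) = y := fun y =>
    congrArg Subtype.val ((hg.homeomorphImage T).apply_symm_apply y)
  exact h1 _

theorem homeoOfImageEq_symm_apply {X Y Z : Type*} [TopologicalSpace X] [TopologicalSpace Y]
    [TopologicalSpace Z] {f : X → Z} {g : Y → Z} (hf : IsEmbedding f) (hg : IsEmbedding g)
    {S : Set X} {T : Set Y} (e : f '' S = g '' T) (y : T) :
    f ((homeoOfImageEq hf hg e).symm y) = g y := by
  rw [← homeoOfImageEq_apply hf hg e, Homeomorph.apply_symm_apply]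

omit [HasGroupoid M (plGroupoid m)] [T2Space M] [SecondCountableTopology M] in
/-- A map that is the identity on the points of an ambient manifold is piecewise linear. -/
theorem isPL_of_ambient {X Y : Type*} [TopologicalSpace X] [TopologicalSpace Y]
    [ChartedSpace (EuclideanHalfSpace m) X] [ChartedSpace (EuclideanHalfSpace m) Y]
    {f : X → M} {g : Y → M} {S : Set X} {k : S → Y} (hk : Continuous k)
    (e : ∀ x, g (k x) = f x)
    (hf : ∀ x, AffineSelection m (𝓝 x) (fun q => (chartAt (EuclideanHalfSpace m) x q).val)
      (fun q => (chartAt (EuclideanHalfSpace m) (f x) (f q)).val))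
    (hg : ∀ x, AffineSelection m (𝓝 x)
      (fun q => (chartAt (EuclideanHalfSpace m) (g x) (g q)).val)
      (fun q => (chartAt (EuclideanHalfSpace m) x q).val)) : IsPL m k := by
  refine ⟨hk, fun p => ((hf p).comp_tendsto continuous_subtype_val.continuousAt).trans ?_⟩
  refine ((hg (k p)).comp_tendsto hk.continuousAt).congr (.of_forall fun q => ?_) .rfl
  simp only [e]

/-- Every pseudo-collar realizes a concatenation of relative h-cobordisms. -/
theorem IsPseudoCollar.exists_realizes {N : Set M} (hN : IsPseudoCollar m N) :
    ∃ (C : Concatenation.{u} m) (e : C.Space → M), C.Realizes N e ∧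
      (∀ i j, (C.cob i j).PairHEquivA) ∧
      ∀ i, Disjoint (C.D i) (edge m (unionB (C.cob i))) := by
  obtain ⟨S, hS0, hS, hSS, hlf⟩ := hN.exists_seq
  choose c κ h1 h2 h3 h4 h5 h6 h7 h8 h9 using fun i =>
    (hS i).exists_disjUnion (hS (i + 1)) (hSS i)
  -- The frontier of `S (i + 1)` is the terminal end of layer `i` and the initial end of layer `i +
  -- 1`; the gluing map is the identity of these points of `M`.
  have himg : ∀ i, κ i '' (κ i ⁻¹' frontier (S (i + 1))) =
      κ (i + 1) '' unionA (fun _ : Fin 1 => c (i + 1)) := by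
    intro i
    rw [h3, image_preimage_eq_inter_range, h2, inter_eq_left]
    exact fun p hp => ⟨interior_subset (hSS i ((hS (i + 1)).1.1.1.frontier_subset hp)), hp.2⟩
  let h : ∀ i, (κ i ⁻¹' frontier (S (i + 1)) : Set _) ≃ₜ
      unionA (fun _ : Fin 1 => c (i + 1)) := fun i =>
    homeoOfImageEq (h1 i).isEmbedding (h1 (i + 1)).isEmbedding (himg i)
  have hh : ∀ i x, κ (i + 1) (h i x) = κ i x := fun i x => homeoOfImageEq_apply _ _ _ x
  have hh' : ∀ i x, κ i ((h i).symm x) = κ (i + 1) x := fun i x => homeoOfImageEq_symm_apply _ _ _ x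
  let C : Concatenation.{u} m :=
    { k := fun _ => 1
      cob := fun i _ => c i
      oneSided := fun i _ => .inl (h7 i)
      hequiv := fun i _ => h8 i
      D := fun i => κ i ⁻¹' frontier (S (i + 1))
      D_sub := h4
      D_clean := h5
      h := h
      h_pl := fun i => isPL_of_ambient (continuous_subtype_val.comp (h i).continuous) (hh i)
        (fun x => (h9 i x).1) fun x => (h9 (i + 1) x).2
      h_symm_pl := fun i => isPL_of_ambient (continuous_subtype_val.comp (h i).symm.continuous)
        (hh' i) (fun x => (h9 (i + 1) x).1) fun x => (h9 i x).2 }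
  have hanti : Antitone S := antitone_nat_of_succ_le fun i => (hSS i).trans interior_subset
  have hsub : ∀ i x, κ i x ∈ S i ∧ κ i x ∉ interior (S (i + 1)) := fun i x =>
    (h2 i).subset (mem_range_self x)
  let e : C.Space → M := Quot.lift (fun x => κ x.1 x.2) (by
    rintro _ _ ⟨i, b⟩
    exact (hh i b).symm)
  have hcont : Continuous e :=
    continuous_quot_lift _ (continuous_sigma fun i => (h1 i).continuous)
  -- Layers whose indices differ by more than one are disjoint, and consecutive layers meet only in
  -- the frontier of `S (i + 1)`, which has been glued.
  have hinj' : ∀ i j x y, i ≤ j → κ i x = κ j y → C.piece i x = C.piece j y := by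
    intro i j x y hij hxy
    rcases hij.eq_or_lt with rfl | hlt
    · rw [(h1 i).injective hxy]
    · have hj : j = i + 1 := by
        by_contra hne
        have : S j ⊆ S (i + 1 + 1) := hanti (by omega)
        exact (hsub i x).2 (hSS (i + 1) (this (hxy ▸ (hsub j y).1)))
      subst hj
      have hx : x ∈ κ i ⁻¹' frontier (S (i + 1)) :=
        ⟨subset_closure (hxy ▸ (hsub (i + 1) y).1), (hsub i x).2⟩
      have hy : (h i ⟨x, hx⟩ : DisjUnion fun _ : Fin 1 => c (i + 1)) = y :=
        (h1 (i + 1)).injective ((hh i ⟨x, hx⟩).trans hxy)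
      rw [← hy]
      exact Quot.sound (Concatenation.Glue.glue (C := C) i ⟨x, hx⟩)
  have hinj : Function.Injective e := by
    rintro ⟨i, x⟩ ⟨j, y⟩ hxy
    rcases le_total i j with hij | hij
    · exact hinj' i j x y hij hxy
    · exact (hinj' j i y x hij hxy.symm).symm
  have hlf' : LocallyFinite fun i => S i := by
    intro p
    obtain ⟨U, hU, n, hn⟩ := hlf p
    refine ⟨U, hU, (finite_Iio n).subset fun i hi => ?_⟩
    by_contra hni
    exact (Set.not_disjoint_iff_nonempty_inter.2 hi) (hn i (not_lt (α := ℕ).1 hni))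
  -- The image of a closed set is a locally finite union of closed sets, one in each layer.
  have hclosed : IsClosedMap e := by
    intro T hT
    have : e '' T = ⋃ i, κ i '' (C.piece i ⁻¹' T) := by
      ext p
      rw [mem_iUnion]
      constructor
      · rintro ⟨⟨i, x⟩, hx, rfl⟩
        exact ⟨i, x, hx, rfl⟩
      · rintro ⟨i, x, hx, rfl⟩
        exact ⟨_, hx, rfl⟩
    rw [this]
    refine (hlf'.subset fun i => ?_).isClosed_iUnion fun i =>
      (h1 i).isClosedMap _ (hT.preimage (C.isChain_piece.emb i).continuous)
    rintro _ ⟨x, -, rfl⟩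
    exact (hsub i x).1
  refine ⟨C, e, ⟨hN.1.1, (IsClosedEmbedding.of_continuous_injective_isClosedMap hcont hinj
    hclosed).isEmbedding, ?_, fun i => ?_, ?_⟩, fun i _ => h7 i, h6⟩
  · ext p
    constructor
    · rintro ⟨⟨i, x⟩, rfl⟩
      exact hS0 ▸ hanti (Nat.zero_le i) (hsub i x).1
    · intro hp
      -- The least such `i` is the index of a layer containing `p`: by minimality, or by `S 0 = N`,
      -- the point is still in `S i`.
      have hex : ∃ i, p ∉ S (i + 1) := by
        obtain ⟨U, hU, n, hn⟩ := hlf p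
        exact ⟨n, fun h => Set.disjoint_left.1 (hn (n + 1) (by omega)) h (mem_of_mem_nhds hU)⟩
      classical
      have hi := Nat.find_spec hex
      have hi' : p ∈ S (Nat.find hex) := by
        rcases hj : Nat.find hex with _ | j
        · exact hS0.symm ▸ hp
        · exact not_not.1 (Nat.find_min hex (by omega : j < Nat.find hex))
      obtain ⟨x, hx⟩ := (h2 (Nat.find hex)).symm.subset ⟨hi', fun h => hi (interior_subset h)⟩
      exact ⟨C.piece _ x, hx⟩
  · exact ⟨(h1 i).continuous.comp continuous_subtype_val, fun p =>
      (h9 i p.1).1.comp_tendsto continuous_subtype_val.continuousAt⟩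
  · exact (h3 0).trans (by rw [hS0])

end Layers

end PLTop

theorem mainTheorem7 (m : ℕ) [NeZero m] :
    (∀ C : PLTop.Concatenation.{u} m,
      (∃ (M : Type u) (_ : TopologicalSpace M) (_ : ChartedSpace (EuclideanHalfSpace m) M)
          (_ : HasGroupoid M (PLTop.plGroupoid m)) (_ : T2Space M)
          (_ : SecondCountableTopology M) (N : Set M) (e : C.Space → M), C.Realizes N e) ∧
      ∀ (M : Type u) [TopologicalSpace M] [ChartedSpace (EuclideanHalfSpace m) M]
        [HasGroupoid M (PLTop.plGroupoid m)] [T2Space M] [SecondCountableTopology M]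
        (N : Set M) (e : C.Space → M), C.Realizes N e → PLTop.IsPseudoCollar m N) ∧
    (∀ (M : Type u) [TopologicalSpace M] [ChartedSpace (EuclideanHalfSpace m) M]
      [HasGroupoid M (PLTop.plGroupoid m)] [T2Space M] [SecondCountableTopology M]
      (N : Set M), PLTop.IsPseudoCollar m N →
      ∃ (C : PLTop.Concatenation.{u} m) (e : C.Space → M), C.Realizes N e ∧
        (∀ i j, (C.cob i j).PairHEquivA) ∧
        ∀ i, Disjoint (C.D i) (PLTop.edge m (PLTop.unionB (C.cob i)))) :=
  ⟨fun C => ⟨C.exists_realizes, fun _ _ _ _ _ _ _ _ h => h.isPseudoCollar⟩, fun _ _ _ _ _ _ _ h => h.exists_realizes⟩
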